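/- **Setting.** Let $\varepsilon>0$ and $A\in\mathbb R$. Let $\mathcal G_1^\varepsilon$ be the $\varepsilon$-periodic tubular metric graph with vertices $b_n,t_n$ ($n\in\mathbb Z$) and, for every $n$, four edges of length $\varepsilon$: the horizontal edges $b_n\to b_{n+1}$ and $t_n\to t_{n+1}$, and two parallel edges $b_n\to t_n$. Let $\Delta_\varepsilon(A)$ be the magnetic Laplacian $-\left(\frac{d}{dx}+i a_e\right)^2$ on the edges $e$ of $\mathcal G_1^\varepsilon$, where the potential $a_e$ equals $A/\varepsilon$ on the edges $b_n\to b_{n+1}$, $-A/\varepsilon$ on the edges $t_n\to t_{n+1}$ and $0$ on the other edges (thus, as is customary here, the parameter $A$ is the magnetic potential multiplied by $\varepsilon$). Its domain consists of all $f\in W^2_2(\mathcal G_1^\varepsilon)$ that are continuous on the graph and satisfy the Kirchhoff condition at each vertex: the outgoing magnetic derivatives $f'+i a_e f$ at the origins of the edges leaving the vertex, minus the magnetic derivatives at the ends of the edges entering it, sum to $0$. For $t\in\mathbb R$ let $\widetilde\Delta_\varepsilon(A,t)$ be the fibre at the quasimomentum $t$, i.e. the operator defined in the same way on the quotient of $\mathcal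 G_1^\varepsilon$ by the translations $n\mapsto n+1$ (two vertices, one loop at each of them, and two parallel edges joining them), with the potential increased by $t$ on the two loops. A *spectral band* of $\Delta_\varepsilon(A)$ is a connected component of $\sigma(\Delta_\varepsilon(A))$ that is not a single point; bands are numbered $1,2,3,\dots$ from left to right. An edge $z_0$ (the minimum of the spectrum or an endpoint of a band) is called *of order $m$* if $z_0\in\sigma(\widetilde\Delta_\varepsilon(A,t_0))$ for some $t_0\in\mathbb R$ and, for every such $t_0$, the set $\{(t,z): z\in\sigma(\widetilde\Delta_\varepsilon(A,t))\}$ coincides near $(t_0,z_0)$ with the graph of a function $E$ (the band function), continuous at $t_0$ with $E(t_0)=z_0$, for which $$\lim_{t\to t_0}\frac{E(t)-z_0}{(t-t_0)^m}=c\quad\text{for some } c\neq0 .$$ The edge is *degenerate* if it is of order $4$, and *non-degenerate* if it is of order $2$. The number $A$ is *critical* if $\cos A=\sin^2A$ or $\cos A=-\sin^2A$. **Theorem.** For all $\varepsilon>0$ and $A\in\mathbb R$ the spectrum of $\Delta_\varepsilon(A)$ has a minimum, and this lower edge of the spectrum is degenerate if and only if $A$ is critical; if $A$ is not critical, it is non-degenerate.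 If $A$ is critical, then for every $n\ge1$ the operator $\Delta_\varepsilon(A)$ has an $n$-th spectral band, which is a compact interval $[\alpha_n,\beta_n]$ with $\alpha_n<\beta_n$; its left edge $\alpha_n$ is degenerate if $n$ is odd, and its right edge $\beta_n$ is degenerate if $n$ is even. -/

import Mathlib

open MeasureTheory Filter Topology

noncomputable section

/-! ### Metric graphs and the magnetic Laplacian -/

/-- An oriented metric graph with vertex set `V` and edge set `E` (loops and multiple edges are
allowed).  The edge `e` runs from `src e` to `tgt e` and is identified with `[0, len e]`. -/
structure MetricGraph (V E : Type) where
  src : E → V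
  tgt : E → V
  len : E → ℝ
  len_pos : ∀ e, 0 < len e
  locallyFinite : ∀ v, {e | src e = v ∨ tgt e = v}.Finite

namespace MetricGraph

variable {V E : Type} (G : MetricGraph V E)

/-- Lebesgue measure on the edge `e`. -/
def edgeMeasure (e : E) : Measure ℝ := volume.restrict (Set.Ioc 0 (G.len e))

/-- The Hilbert space `L²(G)`: the Hilbert sum of the spaces `L²(0, len e)` over all edges. -/
abbrev L2 : Type := lp (fun e : E => Lp ℂ 2 (G.edgeMeasure e)) 2

/-- `f` belongs to the Sobolev space `W²₂(G)`, with first and second edgewise derivatives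
`f₁, f₂ ∈ L²(G)`; here `u e` is the continuously differentiable representative of `f` on the
edge `e` and `u' e` is the absolutely continuous representative of its derivative. -/
structure IsSobolevTwo (f f₁ f₂ : G.L2) (u u' : E → ℝ → ℂ) : Prop where
  repr : ∀ e, (f e : ℝ → ℂ) =ᵐ[G.edgeMeasure e] u e
  repr_deriv : ∀ e, (f₁ e : ℝ → ℂ) =ᵐ[G.edgeMeasure e] u' e
  eq_integral : ∀ e, ∀ x ∈ Set.Icc 0 (G.len e), u e x = u e 0 + ∫ y in (0 : ℝ)..x, u' e y
  deriv_eq_integral : ∀ e, ∀ x ∈ Set.Icc 0 (G.len e),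
    u' e x = u' e 0 + ∫ y in (0 : ℝ)..x, (f₂ e : ℝ → ℂ) y

/-- Continuity at the vertices: at each vertex there is a common value of all edge functions. -/
def IsContinuousAtVertices (u : E → ℝ → ℂ) : Prop :=
  ∃ φ : V → ℂ, ∀ e, u e 0 = φ (G.src e) ∧ u e (G.len e) = φ (G.tgt e)

/-- The sum over all edges of the magnetic co-normal derivatives at the vertex `v`, for a
potential equal to the constant `a e` on each edge `e`.  Outgoing edges contribute
`u'(0) + i a u(0)`, incoming ones `-(u'(len) + i a u(len))`, and a loop contributes both. -/
def conormalSum (a : E → ℝ) (u u' : E → ℝ → ℂ) (v : V) : ℂ :=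
  (∑ᶠ (e : E) (_ : G.src e = v), (u' e 0 + Complex.I * a e * u e 0)) -
    ∑ᶠ (e : E) (_ : G.tgt e = v), (u' e (G.len e) + Complex.I * a e * u e (G.len e))

/-- The graph of the magnetic Laplacian on `L²(G)` with edgewise constant potential `a`: the
pairs `(f, g)` such that `f ∈ W²₂(G)` is continuous on `G` and satisfies the Kirchhoff condition
at every vertex, and `g = -(d/dx + i a)² f = -(f'' + 2 i a f' - a² f)` on every edge. -/
def magneticLaplacian (a : E → ℝ) : Set (G.L2 × G.L2) :=
  {p | ∃ (f₁ f₂ : G.L2) (u u' : E → ℝ → ℂ), G.IsSobolevTwo p.1 f₁ f₂ u u' ∧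
    G.IsContinuousAtVertices u ∧ (∀ v, G.conormalSum a u u' v = 0) ∧
    ∀ e, p.2 e = -(f₂ e + (2 * Complex.I * (a e : ℂ)) • f₁ e - ((a e : ℂ) ^ 2) • p.1 e)}

end MetricGraph

/-- The spectrum of an (unbounded) operator given by its graph `T`.  A number `z` is in the
resolvent set when `T - z` is a bijection from the domain onto `H` with bounded inverse `R`,
that is, `f ∈ dom T` and `(T - z) f = g` hold iff `f = R g`. -/
def operatorSpectrum {H : Type*} [NormedAddCommGroup H] [NormedSpace ℂ H]
    (T : Set (H × H)) : Set ℂ :=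
  {z | ¬ ∃ R : H →L[ℂ] H, ∀ f g : H, (f, g + z • f) ∈ T ↔ f = R g}

/-- The real points of the spectrum (all of it, for a self-adjoint operator). -/
def realSpectrum {H : Type*} [NormedAddCommGroup H] [NormedSpace ℂ H]
    (T : Set (H × H)) : Set ℝ :=
  {x | (x : ℂ) ∈ operatorSpectrum T}

/-! ### The tubular graph -/

/-- The two vertices of the elementary cell. -/
inductive TubeVertex
  | bottom
  | top

/-- The four edges of the elementary cell: two horizontal ones, which lead to the next cell,
and two parallel ones (front and back), which join the two vertices inside the cell. -/
inductive TubeEdge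
  | bottomHorizontal
  | topHorizontal
  | front
  | back

namespace TubeEdge

/-- The origin of an edge of the elementary cell. -/
def src : TubeEdge → TubeVertex
  | bottomHorizontal => .bottom
  | topHorizontal => .top
  | front => .bottom
  | back => .bottom

/-- The end of an edge of the elementary cell, modulo periods. -/
def tgt : TubeEdge → TubeVertex
  | bottomHorizontal => .bottom
  | topHorizontal => .top
  | front => .top
  | back => .top

/-- The number of cells by which an edge moves to the right. -/
def shift : TubeEdge → ℤ
  | bottomHorizontal => 1
  | topHorizontal => 1
  | front => 0
  | back => 0

/-- The magnetic potential with parameter `A`: opposite signs on the two horizontal edges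
(both oriented to the right), zero on the other edges. -/
def potential (A : ℝ) : TubeEdge → ℝ
  | bottomHorizontal => A
  | topHorizontal => -A
  | front => 0
  | back => 0

end TubeEdge

instance : Finite TubeEdge :=
  Finite.of_surjective
    (fun n : Fin 4 => ![TubeEdge.bottomHorizontal, .topHorizontal, .front, .back] n) (by
      rintro (_ | _ | _ | _)
      exacts [⟨0, rfl⟩, ⟨1, rfl⟩, ⟨2, rfl⟩, ⟨3, rfl⟩])

/-- The `ε`-periodic tubular graph, all of whose edges have length `ε`; `(n, v)` and `(n, e)` are
the copies of the vertex `v` and of the edge `e` in the `n`-th cell. -/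
def tubularGraph (ε : ℝ) (hε : 0 < ε) : MetricGraph (ℤ × TubeVertex) (ℤ × TubeEdge) where
  src := fun e => (e.1, e.2.src)
  tgt := fun e => (e.1 + e.2.shift, e.2.tgt)
  len := fun _ => ε
  len_pos := fun _ => hε
  locallyFinite := fun v => by
    refine Set.Finite.subset ((Set.finite_Icc (v.1 - 1) v.1).prod
      (Set.finite_univ (α := TubeEdge))) ?_
    rintro ⟨n, e⟩ h
    have hs : e.shift = 0 ∨ e.shift = 1 := by cases e <;> simp [TubeEdge.shift]
    refine ⟨?_, Set.mem_univ _⟩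
    simp only [Set.mem_ofPred_eq, Prod.ext_iff] at h
    simp only [Set.mem_Icc]
    omega

/-- The fundamental graph: the quotient of the tubular graph by translations along its axis. -/
def fundamentalGraph (ε : ℝ) (hε : 0 < ε) : MetricGraph TubeVertex TubeEdge where
  src := TubeEdge.src
  tgt := TubeEdge.tgt
  len := fun _ => ε
  len_pos := fun _ => hε
  locallyFinite := fun _ => Set.toFinite _

/-- The spectrum of the magnetic Laplacian on the `ε`-periodic tubular graph; the potential
is scaled by `ε⁻¹`. -/
def tubeSpectrum (ε : ℝ) (hε : 0 < ε) (A : ℝ) : Set ℝ :=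
  realSpectrum ((tubularGraph ε hε).magneticLaplacian fun e => e.2.potential (A / ε))

/-- The spectrum of the fibre of this operator at the quasimomentum `t`.  The fibre acts on the
fundamental graph, and the potential on the edge `e` is increased by `⟨g_e, t⟩ / l_e`, where
`g_e = ε * shift e` is the lattice vector of the edge and `l_e = ε` its length. -/
def fibreSpectrum (ε : ℝ) (hε : 0 < ε) (A t : ℝ) : Set ℝ :=
  realSpectrum ((fundamentalGraph ε hε).magneticLaplacian
    fun e => e.potential (A / ε) + (ε * e.shift) * t / ε)

/-! ### Spectral bands and degeneracy of their edges -/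

/-- A spectral band of a closed set `S ⊆ ℝ`: a connected component that is not a single point. -/
def IsSpectralBand (S I : Set ℝ) : Prop :=
  ∃ x ∈ S, I = connectedComponentIn S x ∧ I.Nontrivial

/-- `I` is the `n`-th spectral band of `S`, counted from the left and starting with `n = 1`. -/
def IsNthSpectralBand (S : Set ℝ) (n : ℕ) (I : Set ℝ) : Prop :=
  IsSpectralBand S I ∧
    {J | IsSpectralBand S J ∧ ∀ x ∈ J, ∀ y ∈ I, x < y}.encard + 1 = n

/-- `E` is the band function of the family of fibre spectra `S` in a neighbourhood of `(t₀, z₀)`: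
there the set of all `(t, z)` with `z ∈ S t` is the graph of `E`, a function continuous at `t₀`
with `E t₀ = z₀`. -/
def IsBandFunctionNear (S : ℝ → Set ℝ) (t₀ z₀ : ℝ) (E : ℝ → ℝ) : Prop :=
  E t₀ = z₀ ∧ ContinuousAt E t₀ ∧ ∀ᶠ p : ℝ × ℝ in 𝓝 (t₀, z₀), p.2 ∈ S p.1 ↔ p.2 = E p.1

/-- The spectral edge `z₀` has order `m`: it is attained at some quasimomentum, and at every
quasimomentum `t₀` at which it is attained the band function `E` satisfies
`E t - z₀ ∼ c (t - t₀) ^ m` as `t → t₀`, with some `c ≠ 0`. -/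
def IsEdgeOfOrder (S : ℝ → Set ℝ) (m : ℕ) (z₀ : ℝ) : Prop :=
  (∃ t₀, z₀ ∈ S t₀) ∧
    ∀ t₀, z₀ ∈ S t₀ → ∃ E : ℝ → ℝ, IsBandFunctionNear S t₀ z₀ E ∧
      ∃ c : ℝ, c ≠ 0 ∧ Tendsto (fun t => (E t - z₀) / (t - t₀) ^ m) (𝓝[≠] t₀) (𝓝 c)

/-- A spectral edge is degenerate if the band function behaves like `(t - t₀)⁴` there. -/
def IsDegenerateEdge (S : ℝ → Set ℝ) (z₀ : ℝ) : Prop := IsEdgeOfOrder S 4 z₀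

/-- The generic situation: the band function behaves like `(t - t₀)²`. -/
def IsNondegenerateEdge (S : ℝ → Set ℝ) (z₀ : ℝ) : Prop := IsEdgeOfOrder S 2 z₀

/-- The critical values of the magnetic potential. -/
def IsCriticalPotential (A : ℝ) : Prop :=
  Real.cos A = Real.sin A ^ 2 ∨ Real.cos A = -Real.sin A ^ 2

end

/-! The spectral problem is reduced to a difference equation on the vertices. On an edge the phase
`e^{iax}` removes the potential, and the resolvent equation is solved with the fundamental solutions
`C`, `S` of `-w'' = zw`. If `S ε ≠ 0`, that is, if `z` is not a Dirichlet eigenvalue of an edge, the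
Kirchhoff conditions multiplied by `S ε` become a `2 × 2` system for the vertex values whose entries
are commuting polynomials in a shift and its inverse (`IsTube.vertex_equation`). Its symbol at the
phase `e^{iθ}` has determinant `4 * dispersion A c θ`, where `c = C ε`, so `c = cos κ` for `z =
(κ/ε)²`. The tube (shift on `ℤ`) and the fibre (one cell followed by itself) are both instances of
`IsTube`. Where the determinant has no zero on the spectrum of the shift, the system is boundedly
invertible by spectral mapping (`IsTube.notMem_spectrum`). At a zero `r`, a source on a single edge
would give a square summable solution of `ω (σ i) - r ω i = κ δ` with `κ ≠ 0`, which is impossible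
(`IsTube.mem_spectrum`).

Completing the square turns `dispersion A c θ = 0` into `(2c - cos A cos θ)² = 1 + sin² A sin² θ`,
so `c = U(θ)` or `c = -U(θ + π)` with `U = upperBranch A` taking values in `[0, 1]`. As the cosine
decreases, the bottom of the spectrum comes from the maximum of `U`. Put `x = cos θ`, `s = sin² A`;
then `2U = x cos A + √(1 + s(1 - x²))` is concave in `x`, and its derivative at `x = ±1` is `cos A ∓
s`. If `|cos A| < s`, the maximum is at an interior `x`, where `cos` has a simple crossing: order 2
in `θ`. If `|cos A| > s`, it is at `x = ±1` with nonzero slope, and `1 ∓ x` is itself quadratic in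
`θ`: order 2 again. If `|cos A| = s`, the slope vanishes at the endpoint and the order is 4. These
are `isMaxOfOrder_of_lt` and `isMaxOfOrder_of_le`; `isEdgeOfOrder_energyNear` carries the order over
to the energy.

For critical `A`, with `D = |cos A|`, the spectrum away from Dirichlet points is `|cos κ| ∈ [(1 -
D)/2, (1 + D)/2]`: one band in each interval of `κ` of length `π/2`. The edges with `|cos κ| = (1 +
D)/2`, those nearest to a multiple of `π`, come from the maximum of `U`; they are the left edges of
odd bands and the right edges of even ones. The Dirichlet points are countable, hence do not affect
the bands. -/

noncomputable section

/-! ### Absolutely continuous functions and the product rule. -/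

/-- `F` is absolutely continuous on `[0, ℓ]` with derivative `h`. -/
def PrimOn (ℓ : ℝ) (F h : ℝ → ℂ) : Prop :=
  IntervalIntegrable h volume 0 ℓ ∧ ∀ x ∈ Set.Icc 0 ℓ, F x = F 0 + ∫ y in (0 : ℝ)..x, h y

/-- The real statement is applied to the real and the imaginary part, and the two are recombined
with the constant coefficients `1` and `I`. -/
theorem IntervalIntegrable.absolutelyContinuousOnInterval_complex {h : ℝ → ℂ} {a b : ℝ}
    (hh : IntervalIntegrable h volume a b) :
    AbsolutelyContinuousOnInterval (fun x => ∫ y in a..x, h y) a b := by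
  have hre : IntervalIntegrable (fun x => (h x).re) volume a b := ⟨hh.1.re, hh.2.re⟩
  have him : IntervalIntegrable (fun x => (h x).im) volume a b := ⟨hh.1.im, hh.2.im⟩
  have hc : ∀ c : ℂ, AbsolutelyContinuousOnInterval (fun _ : ℝ => c) a b := fun c =>
    ContDiffOn.absolutelyContinuousOnInterval contDiffOn_const
  have h1 := (hre.absolutelyContinuousOnInterval_intervalIntegral (c := a) (by simp)).smul (hc 1)
  have h2 := (him.absolutelyContinuousOnInterval_intervalIntegral (c := a) (by simp)).smul
    (hc Complex.I)
  have key : ∀ x ∈ Set.uIcc a b, ((fun x => ∫ y in a..x, (h y).re) • (fun _ : ℝ => (1 : ℂ)) +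
      (fun x => ∫ y in a..x, (h y).im) • (fun _ : ℝ => Complex.I)) x = ∫ y in a..x, h y := by
    intro x hx
    have hx' : IntervalIntegrable h volume a x := hh.mono_set (Set.uIcc_subset_uIcc_left hx)
    have h1 : ∫ y in a..x, (h y).re = (∫ y in a..x, h y).re :=
      intervalIntegral.intervalIntegral_re hx'
    have h2 : ∫ y in a..x, (h y).im = (∫ y in a..x, h y).im :=
      intervalIntegral.intervalIntegral_im hx'
    simp only [Pi.add_apply, Pi.smul_apply', h1, h2]
    simp [Complex.re_add_im]
  have h3 := h1.add h2
  rw [absolutelyContinuousOnInterval_iff] at h3 ⊢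
  intro ε hε
  obtain ⟨δ, hδ, H⟩ := h3 ε hε
  refine ⟨δ, hδ, fun E hE hs => ?_⟩
  refine lt_of_eq_of_lt (Finset.sum_congr rfl fun i hi => ?_) (H E hE hs)
  rw [key _ (hE.1 i hi).1, key _ (hE.1 i hi).2]

namespace PrimOn

variable {ℓ : ℝ} {F h F₁ h₁ : ℝ → ℂ}

theorem add (H : PrimOn ℓ F h) (H₁ : PrimOn ℓ F₁ h₁) :
    PrimOn ℓ (fun x => F x + F₁ x) (fun x => h x + h₁ x) := by
  refine ⟨H.1.add H₁.1, fun x hx => ?_⟩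
  have hs : Set.uIcc 0 x ⊆ Set.uIcc 0 ℓ :=
    Set.uIcc_subset_uIcc_left (by rw [Set.uIcc_of_le (hx.1.trans hx.2)]; exact hx)
  simp only [intervalIntegral.integral_add (H.1.mono_set hs) (H₁.1.mono_set hs)]
  linear_combination H.2 x hx + H₁.2 x hx

theorem const_mul (c : ℂ) (H : PrimOn ℓ F h) :
    PrimOn ℓ (fun x => c * F x) (fun x => c * h x) := by
  refine ⟨H.1.const_mul c, fun x hx => ?_⟩
  simp only [intervalIntegral.integral_const_mul]
  linear_combination c * H.2 x hx

theorem sub (H : PrimOn ℓ F h) (H₁ : PrimOn ℓ F₁ h₁) :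
    PrimOn ℓ (fun x => F x - F₁ x) (fun x => h x - h₁ x) := by
  simpa [sub_eq_add_neg] using H.add (H₁.const_mul (-1))

theorem const (c : ℂ) : PrimOn ℓ (fun _ => c) (fun _ => 0) :=
  ⟨by simp, fun x _ => by simp⟩

theorem of_integral (hh : IntervalIntegrable h volume 0 ℓ) (c : ℂ) :
    PrimOn ℓ (fun x => c + ∫ y in (0 : ℝ)..x, h y) h :=
  ⟨hh, fun x _ => by simp⟩

theorem congr_ae (hℓ : 0 ≤ ℓ) (H : PrimOn ℓ F h) (hF : ∀ x ∈ Set.Icc 0 ℓ, F x = F₁ x)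
    (hh : h =ᵐ[volume.restrict (Set.Ioc 0 ℓ)] h₁) : PrimOn ℓ F₁ h₁ := by
  refine ⟨H.1.congr_ae (by rwa [Set.uIoc_of_le hℓ]), fun x hx => ?_⟩
  rw [← hF x hx, ← hF 0 ⟨le_rfl, hℓ⟩, H.2 x hx]
  congr 1
  apply intervalIntegral.integral_congr_ae
  rw [Set.uIoc_of_le hx.1]
  rw [EventuallyEq, ae_restrict_iff' measurableSet_Ioc] at hh
  filter_upwards [hh] with y hy hy'
  exact hy ⟨hy'.1, hy'.2.trans hx.2⟩

theorem absolutelyContinuous (H : PrimOn ℓ F h) :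
    AbsolutelyContinuousOnInterval (fun x => F 0 + ∫ y in (0 : ℝ)..x, h y) 0 ℓ := by
  have hc : AbsolutelyContinuousOnInterval (fun _ : ℝ => F 0) 0 ℓ :=
    ContDiffOn.absolutelyContinuousOnInterval contDiffOn_const
  exact hc.add H.1.absolutelyContinuousOnInterval_complex

theorem continuousOn (hℓ : 0 ≤ ℓ) (H : PrimOn ℓ F h) : ContinuousOn F (Set.Icc 0 ℓ) := by
  have h1 := H.absolutelyContinuous.continuousOn
  rw [Set.uIcc_of_le hℓ] at h1
  exact h1.congr fun x hx => H.2 x hx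

theorem intervalIntegrable (hℓ : 0 ≤ ℓ) (H : PrimOn ℓ F h) : IntervalIntegrable F volume 0 ℓ := by
  apply ContinuousOn.intervalIntegrable
  rw [Set.uIcc_of_le hℓ]
  exact H.continuousOn hℓ

/-- The product rule for an absolutely continuous function and a smooth one. -/
theorem mul_left (hℓ : 0 ≤ ℓ) (H : PrimOn ℓ F h) {s s' : ℝ → ℂ}
    (hs : ∀ x, HasDerivAt s (s' x) x) (hs' : Continuous s') :
    PrimOn ℓ (fun x => s x * F x) (fun x => s' x * F x + s x * h x) := by
  have hsc : Continuous s := continuous_iff_continuousAt.2 fun x => (hs x).continuousAt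
  have hint : IntervalIntegrable (fun x => s' x * F x + s x * h x) volume 0 ℓ :=
    ((H.intervalIntegrable hℓ).continuousOn_mul hs'.continuousOn).add
      (H.1.continuousOn_mul hsc.continuousOn)
  have hsd : ContDiff ℝ 1 s := by
    rw [contDiff_one_iff_deriv]
    refine ⟨fun x => (hs x).differentiableAt, ?_⟩
    rwa [show deriv s = s' from funext fun x => (hs x).deriv]
  have hsAC : AbsolutelyContinuousOnInterval s 0 ℓ :=
    ContDiffOn.absolutelyContinuousOnInterval hsd.contDiffOn
  -- The difference between `s F` and the integral of `s' F + s h` is absolutely continuous with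
  -- derivative zero almost everywhere, hence constant; without absolute continuity the second
  -- property would not suffice.
  have hAC := (hsAC.smul H.absolutelyContinuous).sub hint.absolutelyContinuousOnInterval_complex
  obtain ⟨c, hc⟩ := hAC.const_of_ae_hasDerivAt_zero (by
    filter_upwards [H.1.ae_hasDerivAt_integral, hint.ae_hasDerivAt_integral] with x hx1 hx2 hx
    have e1 := (hx1 hx 0 (by simp)).const_add (F 0)
    have e2 := ((hs x).mul e1).sub (hx2 hx 0 (by simp))
    rw [Set.uIcc_of_le hℓ] at hx
    refine e2.congr_deriv ?_
    rw [← H.2 x hx]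
    ring)
  refine ⟨hint, fun x hx => ?_⟩
  have h0 := hc 0 (by simp)
  have h1 := hc x (by rwa [Set.uIcc_of_le hℓ])
  simp only [Pi.sub_apply, smul_eq_mul, Pi.mul_apply, intervalIntegral.integral_same, sub_zero,
    add_zero] at h0 h1
  rw [← H.2 x hx] at h1
  linear_combination h1 - h0

end PrimOn

/-! ### Explicit solution of the equation on one edge. -/

/-- `C`, `S` are the fundamental solutions of `-w'' = z w`. -/
structure FundamentalPair (z : ℝ) (C S : ℝ → ℝ) : Prop where
  cos_zero : C 0 = 1
  sin_zero : S 0 = 0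
  cos_deriv : ∀ x, HasDerivAt C (-(z * S x)) x
  sin_deriv : ∀ x, HasDerivAt S (C x) x

namespace FundamentalPair

variable {z : ℝ} {C S : ℝ → ℝ} (P : FundamentalPair z C S)
include P

theorem continuous_cos : Continuous C :=
  continuous_iff_continuousAt.2 fun x => (P.cos_deriv x).continuousAt

theorem continuous_sin : Continuous S :=
  continuous_iff_continuousAt.2 fun x => (P.sin_deriv x).continuousAt

theorem wronskian (x : ℝ) : C x ^ 2 + z * S x ^ 2 = 1 := by
  have h : ∀ x, HasDerivAt (fun x => C x ^ 2 + z * S x ^ 2) 0 x := fun x => by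
    have := ((P.cos_deriv x).pow 2).add (((P.sin_deriv x).pow 2).const_mul z)
    refine this.congr_deriv ?_
    ring
  have := is_const_of_deriv_eq_zero (fun x => (h x).differentiableAt) (fun x => (h x).deriv) x 0
  simpa [P.cos_zero, P.sin_zero] using this

theorem cos_derivC (x : ℝ) : HasDerivAt (fun x => (C x : ℂ)) (-((z : ℂ) * (S x : ℂ))) x := by
  have := (P.cos_deriv x).ofReal_comp
  refine this.congr_deriv (by push_cast; ring)

theorem sin_derivC (x : ℝ) : HasDerivAt (fun x => (S x : ℂ)) (C x : ℂ) x :=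
  (P.sin_deriv x).ofReal_comp

theorem wronskianC (x : ℝ) : (C x : ℂ) ^ 2 + z * (S x : ℂ) ^ 2 = 1 := by
  exact_mod_cast P.wronskian x

end FundamentalPair

theorem HasDerivAt.cexp_I_mul (a x : ℝ) :
    HasDerivAt (fun x : ℝ => Complex.exp (Complex.I * a * x))
      (Complex.I * a * Complex.exp (Complex.I * a * x)) x := by
  have h : HasDerivAt (fun x : ℝ => Complex.I * a * (x : ℂ)) (Complex.I * a * 1) x :=
    (HasDerivAt.ofReal_comp (hasDerivAt_id x)).const_mul _
  refine h.cexp.congr_deriv (by ring)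

theorem continuous_cexp_I_mul (a : ℝ) :
    Continuous (fun x : ℝ => Complex.exp (Complex.I * a * x)) := by fun_prop

section EdgeEquation

variable {ℓ : ℝ} {z a : ℝ} {C S : ℝ → ℝ} {u u' g : ℝ → ℂ}

/-- The equation `-(d/dx + i a)² u = g + z u` on `[0, ℓ]`, in the gauge `q = e^{iax} u`,
`p = q'`. -/
def GaugedEquation (ℓ z : ℝ) (q p G : ℝ → ℂ) : Prop :=
  PrimOn ℓ q p ∧ PrimOn ℓ p (fun x => -(z * q x) - G x)

/-- Since `(e^{iax} u)' = e^{iax} (u' + iau)`, multiplication by the phase turns `d/dx + ia` into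
`d/dx`. The potential survives only in the end value at `ℓ`. -/
theorem GaugedEquation.of_edge (hℓ : 0 ≤ ℓ) {f₂ : ℝ → ℂ} (hu : PrimOn ℓ u u') (hu' : PrimOn ℓ u' f₂)
    (heq : ∀ᵐ x ∂volume.restrict (Set.Ioc 0 ℓ),
      g x + z * u x = -(f₂ x + 2 * Complex.I * a * u' x - (a : ℂ) ^ 2 * u x)) :
    GaugedEquation ℓ z (fun x => Complex.exp (Complex.I * a * x) * u x)
      (fun x => Complex.exp (Complex.I * a * x) * (u' x + Complex.I * a * u x))
      (fun x => Complex.exp (Complex.I * a * x) * g x) := by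
  have hE := fun x => HasDerivAt.cexp_I_mul a x
  have hEc : Continuous (fun x : ℝ => Complex.I * a * Complex.exp (Complex.I * a * x)) := by
    fun_prop
  constructor
  · refine (hu.mul_left hℓ hE hEc).congr_ae hℓ (fun x _ => rfl) (Eventually.of_forall fun x => ?_)
    simp only
    ring
  · refine ((hu'.add (hu.const_mul (Complex.I * a))).mul_left hℓ hE hEc).congr_ae hℓ
      (fun x _ => rfl) ?_
    filter_upwards [heq] with x hx
    have hg : g x = -(f₂ x + 2 * Complex.I * a * u' x - (a : ℂ) ^ 2 * u x) - z * u x := by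
      rw [← hx]; ring
    rw [hg]
    linear_combination (Complex.exp (Complex.I * a * x) * (a : ℂ) ^ 2 * u x) * Complex.I_sq

theorem GaugedEquation.to_edge (hℓ : 0 ≤ ℓ) {q p : ℝ → ℂ}
    (h : GaugedEquation ℓ z q p (fun x => Complex.exp (Complex.I * a * x) * g x)) :
    PrimOn ℓ (fun x => Complex.exp (-(Complex.I * a * x)) * q x)
        (fun x => Complex.exp (-(Complex.I * a * x)) * (p x - Complex.I * a * q x)) ∧
      PrimOn ℓ (fun x => Complex.exp (-(Complex.I * a * x)) * (p x - Complex.I * a * q x))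
        (fun x => -(g x + z * (Complex.exp (-(Complex.I * a * x)) * q x)
          + 2 * Complex.I * a * (Complex.exp (-(Complex.I * a * x)) * (p x - Complex.I * a * q x))
          - (a : ℂ) ^ 2 * (Complex.exp (-(Complex.I * a * x)) * q x))) := by
  have hE : ∀ x : ℝ, HasDerivAt (fun x : ℝ => Complex.exp (-(Complex.I * a * x)))
      (-(Complex.I * a) * Complex.exp (-(Complex.I * a * x))) x := fun x => by
    simpa using HasDerivAt.cexp_I_mul (-a) x
  have hEc : Continuous (fun x : ℝ => -(Complex.I * a) * Complex.exp (-(Complex.I * a * x))) := by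
    fun_prop
  have hee : ∀ x : ℝ, Complex.exp (-(Complex.I * a * x)) * Complex.exp (Complex.I * a * x) = 1 :=
    fun x => by rw [← Complex.exp_add]; simp
  constructor
  · refine (h.1.mul_left hℓ hE hEc).congr_ae hℓ (fun x _ => rfl) (Eventually.of_forall fun x => ?_)
    simp only
    ring
  · refine ((h.2.sub (h.1.const_mul (Complex.I * a))).mul_left hℓ hE hEc).congr_ae hℓ
      (fun x _ => rfl) (Eventually.of_forall fun x => ?_)
    simp only
    linear_combination (-g x) * hee x
      + (-Complex.exp (-(Complex.I * a * x)) * (a : ℂ) ^ 2 * q x) * Complex.I_sq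

/-- Lagrange's identity: the Wronskian of `q` with a solution `χ` of the homogeneous equation has
derivative `-χ G`. The choices `χ = S` and `χ = C` yield everything else about an edge. -/
theorem GaugedEquation.lagrange {q p G : ℝ → ℂ} (hℓ : 0 ≤ ℓ) (h : GaugedEquation ℓ z q p G)
    {χ χ' : ℝ → ℂ} (hχ : ∀ x, HasDerivAt χ (χ' x) x) (hχ' : ∀ x, HasDerivAt χ' (-(z * χ x)) x)
    {x : ℝ} (hx : x ∈ Set.Icc 0 ℓ) :
    χ x * p x - χ' x * q x = χ 0 * p 0 - χ' 0 * q 0 - ∫ y in (0 : ℝ)..x, χ y * G y := by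
  have hχc : Continuous χ := continuous_iff_continuousAt.2 fun x => (hχ x).continuousAt
  have hχ'c : Continuous χ' := continuous_iff_continuousAt.2 fun x => (hχ' x).continuousAt
  have h1 := (h.2.mul_left hℓ hχ hχ'c).sub (h.1.mul_left hℓ hχ' (by fun_prop))
  have h2 := h1.congr_ae (F₁ := fun x => χ x * p x - χ' x * q x)
    (h₁ := fun x => -1 * (χ x * G x)) hℓ (fun x _ => rfl)
    (Eventually.of_forall fun x => by simp only; ring)
  have h3 := h2.2 x hx
  rw [intervalIntegral.integral_const_mul] at h3
  linear_combination h3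

/-- The solution formula (variation of constants). -/
theorem GaugedEquation.solution {q p G : ℝ → ℂ} (P : FundamentalPair z C S) (hℓ : 0 ≤ ℓ)
    (h : GaugedEquation ℓ z q p G) {x : ℝ} (hx : x ∈ Set.Icc 0 ℓ) :
    q x = S x * (p 0 - ∫ y in (0 : ℝ)..x, C y * G y)
        + C x * (q 0 + ∫ y in (0 : ℝ)..x, S y * G y) := by
  have h1 := h.lagrange hℓ P.sin_derivC P.cos_derivC hx
  have h2 := h.lagrange hℓ P.cos_derivC (χ' := fun x => -((z : ℂ) * (S x : ℂ)))
    (fun x => ((P.sin_derivC x).const_mul (z : ℂ)).neg) hx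
  simp only [P.sin_zero, P.cos_zero, Complex.ofReal_zero, Complex.ofReal_one] at h1 h2
  linear_combination (-q x) * P.wronskianC x + (S x : ℂ) * h2 - (C x : ℂ) * h1

/-- End derivatives in terms of end values and source. The factor `S ℓ` is kept on the left, so
nothing is divided by and the identities remain true at Dirichlet eigenvalues. -/
theorem GaugedEquation.dirichlet_to_neumann {q p G : ℝ → ℂ} (P : FundamentalPair z C S)
    (hℓ : 0 ≤ ℓ) (h : GaugedEquation ℓ z q p G) :
    S ℓ * p 0 = q ℓ - C ℓ * q 0 + (S ℓ * (∫ y in (0 : ℝ)..ℓ, C y * G y)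
        - C ℓ * ∫ y in (0 : ℝ)..ℓ, S y * G y) ∧
      S ℓ * p ℓ = C ℓ * q ℓ - q 0 - ∫ y in (0 : ℝ)..ℓ, S y * G y := by
  have hx : ℓ ∈ Set.Icc 0 ℓ := ⟨hℓ, le_rfl⟩
  have h1 := h.lagrange hℓ P.sin_derivC P.cos_derivC hx
  have h2 := h.solution P hℓ hx
  simp only [P.sin_zero, P.cos_zero, Complex.ofReal_zero, Complex.ofReal_one] at h1
  constructor
  · linear_combination -h2
  · linear_combination h1

theorem GaugedEquation.exists_solution {G : ℝ → ℂ} (P : FundamentalPair z C S) (hℓ : 0 ≤ ℓ)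
    (hG : IntervalIntegrable G volume 0 ℓ) (q₀ p₀ : ℂ) :
    GaugedEquation ℓ z
      (fun x => S x * (p₀ - ∫ y in (0 : ℝ)..x, C y * G y)
        + C x * (q₀ + ∫ y in (0 : ℝ)..x, S y * G y))
      (fun x => C x * (p₀ - ∫ y in (0 : ℝ)..x, C y * G y)
        - z * S x * (q₀ + ∫ y in (0 : ℝ)..x, S y * G y)) G := by
  have hCc : Continuous fun x => (C x : ℂ) := Complex.continuous_ofReal.comp P.continuous_cos
  have hSc : Continuous fun x => (S x : ℂ) := Complex.continuous_ofReal.comp P.continuous_sin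
  have hA : PrimOn ℓ (fun x => p₀ - ∫ y in (0 : ℝ)..x, C y * G y) (fun x => -1 * (C x * G x)) :=
    (((PrimOn.of_integral (hG.continuousOn_mul hCc.continuousOn) 0).const_mul (-1)).add
      (PrimOn.const p₀)).congr_ae hℓ (fun x _ => by ring)
      (Eventually.of_forall fun x => by simp only; ring)
  have hB := PrimOn.of_integral (ℓ := ℓ) (hG.continuousOn_mul hSc.continuousOn) q₀
  constructor
  · refine ((hA.mul_left hℓ P.sin_derivC hCc).add
      (hB.mul_left hℓ P.cos_derivC (by fun_prop))).congr_ae hℓ (fun x _ => rfl)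
      (Eventually.of_forall fun x => ?_)
    simp only
    ring
  · refine ((hA.mul_left hℓ P.cos_derivC (by fun_prop)).sub
      ((hB.mul_left hℓ P.sin_derivC hCc).const_mul z)).congr_ae hℓ (fun x _ => by ring)
      (Eventually.of_forall fun x => ?_)
    simp only
    linear_combination (-G x) * P.wronskianC x

end EdgeEquation

/-! ### The edge problem in `L²`, with bounds uniform in the edge. -/

/-- The square-integrable functions on the edge `[0, ℓ]`. -/
abbrev EdgeL2 (ℓ : ℝ) : Type := Lp ℂ 2 (volume.restrict (Set.Ioc 0 ℓ))

theorem EdgeL2.intervalIntegrable {ℓ : ℝ} (hℓ : 0 ≤ ℓ) (g : EdgeL2 ℓ) :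
    IntervalIntegrable (g : ℝ → ℂ) volume 0 ℓ := by
  rw [intervalIntegrable_iff_integrableOn_Ioc_of_le hℓ]
  exact (Lp.memLp g).integrable (by norm_num)

theorem EdgeL2.integral_norm_le {ℓ : ℝ} (hℓ : 0 ≤ ℓ) (g : EdgeL2 ℓ) :
    ∫ y in (0 : ℝ)..ℓ, ‖g y‖ ≤ √ℓ * ‖g‖ := by
  rw [intervalIntegral.integral_of_le hℓ]
  have h1 := eLpNorm_le_eLpNorm_mul_rpow_measure_univ (p := 1) (q := 2) (by norm_num)
    (Lp.memLp g).1
  have hv : (volume.restrict (Set.Ioc 0 ℓ)) Set.univ = ENNReal.ofReal ℓ := by simp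
  rw [hv] at h1
  have h2 := ENNReal.toReal_mono (by
    refine ENNReal.mul_ne_top (Lp.memLp g).2.ne
      (ENNReal.rpow_ne_top_of_nonneg (by norm_num) (by simp))) h1
  rw [ENNReal.toReal_mul, ← Lp.norm_def, eLpNorm_one_eq_lintegral_enorm, ← ENNReal.toReal_rpow,
    ENNReal.toReal_ofReal hℓ] at h2
  rw [integral_norm_eq_lintegral_enorm (Lp.memLp g).1, mul_comm, Real.sqrt_eq_rpow]
  convert h2 using 2
  norm_num

theorem EdgeL2.exists_of_continuousOn {ℓ : ℝ} (hℓ : 0 ≤ ℓ) {u : ℝ → ℂ}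
    (hu : ContinuousOn u (Set.Icc 0 ℓ)) {B : ℝ} (hB : 0 ≤ B) (hb : ∀ x ∈ Set.Icc 0 ℓ, ‖u x‖ ≤ B) :
    ∃ f : EdgeL2 ℓ, f =ᵐ[volume.restrict (Set.Ioc 0 ℓ)] u ∧ ‖f‖ ≤ √ℓ * B := by
  have hm : AEStronglyMeasurable u (volume.restrict (Set.Ioc 0 ℓ)) :=
    (hu.mono Set.Ioc_subset_Icc_self).aestronglyMeasurable measurableSet_Ioc
  have hbd : ∀ᵐ x ∂volume.restrict (Set.Ioc 0 ℓ), ‖u x‖ ≤ B := by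
    filter_upwards [ae_restrict_mem measurableSet_Ioc] with x hx
    exact hb x (Set.Ioc_subset_Icc_self hx)
  have hmem : MemLp u 2 (volume.restrict (Set.Ioc 0 ℓ)) := MemLp.of_bound hm B hbd
  refine ⟨hmem.toLp u, hmem.coeFn_toLp, ?_⟩
  have := Lp.norm_le_of_ae_bound (f := hmem.toLp u) hB (by
    filter_upwards [hmem.coeFn_toLp, hbd] with x h1 h2
    rwa [h1])
  refine this.trans (le_of_eq ?_)
  rw [Real.sqrt_eq_rpow]
  simp only [measureUnivNNReal, Measure.restrict_apply_univ, Real.volume_Ioc, sub_zero,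
    ENNReal.toReal_ofNat, one_div]
  rw [show ((ENNReal.ofReal ℓ).toNNReal : ℝ) = ℓ from ENNReal.toReal_ofReal hℓ]

/-- `f` solves `-(d/dx + i a)² f = g + z f` on `[0, ℓ]`; `f₁`, `f₂` are its derivatives. -/
structure EdgeSolution (ℓ z a : ℝ) (g f f₁ f₂ : EdgeL2 ℓ) (u u' : ℝ → ℂ) : Prop where
  repr : f =ᵐ[volume.restrict (Set.Ioc 0 ℓ)] u
  repr_deriv : f₁ =ᵐ[volume.restrict (Set.Ioc 0 ℓ)] u'
  prim : PrimOn ℓ u u'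
  prim_deriv : PrimOn ℓ u' f₂
  eq : g + (z : ℂ) • f = -(f₂ + (2 * Complex.I * (a : ℂ)) • f₁ - ((a : ℂ) ^ 2) • f)

/-- The weighted mean of the source term `g` against `χ`, in the gauge of the potential `a`. -/
def edgeMean (ℓ a : ℝ) (χ : ℝ → ℝ) (g : ℝ → ℂ) : ℂ :=
  ∫ y in (0 : ℝ)..ℓ, χ y * (Complex.exp (Complex.I * a * y) * g y)

/-- The contribution of the source term `g` to the conormal derivative at the origin. -/
def edgeSource (ℓ a : ℝ) (C S : ℝ → ℝ) (g : ℝ → ℂ) : ℂ :=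
  S ℓ * edgeMean ℓ a C g - C ℓ * edgeMean ℓ a S g

theorem norm_cexp_I_mul (a x : ℝ) : ‖Complex.exp (Complex.I * a * x)‖ = 1 := by
  rw [show Complex.I * a * x = ((a * x : ℝ) : ℂ) * Complex.I by push_cast; ring]
  exact Complex.norm_exp_ofReal_mul_I _

theorem norm_cexp_neg_I_mul (a x : ℝ) : ‖Complex.exp (-(Complex.I * a * x))‖ = 1 := by
  rw [Complex.exp_neg, norm_inv, norm_cexp_I_mul, inv_one]

theorem norm_edge_integral_le {ℓ a B : ℝ} (hℓ : 0 ≤ ℓ) {χ : ℝ → ℝ}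
    (hB : ∀ y ∈ Set.Icc 0 ℓ, |χ y| ≤ B) (g : EdgeL2 ℓ) {x : ℝ} (hx : x ∈ Set.Icc 0 ℓ) :
    ‖∫ y in (0 : ℝ)..x, (χ y : ℂ) * (Complex.exp (Complex.I * a * y) * g y)‖
      ≤ B * (√ℓ * ‖g‖) := by
  have hB0 : 0 ≤ B := (abs_nonneg _).trans (hB 0 ⟨le_rfl, hℓ⟩)
  have hg := EdgeL2.intervalIntegrable hℓ g
  have hsub : Set.uIcc 0 x ⊆ Set.uIcc 0 ℓ :=
    Set.uIcc_subset_uIcc_left (by rw [Set.uIcc_of_le hℓ]; exact hx)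
  have hint : IntervalIntegrable (fun y : ℝ => B * ‖g y‖) volume 0 ℓ := hg.norm.const_mul B
  calc _ ≤ ∫ y in (0 : ℝ)..x, B * ‖g y‖ := by
        refine intervalIntegral.norm_integral_le_of_norm_le hx.1 (Eventually.of_forall ?_)
          (hint.mono_set hsub)
        intro y hy
        rw [norm_mul, norm_mul, norm_cexp_I_mul, one_mul, Complex.norm_real, Real.norm_eq_abs]
        gcongr
        exact hB y ⟨hy.1.le, hy.2.trans hx.2⟩
    _ ≤ ∫ y in (0 : ℝ)..ℓ, B * ‖g y‖ := by
        refine intervalIntegral.integral_mono_interval le_rfl hx.1 hx.2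
          (Eventually.of_forall fun y => by positivity) hint
    _ ≤ _ := by
        rw [intervalIntegral.integral_const_mul]
        gcongr
        exact EdgeL2.integral_norm_le hℓ g

theorem edge_mul_intervalIntegrable {ℓ : ℝ} (hℓ : 0 ≤ ℓ) (a : ℝ) (g : EdgeL2 ℓ) :
    IntervalIntegrable (fun y : ℝ => Complex.exp (Complex.I * a * y) * g y) volume 0 ℓ :=
  (EdgeL2.intervalIntegrable hℓ g).continuousOn_mul (continuous_cexp_I_mul a).continuousOn

namespace EdgeSolution

variable {ℓ z a : ℝ} {C S : ℝ → ℝ} {g f f₁ f₂ : EdgeL2 ℓ} {u u' : ℝ → ℂ}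

theorem gauged (hℓ : 0 ≤ ℓ) (h : EdgeSolution ℓ z a g f f₁ f₂ u u') :
    GaugedEquation ℓ z (fun x => Complex.exp (Complex.I * a * x) * u x)
      (fun x => Complex.exp (Complex.I * a * x) * (u' x + Complex.I * a * u x))
      (fun x => Complex.exp (Complex.I * a * x) * g x) := by
  refine GaugedEquation.of_edge hℓ h.prim h.prim_deriv ?_
  have e1 := Lp.coeFn_add g ((z : ℂ) • f)
  rw [h.eq] at e1
  filter_upwards [e1, Lp.coeFn_smul (z : ℂ) f, h.repr, h.repr_deriv,
    Lp.coeFn_neg (f₂ + (2 * Complex.I * (a : ℂ)) • f₁ - ((a : ℂ) ^ 2) • f),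
    Lp.coeFn_sub (f₂ + (2 * Complex.I * (a : ℂ)) • f₁) (((a : ℂ) ^ 2) • f),
    Lp.coeFn_add f₂ ((2 * Complex.I * (a : ℂ)) • f₁), Lp.coeFn_smul (2 * Complex.I * (a : ℂ)) f₁,
    Lp.coeFn_smul ((a : ℂ) ^ 2) f] with x h1 h2 h3 h4 h5 h6 h7 h8 h9
  rw [h5] at h1
  simp only [Pi.add_apply, Pi.neg_apply, Pi.sub_apply, Pi.smul_apply, smul_eq_mul, h6, h7, h8,
    h9, h2, h3, h4] at h1
  exact h1.symm

theorem conormal (P : FundamentalPair z C S) (hℓ : 0 ≤ ℓ)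
    (h : EdgeSolution ℓ z a g f f₁ f₂ u u') :
    S ℓ * (u' 0 + Complex.I * a * u 0) =
        Complex.exp (Complex.I * a * ℓ) * u ℓ - C ℓ * u 0 + edgeSource ℓ a C S g ∧
      S ℓ * (u' ℓ + Complex.I * a * u ℓ) =
        C ℓ * u ℓ - Complex.exp (-(Complex.I * a * ℓ)) * u 0
          - Complex.exp (-(Complex.I * a * ℓ)) * edgeMean ℓ a S g := by
  obtain ⟨h1, h2⟩ := (h.gauged hℓ).dirichlet_to_neumann P hℓ
  simp only [Complex.ofReal_zero, mul_zero, Complex.exp_zero, one_mul] at h1 h2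
  refine ⟨h1, ?_⟩
  have hee : Complex.exp (-(Complex.I * a * ℓ)) * Complex.exp (Complex.I * a * ℓ) = 1 := by
    rw [← Complex.exp_add]; simp
  unfold edgeMean
  linear_combination (Complex.exp (-(Complex.I * a * ℓ))) * h2
    - (S ℓ * (u' ℓ + Complex.I * a * u ℓ) - C ℓ * u ℓ) * hee

/-- As `S ℓ ≠ 0`, vanishing end values and source force the initial derivative to vanish too, by
`dirichlet_to_neumann`; the solution formula is then identically zero. -/
theorem eq_zero (P : FundamentalPair z C S) (hℓ : 0 ≤ ℓ) (hS : S ℓ ≠ 0)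
    (h : EdgeSolution ℓ z a 0 f f₁ f₂ u u') (h0 : u 0 = 0) (h1 : u ℓ = 0) : f = 0 := by
  have hG := h.gauged hℓ
  have hG' : GaugedEquation ℓ z (fun x => Complex.exp (Complex.I * a * x) * u x)
      (fun x => Complex.exp (Complex.I * a * x) * (u' x + Complex.I * a * u x))
      (fun _ => 0) := by
    refine ⟨hG.1, hG.2.congr_ae hℓ (fun _ _ => rfl) ?_⟩
    filter_upwards [Lp.coeFn_zero ℂ 2 (volume.restrict (Set.Ioc 0 ℓ))] with x hx
    rw [hx]
    simp
  have hp := (hG'.dirichlet_to_neumann P hℓ).1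
  have hS' : (S ℓ : ℂ) ≠ 0 := by exact_mod_cast hS
  simp only [h0, h1, mul_zero, intervalIntegral.integral_zero, sub_zero, add_zero,
    mul_eq_zero, hS', false_or] at hp
  have hu : ∀ x ∈ Set.Icc 0 ℓ, u x = 0 := by
    intro x hx
    have := hG'.solution P hℓ hx
    simp only [h0, mul_zero, intervalIntegral.integral_zero, sub_zero, add_zero] at this
    rw [mul_eq_zero.2 hp] at this
    simpa [Complex.exp_ne_zero] using this
  refine Lp.ext ?_
  filter_upwards [h.repr, Lp.coeFn_zero ℂ 2 (volume.restrict (Set.Ioc 0 ℓ)),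
    ae_restrict_mem measurableSet_Ioc] with x h1 h2 hx
  rw [h1, h2, hu x (Set.Ioc_subset_Icc_self hx)]
  rfl

/-- Trace inequality: `|u 0| ≤ |u x| + ∫ |u'|` is averaged over `x` in the edge. It makes the vertex
values of an element of the domain square summable. -/
theorem trace_le (hℓ : 0 < ℓ) (h : EdgeSolution ℓ z a g f f₁ f₂ u u') :
    ‖u 0‖ ≤ (√ℓ / ℓ) * ‖f‖ + √ℓ * ‖f₁‖ := by
  have hf := EdgeL2.intervalIntegrable hℓ.le f
  have hf1 := EdgeL2.intervalIntegrable hℓ.le f₁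
  have e1 : ∫ y in (0 : ℝ)..ℓ, ‖u' y‖ = ∫ y in (0 : ℝ)..ℓ, ‖f₁ y‖ := by
    rw [intervalIntegral.integral_of_le hℓ.le, intervalIntegral.integral_of_le hℓ.le]
    exact integral_congr_ae (by filter_upwards [h.repr_deriv] with x hx; rw [hx])
  have e0 : ∫ y in (0 : ℝ)..ℓ, ‖u y‖ = ∫ y in (0 : ℝ)..ℓ, ‖f y‖ := by
    rw [intervalIntegral.integral_of_le hℓ.le, intervalIntegral.integral_of_le hℓ.le]
    exact integral_congr_ae (by filter_upwards [h.repr] with x hx; rw [hx])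
  set N := ∫ y in (0 : ℝ)..ℓ, ‖u' y‖ with hN
  have key : ∀ x ∈ Set.Icc 0 ℓ, ‖u 0‖ - N ≤ ‖u x‖ := by
    intro x hx
    have h1 : u 0 = u x - ∫ y in (0 : ℝ)..x, u' y := by rw [h.prim.2 x hx]; ring
    have h2 : ‖∫ y in (0 : ℝ)..x, u' y‖ ≤ N :=
      (intervalIntegral.norm_integral_le_integral_norm hx.1).trans
        (intervalIntegral.integral_mono_interval le_rfl hx.1 hx.2
          (Eventually.of_forall fun y => norm_nonneg _) h.prim.1.norm)
    have h3 : ‖u 0‖ ≤ ‖u x‖ + ‖∫ y in (0 : ℝ)..x, u' y‖ := by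
      conv_lhs => rw [h1]
      exact norm_sub_le _ _
    linarith
  have h4 := intervalIntegral.integral_mono_on hℓ.le (by simp)
    (h.prim.intervalIntegrable hℓ.le).norm key
  rw [intervalIntegral.integral_const, e0, sub_zero, smul_eq_mul] at h4
  have h5 := EdgeL2.integral_norm_le hℓ.le f
  have h6 := EdgeL2.integral_norm_le hℓ.le f₁
  rw [← e1] at h6
  have h7 : ‖u 0‖ - N ≤ (√ℓ * ‖f‖) / ℓ := by
    rw [le_div_iff₀ hℓ]; linarith
  rw [div_mul_eq_mul_div]
  linarith

end EdgeSolution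

/-- One constant must serve every edge and every potential `a`, which is possible because the phase
has modulus one. The length enters as `ℓ` with `ℓ = ε` because the space of an edge of an abstract
graph is typed by its own length, which is only provably equal to `ε`. -/
theorem exists_edgeMean_bound {ε z : ℝ} {C S : ℝ → ℝ} (P : FundamentalPair z C S) (hε : 0 < ε) :
    ∃ K, 0 ≤ K ∧ ∀ ℓ, ℓ = ε → ∀ (a : ℝ) (g : EdgeL2 ℓ), ∀ x ∈ Set.Icc 0 ℓ,
      |C x| ≤ K ∧ |S x| ≤ K ∧
      ‖∫ y in (0 : ℝ)..x, (C y : ℂ) * (Complex.exp (Complex.I * a * y) * g y)‖ ≤ K * ‖g‖ ∧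
      ‖∫ y in (0 : ℝ)..x, (S y : ℂ) * (Complex.exp (Complex.I * a * y) * g y)‖ ≤ K * ‖g‖ := by
  obtain ⟨B₁, h₁⟩ := isCompact_Icc.exists_bound_of_continuousOn (s := Set.Icc 0 ε)
    P.continuous_cos.continuousOn
  obtain ⟨B₂, h₂⟩ := isCompact_Icc.exists_bound_of_continuousOn (s := Set.Icc 0 ε)
    P.continuous_sin.continuousOn
  have h0 : (0 : ℝ) ∈ Set.Icc 0 ε := ⟨le_rfl, hε.le⟩
  have hB₁ : 0 ≤ B₁ := (norm_nonneg _).trans (h₁ 0 h0)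
  have hB₂ : 0 ≤ B₂ := (norm_nonneg _).trans (h₂ 0 h0)
  have hs := Real.sqrt_nonneg ε
  refine ⟨(B₁ + B₂) * (1 + √ε), by positivity, ?_⟩
  rintro ℓ rfl a g x hx
  have e1 := norm_edge_integral_le (a := a) hε.le h₁ g hx
  have e2 := norm_edge_integral_le (a := a) hε.le h₂ g hx
  have e3 := h₁ x hx
  have e4 := h₂ x hx
  rw [Real.norm_eq_abs] at e3 e4
  have e5 : 0 ≤ (B₁ + B₂) * √ℓ := by positivity
  have e6 : 0 ≤ B₁ * ‖g‖ := by positivity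
  have e7 : 0 ≤ B₂ * ‖g‖ := by positivity
  have e8 : 0 ≤ B₁ * ‖g‖ * √ℓ := by positivity
  have e9 : 0 ≤ B₂ * ‖g‖ * √ℓ := by positivity
  refine ⟨?_, ?_, e1.trans ?_, e2.trans ?_⟩ <;> linarith

theorem exists_edgeSource_bound {ε z : ℝ} {C S : ℝ → ℝ} (P : FundamentalPair z C S)
    (hε : 0 < ε) :
    ∃ K, 0 ≤ K ∧ ∀ ℓ, ℓ = ε → ∀ (a : ℝ) (g : EdgeL2 ℓ),
      ‖edgeMean ε a S g‖ ≤ K * ‖g‖ ∧ ‖edgeSource ε a C S g‖ ≤ K * ‖g‖ := by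
  obtain ⟨K, hK, h⟩ := exists_edgeMean_bound P hε
  refine ⟨K + 2 * K * K, by positivity, ?_⟩
  rintro ℓ rfl a g
  obtain ⟨h1, h2, h3, h4⟩ := h ℓ rfl a g ℓ ⟨hε.le, le_rfl⟩
  have hg := norm_nonneg g
  have h5 : 0 ≤ K * K * ‖g‖ := by positivity
  constructor
  · refine h4.trans ?_
    nlinarith
  · refine (norm_sub_le _ _).trans ?_
    rw [norm_mul, norm_mul, Complex.norm_real, Complex.norm_real, Real.norm_eq_abs,
      Real.norm_eq_abs]
    have h6 : |S ℓ| * ‖edgeMean ℓ a C g‖ ≤ K * (K * ‖g‖) := by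
      unfold edgeMean; gcongr
    have h7 : |C ℓ| * ‖edgeMean ℓ a S g‖ ≤ K * (K * ‖g‖) := by
      unfold edgeMean; gcongr
    nlinarith

/-- Solvability of the Dirichlet problem on an edge, with bounds. -/
theorem exists_edgeSolution {ε z : ℝ} {C S : ℝ → ℝ} (P : FundamentalPair z C S) (hε : 0 < ε)
    (hS : S ε ≠ 0) (A : ℝ) :
    ∃ K, 0 ≤ K ∧ ∀ ℓ, ℓ = ε → ∀ a : ℝ, |a| ≤ A → ∀ (g : EdgeL2 ℓ) (α γ : ℂ),
      ∃ (f f₁ f₂ : EdgeL2 ℓ) (u u' : ℝ → ℂ), EdgeSolution ℓ z a g f f₁ f₂ u u' ∧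
        u 0 = α ∧ u ℓ = γ ∧ ‖f‖ ≤ K * (‖α‖ + ‖γ‖ + ‖g‖) ∧ ‖f₁‖ ≤ K * (‖α‖ + ‖γ‖ + ‖g‖) ∧
        ‖f₂‖ ≤ K * (‖α‖ + ‖γ‖ + ‖g‖) := by
  obtain ⟨K₀, hK₀, hb⟩ := exists_edgeMean_bound P hε
  obtain ⟨K₁, hK₁, hb₁⟩ := exists_edgeSource_bound P hε
  -- `K₂` bounds the initial derivative `p₀`, `K₃` the gauged solution and its derivative on the
  -- edge, and `K₄` the `L²` norms of `f` and `f₁`. The remaining terms of the final constant bound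
  -- `f₂`, which is read off from the equation.
  set σ := |S ε|⁻¹ with hσ
  have hσ0 : 0 ≤ σ := by positivity
  set K₂ := σ * (1 + K₀ + K₁) with hK₂
  have hK₂0 : 0 ≤ K₂ := by positivity
  set K₃ := (1 + |z|) * K₀ * (K₂ + K₀ + (1 + K₀)) with hK₃
  have hK₃0 : 0 ≤ K₃ := by positivity
  set K₄ := √ε * (K₃ + |A| * K₃) with hK₄
  have hK₄0 : 0 ≤ K₄ := by positivity
  refine ⟨K₄ + (1 + |z| * K₄ + 2 * |A| * K₄ + |A| ^ 2 * K₄), by positivity, ?_⟩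
  rintro ℓ rfl a ha g α γ
  set q₀ := α
  set e := Complex.exp (Complex.I * a * ℓ)
  -- The Dirichlet-to-Neumann relation solved for the initial derivative: with this `p₀` the gauged
  -- solution ends at `e * γ`, so that `u ℓ = γ`.
  set p₀ : ℂ := (S ℓ : ℂ)⁻¹ * (e * γ - C ℓ * α + edgeSource ℓ a C S g) with hp₀
  set N := ‖α‖ + ‖γ‖ + ‖g‖ with hN
  have hS' : (S ℓ : ℂ) ≠ 0 := by exact_mod_cast hS
  have hα := norm_nonneg α
  have hγ := norm_nonneg γ
  have hg := norm_nonneg g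
  have hN0 : 0 ≤ N := by positivity
  have hℓI : ℓ ∈ Set.Icc 0 ℓ := ⟨hε.le, le_rfl⟩
  have hp₀n : ‖p₀‖ ≤ K₂ * N := by
    rw [hp₀, norm_mul, norm_inv, Complex.norm_real, Real.norm_eq_abs, hK₂, mul_assoc]
    gcongr
    refine (norm_add_le _ _).trans ?_
    have e1 := (hb₁ ℓ rfl a g).2
    have e2 : ‖e * γ - C ℓ * α‖ ≤ ‖γ‖ + K₀ * ‖α‖ := by
      refine (norm_sub_le _ _).trans ?_
      rw [norm_mul, norm_mul, norm_cexp_I_mul, one_mul, Complex.norm_real, Real.norm_eq_abs]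
      gcongr
      exact (hb ℓ rfl a g ℓ hℓI).1
    have e3 : 0 ≤ K₀ * ‖γ‖ := by positivity
    have e4 : 0 ≤ K₁ * ‖γ‖ := by positivity
    have e5 : 0 ≤ K₁ * ‖α‖ := by positivity
    have e6 : 0 ≤ K₀ * ‖g‖ := by positivity
    rw [hN]
    linarith
  have hG := edge_mul_intervalIntegrable hε.le a g
  have hsol := GaugedEquation.exists_solution P hε.le hG q₀ p₀
  set q : ℝ → ℂ := fun x =>
    S x * (p₀ - ∫ y in (0 : ℝ)..x, C y * (Complex.exp (Complex.I * a * y) * g y))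
        + C x * (q₀ + ∫ y in (0 : ℝ)..x, S y * (Complex.exp (Complex.I * a * y) * g y)) with hq
  set p : ℝ → ℂ := fun x =>
    C x * (p₀ - ∫ y in (0 : ℝ)..x, C y * (Complex.exp (Complex.I * a * y) * g y))
        - z * S x * (q₀ + ∫ y in (0 : ℝ)..x, S y * (Complex.exp (Complex.I * a * y) * g y)) with hp
  have hA : ∀ x ∈ Set.Icc 0 ℓ,
      ‖p₀ - ∫ y in (0 : ℝ)..x, C y * (Complex.exp (Complex.I * a * y) * g y)‖
        ≤ (K₂ + K₀) * N := by
    intro x hx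
    refine (norm_sub_le _ _).trans ?_
    have e1 := (hb ℓ rfl a g x hx).2.2.1
    have e2 : K₀ * ‖g‖ ≤ K₀ * N := by gcongr; rw [hN]; linarith
    linarith
  have hBd : ∀ x ∈ Set.Icc 0 ℓ,
      ‖q₀ + ∫ y in (0 : ℝ)..x, S y * (Complex.exp (Complex.I * a * y) * g y)‖
        ≤ (1 + K₀) * N := by
    intro x hx
    refine (norm_add_le _ _).trans ?_
    have e1 := (hb ℓ rfl a g x hx).2.2.2
    have e2 : K₀ * ‖g‖ ≤ K₀ * N := by gcongr; rw [hN]; linarith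
    have e3 : ‖α‖ ≤ N := by rw [hN]; linarith
    linarith
  have hz := abs_nonneg z
  have hqn : ∀ x ∈ Set.Icc 0 ℓ, ‖q x‖ ≤ K₃ * N := by
    intro x hx
    obtain ⟨c1, c2, -⟩ := hb ℓ rfl a g x hx
    refine (norm_add_le _ _).trans ?_
    rw [norm_mul, norm_mul, Complex.norm_real, Complex.norm_real, Real.norm_eq_abs,
      Real.norm_eq_abs]
    have e1 : |S x| * ‖p₀ - ∫ y in (0 : ℝ)..x, C y * (Complex.exp (Complex.I * a * y) * g y)‖
      ≤ K₀ * ((K₂ + K₀) * N) := by gcongr; exact hA x hx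
    have e2 : |C x| * ‖q₀ + ∫ y in (0 : ℝ)..x, S y * (Complex.exp (Complex.I * a * y) * g y)‖
      ≤ K₀ * ((1 + K₀) * N) := by gcongr; exact hBd x hx
    have e3 : 0 ≤ |z| * (K₀ * (K₂ + K₀ + (1 + K₀)) * N) := by positivity
    rw [hK₃]
    linarith
  have hpn : ∀ x ∈ Set.Icc 0 ℓ, ‖p x‖ ≤ K₃ * N := by
    intro x hx
    obtain ⟨c1, c2, -⟩ := hb ℓ rfl a g x hx
    refine (norm_sub_le _ _).trans ?_
    rw [norm_mul, norm_mul, norm_mul, Complex.norm_real, Complex.norm_real, Complex.norm_real,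
      Real.norm_eq_abs, Real.norm_eq_abs, Real.norm_eq_abs]
    have e1 : |C x| * ‖p₀ - ∫ y in (0 : ℝ)..x, C y * (Complex.exp (Complex.I * a * y) * g y)‖
      ≤ K₀ * ((K₂ + K₀) * N) := by gcongr; exact hA x hx
    have e2 : |z| * |S x| *
        ‖q₀ + ∫ y in (0 : ℝ)..x, S y * (Complex.exp (Complex.I * a * y) * g y)‖
      ≤ |z| * K₀ * ((1 + K₀) * N) := by gcongr; exact hBd x hx
    have e3 : 0 ≤ |z| * (K₀ * (K₂ + K₀) * N) := by positivity
    have e4 : 0 ≤ (K₀ * (1 + K₀) * N) := by positivity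
    rw [hK₃]
    linarith
  obtain ⟨hu, hu'⟩ := hsol.to_edge hε.le
  have haA : |a| ≤ |A| := ha.trans (le_abs_self A)
  have hun : ∀ x ∈ Set.Icc 0 ℓ, ‖Complex.exp (-(Complex.I * a * x)) * q x‖ ≤
      (K₃ + |A| * K₃) * N := by
    intro x hx
    rw [norm_mul, norm_cexp_neg_I_mul, one_mul]
    have : 0 ≤ |A| * K₃ * N := by positivity
    linarith [hqn x hx]
  have hu'n : ∀ x ∈ Set.Icc 0 ℓ,
      ‖Complex.exp (-(Complex.I * a * x)) * (p x - Complex.I * a * q x)‖ ≤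
      (K₃ + |A| * K₃) * N := by
    intro x hx
    rw [norm_mul, norm_cexp_neg_I_mul, one_mul]
    refine (norm_sub_le _ _).trans ?_
    rw [norm_mul, norm_mul, Complex.norm_I, Complex.norm_real, Real.norm_eq_abs, one_mul]
    have : |a| * ‖q x‖ ≤ |A| * (K₃ * N) := by gcongr; exact hqn x hx
    linarith [hpn x hx]
  obtain ⟨f, hf, hfn⟩ := EdgeL2.exists_of_continuousOn hε.le (hu.continuousOn hε.le)
    (by positivity) hun
  obtain ⟨f₁, hf₁, hf₁n⟩ := EdgeL2.exists_of_continuousOn hε.le (hu'.continuousOn hε.le)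
    (by positivity) hu'n
  rw [← mul_assoc, ← hK₄] at hfn hf₁n
  have hK4N : 0 ≤ K₄ * N := by positivity
  set R := |z| * K₄ + 2 * |A| * K₄ + |A| ^ 2 * K₄ with hR
  have hRN : 0 ≤ R * N := by positivity
  refine ⟨f, f₁, -(g + (z : ℂ) • f) - (2 * Complex.I * (a : ℂ)) • f₁ + ((a : ℂ) ^ 2) • f, _, _,
    ⟨hf, hf₁, hu, ?_, by abel⟩, ?_, ?_, ?_, ?_, ?_⟩
  · refine hu'.congr_ae hε.le (fun _ _ => rfl) ?_
    filter_upwards [hf, hf₁,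
      Lp.coeFn_add (-(g + (z : ℂ) • f) - (2 * Complex.I * (a : ℂ)) • f₁) (((a : ℂ) ^ 2) • f),
      Lp.coeFn_sub (-(g + (z : ℂ) • f)) ((2 * Complex.I * (a : ℂ)) • f₁),
      Lp.coeFn_neg (g + (z : ℂ) • f), Lp.coeFn_add g ((z : ℂ) • f), Lp.coeFn_smul (z : ℂ) f,
      Lp.coeFn_smul (2 * Complex.I * (a : ℂ)) f₁, Lp.coeFn_smul ((a : ℂ) ^ 2) f]
      with x h1 h2 h3 h4 h5 h6 h7 h8 h9
    simp only [h3, h4, h5, h6, h7, h8, h9, Pi.add_apply, Pi.neg_apply, Pi.sub_apply,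
      Pi.smul_apply, smul_eq_mul, h1, h2]
    ring
  · simp [hq, P.sin_zero, P.cos_zero, q₀]
  · have hee : Complex.exp (-(Complex.I * a * ℓ)) * e = 1 := by
      rw [← Complex.exp_add]; simp
    have e1 : (S ℓ : ℂ) * p₀ = e * γ - C ℓ * α + edgeSource ℓ a C S g := by
      rw [hp₀, mul_inv_cancel_left₀ hS']
    have e2 : q ℓ = e * γ := by
      simp only [hq, edgeSource, edgeMean] at e1 ⊢
      linear_combination e1
    rw [e2, ← mul_assoc, hee, one_mul]
  · refine hfn.trans ?_
    linarith
  · refine hf₁n.trans ?_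
    linarith
  · have e1 : ‖-(g + (z : ℂ) • f)‖ ≤ N + |z| * (K₄ * N) := by
      rw [norm_neg]
      refine (norm_add_le _ _).trans ?_
      rw [norm_smul, Complex.norm_real, Real.norm_eq_abs]
      gcongr
      linarith
    have e2 : ‖(2 * Complex.I * (a : ℂ)) • f₁‖ ≤ 2 * |A| * (K₄ * N) := by
      rw [norm_smul, norm_mul, norm_mul, Complex.norm_I, Complex.norm_real, Real.norm_eq_abs]
      simp only [Complex.norm_ofNat, mul_one]
      gcongr
    have e3 : ‖((a : ℂ) ^ 2) • f‖ ≤ |A| ^ 2 * (K₄ * N) := by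
      rw [norm_smul, norm_pow, Complex.norm_real, Real.norm_eq_abs]
      gcongr
    refine (norm_add_le _ _).trans ?_
    have e4 := norm_sub_le (-(g + (z : ℂ) • f)) ((2 * Complex.I * (a : ℂ)) • f₁)
    linarith

/-! ### Square summable families. -/

/-- The family `h` is square summable with `ℓ²` norm at most `c`. -/
def SqBound {ι : Type*} (h : ι → ℝ) (c : ℝ) : Prop :=
  0 ≤ c ∧ ∀ s : Finset ι, ∑ i ∈ s, h i ^ 2 ≤ c ^ 2

namespace SqBound

variable {ι κ : Type*} {h k : ι → ℝ} {c d : ℝ}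

theorem mono (H : SqBound h c) (hk : ∀ i, |k i| ≤ |h i|) : SqBound k c :=
  ⟨H.1, fun s => (Finset.sum_le_sum fun i _ => sq_le_sq.2 (hk i)).trans (H.2 s)⟩

theorem mono_right (H : SqBound h c) (hcd : c ≤ d) : SqBound h d :=
  ⟨H.1.trans hcd, fun s => (H.2 s).trans (pow_le_pow_left₀ H.1 hcd 2)⟩

theorem add (H : SqBound h c) (K : SqBound k d) : SqBound (fun i => h i + k i) (c + d) := by
  refine ⟨add_nonneg H.1 K.1, fun s => ?_⟩
  have h1 := Finset.sum_mul_sq_le_sq_mul_sq s h k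
  have h2 : ∑ i ∈ s, h i * k i ≤ c * d := by
    refine abs_le_of_sq_le_sq' ?_ (mul_nonneg H.1 K.1) |>.2
    refine h1.trans ?_
    rw [mul_pow]
    exact mul_le_mul (H.2 s) (K.2 s) (Finset.sum_nonneg fun i _ => sq_nonneg _) (sq_nonneg _)
  have h3 : ∑ i ∈ s, (h i + k i) ^ 2 =
      ∑ i ∈ s, h i ^ 2 + 2 * ∑ i ∈ s, h i * k i + ∑ i ∈ s, k i ^ 2 := by
    rw [Finset.mul_sum, ← Finset.sum_add_distrib, ← Finset.sum_add_distrib]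
    exact Finset.sum_congr rfl fun i _ => by ring
  rw [h3]
  nlinarith [H.2 s, K.2 s]

theorem const_mul (H : SqBound h c) {a : ℝ} (ha : 0 ≤ a) : SqBound (fun i => a * h i) (a * c) := by
  refine ⟨mul_nonneg ha H.1, fun s => ?_⟩
  simp only [mul_pow, ← Finset.mul_sum]
  exact mul_le_mul_of_nonneg_left (H.2 s) (sq_nonneg a)

theorem comp (H : SqBound h c) {η : κ → ι} (hη : Function.Injective η) :
    SqBound (fun i => h (η i)) c := by
  refine ⟨H.1, fun s => ?_⟩
  have := H.2 (s.map ⟨η, hη⟩)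
  rwa [Finset.sum_map] at this

/-- Used with the edges sorted by their type in the cell: a bound on each of the finitely many
slices suffices, since `∑ c_k² ≤ (∑ c_k)²`. -/
theorem of_fibres [Fintype κ] {α : Type*} (e : ι × κ ≃ α) {h : α → ℝ} {c : κ → ℝ}
    (H : ∀ k, SqBound (fun i => h (e (i, k))) (c k)) : SqBound h (∑ k, c k) := by
  classical
  refine ⟨Finset.sum_nonneg fun k _ => (H k).1, fun s => ?_⟩
  set t : Finset ι := s.image fun x => (e.symm x).1
  have h0 : ∑ p ∈ t ×ˢ (Finset.univ : Finset κ), h (e p) ^ 2 =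
      ∑ x ∈ (t ×ˢ (Finset.univ : Finset κ)).map e.toEmbedding, h x ^ 2 :=
    (Finset.sum_map _ e.toEmbedding fun x => h x ^ 2).symm
  have h1 : ∑ x ∈ s, h x ^ 2 ≤ ∑ p ∈ t ×ˢ (Finset.univ : Finset κ), h (e p) ^ 2 := by
    rw [h0]
    refine Finset.sum_le_sum_of_subset_of_nonneg (fun x hx => ?_) fun _ _ _ => sq_nonneg _
    rw [Finset.mem_map]
    refine ⟨e.symm x, ?_, by simp⟩
    rw [Finset.mem_product]
    exact ⟨Finset.mem_image_of_mem _ hx, Finset.mem_univ _⟩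
  refine h1.trans ?_
  rw [Finset.sum_product_right]
  calc _ ≤ ∑ k, c k ^ 2 := Finset.sum_le_sum fun k _ => (H k).2 t
    _ ≤ (∑ k, c k) ^ 2 := Finset.sum_sq_le_sq_sum_of_nonneg fun k _ => (H k).1

theorem of_lp {E : ι → Type*} [∀ i, NormedAddCommGroup (E i)] (f : lp E 2) :
    SqBound (fun i => ‖f i‖) ‖f‖ := by
  refine ⟨norm_nonneg _, fun s => ?_⟩
  have := lp.sum_rpow_le_norm_rpow (p := 2) (by norm_num) f s
  simpa using this

theorem exists_lp {E : ι → Type*} [∀ i, NormedAddCommGroup (E i)] {f : ∀ i, E i}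
    (H : SqBound (fun i => ‖f i‖) c) : ∃ F : lp E 2, (∀ i, F i = f i) ∧ ‖F‖ ≤ c := by
  have hm : Memℓp f 2 := memℓp_gen' (C := c ^ 2) fun s => by simpa using H.2 s
  refine ⟨⟨f, hm⟩, fun i => rfl, ?_⟩
  exact lp.norm_le_of_forall_sum_le (by norm_num) H.1 fun s => by simpa using H.2 s

end SqBound

/-! ### The magnetic Laplacian as a linear relation. -/

/-- A criterion for `z` to be in the resolvent set of a linear relation. -/
theorem notMem_operatorSpectrum {H : Type*} [NormedAddCommGroup H] [NormedSpace ℂ H]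
    {T : Set (H × H)} (hadd : ∀ p ∈ T, ∀ q ∈ T, p + q ∈ T) (hsmul : ∀ c : ℂ, ∀ p ∈ T, c • p ∈ T)
    {z : ℂ} {K : ℝ} (hex : ∀ g : H, ∃ f : H, (f, g + z • f) ∈ T ∧ ‖f‖ ≤ K * ‖g‖)
    (hker : ∀ f : H, (f, z • f) ∈ T → f = 0) : z ∉ operatorSpectrum T := by
  choose R hR hRn using hex
  have huniq : ∀ f g, (f, g + z • f) ∈ T → f = R g := by
    intro f g hf
    have h1 := hadd _ hf _ (hsmul (-1) _ (hR g))
    have h2 : (f, g + z • f) + (-1 : ℂ) • (R g, g + z • R g) = (f - R g, z • (f - R g)) := by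
      ext
      · simp [sub_eq_add_neg]
      · change g + z • f + (-1 : ℂ) • (g + z • R g) = z • (f - R g)
        rw [neg_smul, one_smul, smul_sub]
        abel
    rw [h2] at h1
    exact sub_eq_zero.1 (hker _ h1)
  let Rl : H →ₗ[ℂ] H :=
    { toFun := R
      map_add' := fun g g' => by
        refine (huniq _ _ ?_).symm
        convert hadd _ (hR g) _ (hR g') using 1
        ext
        · rfl
        · simp only [Prod.snd_add, smul_add]
          abel
      map_smul' := fun c g => by
        refine (huniq _ _ ?_).symm
        convert hsmul c _ (hR g) using 1
        ext
        · rfl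
        · simp only [Prod.smul_snd, smul_add, RingHom.id_apply]
          rw [smul_comm] }
  simp only [operatorSpectrum, Set.mem_ofPred_eq, not_not]
  refine ⟨Rl.mkContinuous K hRn, fun f g => ⟨huniq f g, ?_⟩⟩
  rintro rfl
  exact hR g

namespace MetricGraph

variable {V E : Type} {G : MetricGraph V E}

/-- The integrability contained in `PrimOn` is automatic: `f₂` is square integrable on a bounded
interval, and `u'` is therefore continuous there. -/
theorem isSobolevTwo_iff {f f₁ f₂ : G.L2} {u u' : E → ℝ → ℂ} :
    G.IsSobolevTwo f f₁ f₂ u u' ↔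
      ∀ e, (f e : ℝ → ℂ) =ᵐ[G.edgeMeasure e] u e ∧ (f₁ e : ℝ → ℂ) =ᵐ[G.edgeMeasure e] u' e ∧
        PrimOn (G.len e) (u e) (u' e) ∧ PrimOn (G.len e) (u' e) (f₂ e : ℝ → ℂ) := by
  constructor
  · intro h e
    have h2 : PrimOn (G.len e) (u' e) (f₂ e : ℝ → ℂ) :=
      ⟨EdgeL2.intervalIntegrable (G.len_pos e).le (f₂ e), h.deriv_eq_integral e⟩
    exact ⟨h.repr e, h.repr_deriv e,
      ⟨h2.intervalIntegrable (G.len_pos e).le, h.eq_integral e⟩, h2⟩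
  · intro h
    exact ⟨fun e => (h e).1, fun e => (h e).2.1, fun e => (h e).2.2.1.2, fun e => (h e).2.2.2.2⟩

theorem conormalSum_add (a : E → ℝ) (u u' w w' : E → ℝ → ℂ) (v : V) :
    G.conormalSum a (u + w) (u' + w') v = G.conormalSum a u u' v + G.conormalSum a w w' v := by
  have h1 : {e | G.src e = v}.Finite := (G.locallyFinite v).subset fun e he => Or.inl he
  have h2 : {e | G.tgt e = v}.Finite := (G.locallyFinite v).subset fun e he => Or.inr he
  have e1 := finsum_mem_add_distrib (f := fun e => u' e 0 + Complex.I * a e * u e 0)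
    (g := fun e => w' e 0 + Complex.I * a e * w e 0) h1
  have e2 := finsum_mem_add_distrib
    (f := fun e => u' e (G.len e) + Complex.I * a e * u e (G.len e))
    (g := fun e => w' e (G.len e) + Complex.I * a e * w e (G.len e)) h2
  simp only [Set.mem_ofPred_eq] at e1 e2
  have e3 : ∀ e x, (u' + w') e x + Complex.I * a e * (u + w) e x =
    (u' e x + Complex.I * a e * u e x) + (w' e x + Complex.I * a e * w e x) := by
    intro e x
    simp only [Pi.add_apply]
    ring
  simp only [conormalSum, e3, e1, e2]
  ring

theorem conormalSum_smul (a : E → ℝ) (c : ℂ) (u u' : E → ℝ → ℂ) (v : V) :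
    G.conormalSum a (c • u) (c • u') v = c * G.conormalSum a u u' v := by
  have h1 : {e | G.src e = v}.Finite := (G.locallyFinite v).subset fun e he => Or.inl he
  have h2 : {e | G.tgt e = v}.Finite := (G.locallyFinite v).subset fun e he => Or.inr he
  have e1 := smul_finsum_mem (f := fun e => u' e 0 + Complex.I * a e * u e 0) (r := c) h1
  have e2 := smul_finsum_mem
    (f := fun e => u' e (G.len e) + Complex.I * a e * u e (G.len e)) (r := c) h2
  simp only [Set.mem_ofPred_eq, smul_eq_mul] at e1 e2
  have e3 : ∀ e x, (c • u') e x + Complex.I * a e * (c • u) e x =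
    c * (u' e x + Complex.I * a e * u e x) := by
    intro e x
    simp only [Pi.smul_apply, smul_eq_mul]
    ring
  simp only [conormalSum, e3, mul_sub, e1, e2]

theorem magneticLaplacian_add (a : E → ℝ) :
    ∀ p ∈ G.magneticLaplacian a, ∀ q ∈ G.magneticLaplacian a, p + q ∈ G.magneticLaplacian a := by
  rintro ⟨f, F⟩ ⟨f₁, f₂, u, u', hu, ⟨φ, hφ⟩, hK, hF⟩ ⟨g, K⟩ ⟨g₁, g₂, w, w', hw, ⟨ψ, hψ⟩, hK', hG⟩
  refine ⟨f₁ + g₁, f₂ + g₂, u + w, u' + w', ?_, ⟨φ + ψ, fun e => ?_⟩, fun v => ?_, fun e => ?_⟩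
  · rw [isSobolevTwo_iff] at hu hw ⊢
    intro e
    obtain ⟨a1, a2, a3, a4⟩ := hu e
    obtain ⟨b1, b2, b3, b4⟩ := hw e
    refine ⟨(Lp.coeFn_add _ _).trans (a1.add b1), (Lp.coeFn_add _ _).trans (a2.add b2),
      a3.add b3, ?_⟩
    exact (a4.add b4).congr_ae (G.len_pos e).le (fun _ _ => rfl) (Lp.coeFn_add _ _).symm
  · simp only [Pi.add_apply, (hφ e).1, (hφ e).2, (hψ e).1, (hψ e).2, and_self]
  · rw [conormalSum_add, hK, hK', add_zero]
  · simp only [Prod.mk_add_mk, lp.coeFn_add, Pi.add_apply] at hF hG ⊢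
    rw [hF, hG, smul_add, smul_add]
    abel

theorem magneticLaplacian_smul (a : E → ℝ) (c : ℂ) :
    ∀ p ∈ G.magneticLaplacian a, c • p ∈ G.magneticLaplacian a := by
  rintro ⟨f, F⟩ ⟨f₁, f₂, u, u', hu, ⟨φ, hφ⟩, hK, hF⟩
  refine ⟨c • f₁, c • f₂, c • u, c • u', ?_, ⟨c • φ, fun e => ?_⟩, fun v => ?_, fun e => ?_⟩
  · rw [isSobolevTwo_iff] at hu ⊢
    intro e
    obtain ⟨a1, a2, a3, a4⟩ := hu e
    refine ⟨(Lp.coeFn_smul _ _).trans (a1.const_smul c),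
      (Lp.coeFn_smul _ _).trans (a2.const_smul c), a3.const_mul c, ?_⟩
    exact (a4.const_mul c).congr_ae (G.len_pos e).le (fun _ _ => rfl) (Lp.coeFn_smul c (f₂ e)).symm
  · simp only [Pi.smul_apply, (hφ e).1, (hφ e).2, and_self]
  · rw [conormalSum_smul, hK, mul_zero]
  · simp only [Prod.smul_mk, lp.coeFn_smul, Pi.smul_apply] at hF ⊢
    rw [hF, smul_neg, smul_sub, smul_add, smul_comm c, smul_comm c]

/-- The resolvent equation falls apart into independent edge problems, coupled only through the
vertex values `φ` and the conormal sums. -/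
theorem mem_magneticLaplacian_iff (a : E → ℝ) (f g : G.L2) (z : ℝ) :
    (f, g + (z : ℂ) • f) ∈ G.magneticLaplacian a ↔
      ∃ (f₁ f₂ : G.L2) (u u' : E → ℝ → ℂ) (φ : V → ℂ),
        (∀ e, EdgeSolution (G.len e) z (a e) (g e) (f e) (f₁ e) (f₂ e) (u e) (u' e)) ∧
        (∀ e, u e 0 = φ (G.src e) ∧ u e (G.len e) = φ (G.tgt e)) ∧
        ∀ v, G.conormalSum a u u' v = 0 := by
  constructor
  · rintro ⟨f₁, f₂, u, u', hu, ⟨φ, hφ⟩, hK, hF⟩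
    rw [isSobolevTwo_iff] at hu
    exact ⟨f₁, f₂, u, u', φ, fun e => ⟨(hu e).1, (hu e).2.1, (hu e).2.2.1, (hu e).2.2.2, hF e⟩,
      hφ, hK⟩
  · rintro ⟨f₁, f₂, u, u', φ, h, hφ, hK⟩
    refine ⟨f₁, f₂, u, u', ?_, ⟨φ, hφ⟩, hK, fun e => (h e).eq⟩
    rw [isSobolevTwo_iff]
    exact fun e => ⟨(h e).repr, (h e).repr_deriv, (h e).prim, (h e).prim_deriv⟩

end MetricGraph

/-! ### Shift operators and the symbol of the vertex equations. -/

/-- The space of square summable sequences indexed by `ι`. -/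
abbrev SeqL2 (ι : Type) : Type := lp (fun _ : ι => ℂ) 2

/-- Composition with a permutation of the index set. -/
def shiftOp {ι : Type} (σ : ι ≃ ι) : SeqL2 ι →L[ℂ] SeqL2 ι :=
  LinearMap.mkContinuous
    { toFun := fun φ => ⟨fun i => φ (σ i),
        memℓp_gen' (C := ‖φ‖ ^ 2) fun s => by
          simpa using ((SqBound.of_lp φ).comp σ.injective).2 s⟩
      map_add' := fun _ _ => rfl
      map_smul' := fun _ _ => rfl } 1 fun φ => by
    rw [one_mul]
    exact lp.norm_le_of_forall_sum_le (by norm_num) (norm_nonneg _) fun s => by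
      have h := ((SqBound.of_lp φ).comp σ.injective).2 s
      simp only [ENNReal.toReal_ofNat, Real.rpow_ofNat]
      exact h

@[simp]
theorem shiftOp_apply {ι : Type} (σ : ι ≃ ι) (φ : SeqL2 ι) (i : ι) :
    shiftOp σ φ i = φ (σ i) := rfl

theorem norm_shiftOp_le {ι : Type} (σ : ι ≃ ι) : ‖shiftOp σ‖ ≤ 1 :=
  LinearMap.mkContinuous_norm_le _ zero_le_one _

theorem shiftOp_mul_symm {ι : Type} (σ : ι ≃ ι) : shiftOp σ * shiftOp σ.symm = 1 := by
  ext φ i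
  change φ (σ.symm (σ i)) = φ i
  simp

theorem shiftOp_symm_mul {ι : Type} (σ : ι ≃ ι) : shiftOp σ.symm * shiftOp σ = 1 := by
  ext φ i
  change φ (σ (σ.symm i)) = φ i
  simp

instance {ι : Type} [Nonempty ι] : Nontrivial (SeqL2 ι) := by
  classical
  refine ⟨⟨lp.single 2 (Classical.arbitrary ι) (1 : ℂ), 0, fun h => ?_⟩⟩
  have := congrArg (fun f : SeqL2 ι => f (Classical.arbitrary ι)) h
  simp at this

/-- The shift and its inverse are both contractions, so `r` and `r⁻¹` both lie in the closed unit
disc. -/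
theorem norm_eq_one_of_mem_spectrum_shiftOp {ι : Type} [Nonempty ι] (σ : ι ≃ ι) {r : ℂ}
    (hr : r ∈ spectrum ℂ (shiftOp σ)) : ‖r‖ = 1 := by
  have h1 : ‖r‖ ≤ 1 := (spectrum.norm_le_norm_of_mem hr).trans (norm_shiftOp_le σ)
  let U : (SeqL2 ι →L[ℂ] SeqL2 ι)ˣ :=
    ⟨shiftOp σ, shiftOp σ.symm, shiftOp_mul_symm σ, shiftOp_symm_mul σ⟩
  have h0 : r ≠ 0 := spectrum.ne_zero_of_mem_of_unit (a := U) hr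
  have h2 : r⁻¹ ∈ spectrum ℂ (shiftOp σ.symm) :=
    spectrum.inv_mem_iff (r := Units.mk0 r h0) (a := U) |>.1 hr
  have h3 : ‖r⁻¹‖ ≤ 1 := (spectrum.norm_le_norm_of_mem h2).trans (norm_shiftOp_le _)
  rw [norm_inv] at h3
  have h4 : 0 < ‖r‖ := norm_pos_iff.2 h0
  refine le_antisymm h1 ?_
  rwa [inv_le_one₀ h4] at h3

/-- The determinant of the symbol of the vertex equations. -/
def symbolDet (c e₁ e₂ r : ℂ) : ℂ :=
  (e₁ * r + e₁⁻¹ * r⁻¹ - 4 * c) * (e₂ * r + e₂⁻¹ * r⁻¹ - 4 * c) - 4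

/-- Multiplying by `L²` clears the inverse and leaves a polynomial in `L`, whose value at `r` is
`r²` times the symbol. By spectral mapping `0` is not in its spectrum, and the unit `L²` can be
cancelled. -/
theorem isUnit_of_symbolDet_ne_zero {A : Type*} [NormedRing A] [NormedAlgebra ℂ A]
    [CompleteSpace A] [Nontrivial A] {L L' : A} (h1 : L * L' = 1) (h2 : L' * L = 1)
    {c e₁ e₂ : ℂ} (hdet : ∀ r ∈ spectrum ℂ L, symbolDet c e₁ e₂ r ≠ 0) :
    IsUnit ((e₁ • L + e₁⁻¹ • L' - (4 * c) • (1 : A)) * (e₂ • L + e₂⁻¹ • L' - (4 * c) • (1 : A))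
      - (4 : ℂ) • (1 : A)) := by
  open Polynomial in
  let p : ℂ[X] := (C e₁ * X ^ 2 + C e₁⁻¹ - C (4 * c) * X) * (C e₂ * X ^ 2 + C e₂⁻¹ - C (4 * c) * X)
    - C 4 * X ^ 2
  let U : Aˣ := ⟨L, L', h1, h2⟩
  have hp : Polynomial.aeval L p = L ^ 2 * ((e₁ • L + e₁⁻¹ • L' - (4 * c) • (1 : A)) *
      (e₂ • L + e₂⁻¹ • L' - (4 * c) • (1 : A)) - (4 : ℂ) • (1 : A)) := by
    have hf : ∀ e : ℂ, L * (e • L + e⁻¹ • L' - (4 * c) • (1 : A)) =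
        e • L ^ 2 + e⁻¹ • (1 : A) - (4 * c) • L := by
      intro e
      simp only [mul_sub, mul_add, mul_smul_comm, h1, mul_one, sq]
    have hcomm : ∀ e : ℂ, Commute L (e • L + e⁻¹ • L' - (4 * c) • (1 : A)) := by
      intro e
      have : Commute L L' := h1.trans h2.symm
      exact (((Commute.refl L).smul_right e).add_right (this.smul_right _)).sub_right
        ((Commute.one_right L).smul_right _)
    have h3 : L ^ 2 * ((e₁ • L + e₁⁻¹ • L' - (4 * c) • (1 : A)) *
      (e₂ • L + e₂⁻¹ • L' - (4 * c) • (1 : A))) = (L * (e₁ • L + e₁⁻¹ • L' - (4 * c) • (1 : A))) *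
      (L * (e₂ • L + e₂⁻¹ • L' - (4 * c) • (1 : A))) := by
      rw [sq, (hcomm e₁).mul_mul_mul_comm]
    rw [mul_sub, h3, hf, hf]
    simp only [p, map_sub, map_mul, map_add, Polynomial.aeval_C, Polynomial.aeval_X, map_pow,
      Algebra.algebraMap_eq_smul_one, smul_mul_assoc, one_mul, mul_smul_comm, mul_one,
      smul_smul, mul_comm c 4]
  have hpu : IsUnit (Polynomial.aeval L p) := by
    rw [← spectrum.zero_notMem_iff ℂ, spectrum.map_polynomial_aeval_of_nonempty _ _
      (spectrum.nonempty L)]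
    rintro ⟨r, hr, h0⟩
    have hr0 : r ≠ 0 := spectrum.ne_zero_of_mem_of_unit (a := U) hr
    refine hdet r hr ?_
    simp only [p, Polynomial.eval_sub, Polynomial.eval_mul, Polynomial.eval_add,
      Polynomial.eval_C, Polynomial.eval_X, Polynomial.eval_pow] at h0
    have : symbolDet c e₁ e₂ r * r ^ 2 = 0 := by
      rw [← h0]
      unfold symbolDet
      have e3 : ∀ e e' : ℂ, (e * r + e' * r⁻¹ - 4 * c) * r = e * r ^ 2 + e' - 4 * c * r := by
        intro e e'
        field_simp
      linear_combination (e₂ * r + e₂⁻¹ * r⁻¹ - 4 * c) * r * e3 e₁ e₁⁻¹ +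
        (e₁ * r ^ 2 + e₁⁻¹ - 4 * c * r) * e3 e₂ e₂⁻¹
    exact (mul_eq_zero.1 this).resolve_right (pow_ne_zero 2 hr0)
  rw [hp] at hpu
  exact (Units.isUnit_units_mul (U ^ 2) _).1 (by simpa [U] using hpu)

/-- Solvability of a `2 × 2` system with commuting operator coefficients. -/
theorem exists_bound_of_isUnit_det {H : Type*} [NormedAddCommGroup H] [NormedSpace ℂ H]
    {X Y : H →L[ℂ] H} (hXY : X * Y = Y * X) (hD : IsUnit (X * Y - (4 : ℂ) • (1 : H →L[ℂ] H))) :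
    (∃ K, 0 ≤ K ∧ ∀ ψ₁ ψ₂ : H, ∃ φ₁ φ₂ : H, X φ₁ + (2 : ℂ) • φ₂ = ψ₁ ∧
      (2 : ℂ) • φ₁ + Y φ₂ = ψ₂ ∧ ‖φ₁‖ + ‖φ₂‖ ≤ K * (‖ψ₁‖ + ‖ψ₂‖)) ∧
    ∀ φ₁ φ₂ : H, X φ₁ + (2 : ℂ) • φ₂ = 0 → (2 : ℂ) • φ₁ + Y φ₂ = 0 → φ₁ = 0 ∧ φ₂ = 0 := by
  obtain ⟨U, hU⟩ := hD
  set R : H →L[ℂ] H := ((U⁻¹ : (H →L[ℂ] H)ˣ) : H →L[ℂ] H) with hR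
  have e1 : R * (U : H →L[ℂ] H) = 1 := U.inv_mul
  have e2 : (U : H →L[ℂ] H) * R = 1 := U.mul_inv
  have cX : Commute (U : H →L[ℂ] H) X := by
    rw [hU]
    exact (Commute.mul_left (Commute.refl X) (show Y * X = X * Y from hXY.symm)).sub_left
      ((Commute.one_left X).smul_left _)
  have cY : Commute (U : H →L[ℂ] H) Y := by
    rw [hU]
    exact (Commute.mul_left (show X * Y = Y * X from hXY) (Commute.refl Y)).sub_left
      ((Commute.one_left Y).smul_left _)
  have rX : R * X = X * R := cX.units_inv_left
  have rY : R * Y = Y * R := cY.units_inv_left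
  have aX : ∀ x, X (R x) = R (X x) := fun x => (DFunLike.congr_fun rX x).symm
  have aY : ∀ x, Y (R x) = R (Y x) := fun x => (DFunLike.congr_fun rY x).symm
  have aXY : ∀ x, X (Y x) = Y (X x) := fun x => DFunLike.congr_fun hXY x
  have aD : ∀ x, R (X (Y x) - (4 : ℂ) • x) = x := fun x => by
    have := DFunLike.congr_fun e1 x
    rw [hU] at this
    exact this
  constructor
  -- Cramer's rule for the matrix with rows `(X, 2)` and `(2, Y)`; `R` is the inverse of its
  -- determinant and commutes with `X` and `Y`.
  · refine ⟨‖R‖ * (‖X‖ + ‖Y‖ + 4), by positivity, fun ψ₁ ψ₂ =>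
      ⟨R (Y ψ₁ - (2 : ℂ) • ψ₂), R (X ψ₂ - (2 : ℂ) • ψ₁), ?_, ?_, ?_⟩⟩
    · rw [aX, ← map_smul, ← map_add]
      conv_rhs => rw [← aD ψ₁]
      congr 1
      simp only [map_sub, map_smul, smul_sub, smul_smul]
      norm_num
    · rw [aY, ← map_smul, ← map_add]
      conv_rhs => rw [← aD ψ₂]
      congr 1
      simp only [map_sub, map_smul, smul_sub, smul_smul, aXY]
      norm_num
    · have h1 : ‖R (Y ψ₁ - (2 : ℂ) • ψ₂)‖ ≤ ‖R‖ * (‖Y‖ * ‖ψ₁‖ + 2 * ‖ψ₂‖) := by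
        refine (R.le_opNorm _).trans ?_
        gcongr
        refine (norm_sub_le _ _).trans ?_
        rw [norm_smul, Complex.norm_ofNat]
        gcongr
        exact Y.le_opNorm _
      have h2 : ‖R (X ψ₂ - (2 : ℂ) • ψ₁)‖ ≤ ‖R‖ * (‖X‖ * ‖ψ₂‖ + 2 * ‖ψ₁‖) := by
        refine (R.le_opNorm _).trans ?_
        gcongr
        refine (norm_sub_le _ _).trans ?_
        rw [norm_smul, Complex.norm_ofNat]
        gcongr
        exact X.le_opNorm _
      have h3 : 0 ≤ ‖R‖ * (‖X‖ * ‖ψ₁‖ + ‖Y‖ * ‖ψ₂‖ + 2 * ‖ψ₁‖ + 2 * ‖ψ₂‖) := by positivity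
      linarith
  · intro φ₁ φ₂ h1 h2
    have h3 : φ₁ = 0 := by
      rw [← aD φ₁]
      have h4 : X φ₁ = -((2 : ℂ) • φ₂) := eq_neg_of_add_eq_zero_left h1
      have h5 : Y φ₂ = -((2 : ℂ) • φ₁) := eq_neg_of_add_eq_zero_right h2
      rw [aXY, h4, map_neg, map_smul, h5, smul_neg, smul_smul, neg_neg]
      norm_num
    refine ⟨h3, ?_⟩
    rw [h3, map_zero, zero_add] at h1
    exact (smul_eq_zero.1 h1).resolve_left two_ne_zero

/-! ### Tubes over an arbitrary index set and their vertex equations. -/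

/-- The graph `G` is obtained by glueing copies of the elementary cell of the tubular graph, indexed
by `ι`, so that the cell `i` is followed by the cell `σ i`. -/
structure IsTube {V E ι : Type} (G : MetricGraph V E) (ε : ℝ) (σ : ι ≃ ι)
    (ev : ι × TubeVertex ≃ V) (ee : ι × TubeEdge ≃ E) : Prop where
  src : ∀ i k, G.src (ee (i, k)) = ev (i, k.src)
  tgt_bottomHorizontal : ∀ i, G.tgt (ee (i, .bottomHorizontal)) = ev (σ i, .bottom)
  tgt_topHorizontal : ∀ i, G.tgt (ee (i, .topHorizontal)) = ev (σ i, .top)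
  tgt_front : ∀ i, G.tgt (ee (i, .front)) = ev (i, .top)
  tgt_back : ∀ i, G.tgt (ee (i, .back)) = ev (i, .top)
  len : ∀ e, G.len e = ε

/-- The potential on the edges of a tube: `a₁` and `a₂` on the horizontal edges, `0` on the rest. -/
structure IsTubePotential {E ι : Type} (ee : ι × TubeEdge ≃ E) (a : E → ℝ) (a₁ a₂ : ℝ) : Prop where
  bottomHorizontal : ∀ i, a (ee (i, .bottomHorizontal)) = a₁
  topHorizontal : ∀ i, a (ee (i, .topHorizontal)) = a₂
  front : ∀ i, a (ee (i, .front)) = 0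
  back : ∀ i, a (ee (i, .back)) = 0

theorem IsTubePotential.abs_le {E ι : Type} {ee : ι × TubeEdge ≃ E} {a : E → ℝ} {a₁ a₂ : ℝ}
    (h : IsTubePotential ee a a₁ a₂) (e : E) : |a e| ≤ |a₁| + |a₂| := by
  obtain ⟨⟨i, k⟩, rfl⟩ := ee.surjective e
  have h1 := abs_nonneg a₁
  have h2 := abs_nonneg a₂
  cases k
  · rw [h.bottomHorizontal]; linarith
  · rw [h.topHorizontal]; linarith
  · rw [h.front, abs_zero]; linarith
  · rw [h.back, abs_zero]; linarith

theorem finsum_mem_triple {α : Type} (F : α → ℂ) {x y w : α} (hxy : x ≠ y) (hxw : x ≠ w)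
    (hyw : y ≠ w) {p : α → Prop} (hp : ∀ e, p e ↔ e = x ∨ e = y ∨ e = w) :
    ∑ᶠ (e : α) (_ : p e), F e = F x + (F y + F w) := by
  have hs : {e | p e} = {x, y, w} := by
    ext e
    simp [hp]
  change ∑ᶠ e ∈ {e | p e}, F e = _
  rw [hs, finsum_mem_insert _ (by simp [hxy, hxw]) (Set.toFinite _), finsum_mem_pair hyw]

theorem finsum_mem_single {α : Type} (F : α → ℂ) {x : α} {p : α → Prop}
    (hp : ∀ e, p e ↔ e = x) : ∑ᶠ (e : α) (_ : p e), F e = F x := by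
  have hs : {e | p e} = {x} := by
    ext e
    simp [hp]
  change ∑ᶠ e ∈ {e | p e}, F e = _
  rw [hs, finsum_mem_singleton]

theorem EdgeSolution.conormal_of_eq {ℓ ε z a : ℝ} {C S : ℝ → ℝ}
    {g f f₁ f₂ : EdgeL2 ℓ} {u u' : ℝ → ℂ} (P : FundamentalPair z C S) (hε : 0 < ε) (hℓ : ℓ = ε)
    (h : EdgeSolution ℓ z a g f f₁ f₂ u u') :
    S ε * (u' 0 + Complex.I * a * u 0) =
        Complex.exp (Complex.I * a * ε) * u ε - C ε * u 0 + edgeSource ε a C S g ∧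
      S ε * (u' ε + Complex.I * a * u ε) =
        C ε * u ε - (Complex.exp (Complex.I * a * ε))⁻¹ * u 0
          - (Complex.exp (Complex.I * a * ε))⁻¹ * edgeMean ε a S g := by
  subst hℓ
  have := h.conormal P hε.le
  rwa [Complex.exp_neg] at this

theorem EdgeSolution.trace_le_of_eq {ℓ ε z a : ℝ} {g f f₁ f₂ : EdgeL2 ℓ}
    {u u' : ℝ → ℂ} (hε : 0 < ε) (hℓ : ℓ = ε) (h : EdgeSolution ℓ z a g f f₁ f₂ u u') :
    ‖u 0‖ ≤ (√ε / ε) * ‖f‖ + √ε * ‖f₁‖ := by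
  subst hℓ
  exact h.trace_le hε

/-- The operator on the left-hand side of the vertex equations. -/
def vertexOp {ι : Type} (σ : ι ≃ ι) (c e : ℂ) : SeqL2 ι →L[ℂ] SeqL2 ι :=
  e • shiftOp σ + e⁻¹ • shiftOp σ.symm - (4 * c) • (1 : SeqL2 ι →L[ℂ] SeqL2 ι)

theorem vertexOp_apply {ι : Type} (σ : ι ≃ ι) (c e : ℂ) (φ : SeqL2 ι) (i : ι) :
    vertexOp σ c e φ i = e * φ (σ i) + e⁻¹ * φ (σ.symm i) - 4 * c * φ i := by
  simp only [vertexOp, sub_apply, add_apply, smul_apply, one_apply_eq_self, lp.coeFn_sub,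
    lp.coeFn_add, lp.coeFn_smul, Pi.sub_apply, Pi.add_apply, Pi.smul_apply, smul_eq_mul, shiftOp_apply]

theorem vertexOp_comm {ι : Type} (σ : ι ≃ ι) (c e e' : ℂ) :
    vertexOp σ c e * vertexOp σ c e' = vertexOp σ c e' * vertexOp σ c e := by
  have h : Commute (shiftOp σ) (shiftOp σ.symm) :=
    (shiftOp_mul_symm σ).trans (shiftOp_symm_mul σ).symm
  have h1 : ∀ e, Commute (shiftOp σ) (vertexOp σ c e) := fun e =>
    (((Commute.refl _).smul_right e).add_right (h.smul_right _)).sub_right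
        ((Commute.one_right _).smul_right _)
  have h2 : ∀ e, Commute (shiftOp σ.symm) (vertexOp σ c e) := fun e =>
    ((h.symm.smul_right e).add_right ((Commute.refl _).smul_right _)).sub_right
        ((Commute.one_right _).smul_right _)
  exact (((h1 e').smul_left e).add_left ((h2 e').smul_left _)).sub_left
    ((Commute.one_left _).smul_left _)

namespace IsTube

variable {V E ι : Type} {G : MetricGraph V E} {ε : ℝ} {σ : ι ≃ ι}
  {ev : ι × TubeVertex ≃ V} {ee : ι × TubeEdge ≃ E} (hG : IsTube G ε σ ev ee)
  {a : E → ℝ} {a₁ a₂ z : ℝ} {C S : ℝ → ℝ}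

include hG

theorem conormalSum_bottom (a : E → ℝ) (u u' : E → ℝ → ℂ) (i : ι) :
    G.conormalSum a u u' (ev (i, .bottom)) =
      (u' (ee (i, .bottomHorizontal)) 0 +
        Complex.I * a (ee (i, .bottomHorizontal)) * u (ee (i, .bottomHorizontal)) 0) +
      ((u' (ee (i, .front)) 0 + Complex.I * a (ee (i, .front)) * u (ee (i, .front)) 0) +
      (u' (ee (i, .back)) 0 + Complex.I * a (ee (i, .back)) * u (ee (i, .back)) 0)) -
      (u' (ee (σ.symm i, .bottomHorizontal)) ε +
        Complex.I * a (ee (σ.symm i, .bottomHorizontal)) *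
          u (ee (σ.symm i, .bottomHorizontal)) ε) := by
  unfold MetricGraph.conormalSum
  rw [finsum_mem_triple (x := ee (i, .bottomHorizontal)) (y := ee (i, .front))
    (w := ee (i, .back)) _ (by simp) (by simp) (by simp), finsum_mem_single _
    (x := ee (σ.symm i, .bottomHorizontal)), hG.len]
  · intro e
    obtain ⟨⟨j, k⟩, rfl⟩ := ee.surjective e
    cases k <;> simp [hG.tgt_bottomHorizontal, hG.tgt_topHorizontal, hG.tgt_front, hG.tgt_back,
      Equiv.eq_symm_apply]
  · intro e
    obtain ⟨⟨j, k⟩, rfl⟩ := ee.surjective e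
    cases k <;> simp [hG.src, TubeEdge.src]

theorem conormalSum_top (a : E → ℝ) (u u' : E → ℝ → ℂ) (i : ι) :
    G.conormalSum a u u' (ev (i, .top)) =
      (u' (ee (i, .topHorizontal)) 0 +
        Complex.I * a (ee (i, .topHorizontal)) * u (ee (i, .topHorizontal)) 0) -
      ((u' (ee (σ.symm i, .topHorizontal)) ε +
        Complex.I * a (ee (σ.symm i, .topHorizontal)) *
          u (ee (σ.symm i, .topHorizontal)) ε) +
      ((u' (ee (i, .front)) ε + Complex.I * a (ee (i, .front)) * u (ee (i, .front)) ε) +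
      (u' (ee (i, .back)) ε + Complex.I * a (ee (i, .back)) * u (ee (i, .back)) ε))) := by
  unfold MetricGraph.conormalSum
  rw [finsum_mem_single _ (x := ee (i, .topHorizontal)),
    finsum_mem_triple (x := ee (σ.symm i, .topHorizontal)) (y := ee (i, .front))
    (w := ee (i, .back)) _ (by simp) (by simp) (by simp), hG.len, hG.len, hG.len]
  · intro e
    obtain ⟨⟨j, k⟩, rfl⟩ := ee.surjective e
    cases k <;> simp [hG.tgt_bottomHorizontal, hG.tgt_topHorizontal, hG.tgt_front, hG.tgt_back,
      Equiv.eq_symm_apply]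
  · intro e
    obtain ⟨⟨j, k⟩, rfl⟩ := ee.surjective e
    cases k <;> simp [hG.src, TubeEdge.src]

/-- The source term of the vertex equation at the bottom vertex of the cell `i`. -/
def bottomSource (ee : ι × TubeEdge ≃ E) (σ : ι ≃ ι) (ε a₁ : ℝ) (C S : ℝ → ℝ) (g : E → ℝ → ℂ)
    (i : ι) : ℂ :=
  -(edgeSource ε a₁ C S (g (ee (i, .bottomHorizontal))) + edgeSource ε 0 C S (g (ee (i, .front)))
    + edgeSource ε 0 C S (g (ee (i, .back))) + (Complex.exp (Complex.I * a₁ * ε))⁻¹ *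
      edgeMean ε a₁ S (g (ee (σ.symm i, .bottomHorizontal))))

/-- The source term of the vertex equation at the top vertex of the cell `i`. -/
def topSource (ee : ι × TubeEdge ≃ E) (σ : ι ≃ ι) (ε a₂ : ℝ) (C S : ℝ → ℝ) (g : E → ℝ → ℂ)
    (i : ι) : ℂ :=
  -(edgeSource ε a₂ C S (g (ee (i, .topHorizontal))) + edgeMean ε 0 S (g (ee (i, .front)))
    + edgeMean ε 0 S (g (ee (i, .back))) + (Complex.exp (Complex.I * a₂ * ε))⁻¹ *
      edgeMean ε a₂ S (g (ee (σ.symm i, .topHorizontal))))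

/-- Four edge ends meet at every vertex, and each contributes `-C ε` times the value there, whence
`4 C ε`. The opposite ends contribute the neighbouring values: two with magnetic phases along the
axis, and twice the other vertex of the cell through the parallel edges. -/
theorem vertex_equation (P : FundamentalPair z C S) (hε : 0 < ε)
    (ha : IsTubePotential ee a a₁ a₂) {g f f₁ f₂ : G.L2} {u u' : E → ℝ → ℂ} {φ : V → ℂ}
    (h : ∀ e, EdgeSolution (G.len e) z (a e) (g e) (f e) (f₁ e) (f₂ e) (u e) (u' e))
    (hφ : ∀ e, u e 0 = φ (G.src e) ∧ u e (G.len e) = φ (G.tgt e)) (i : ι) :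
    S ε * G.conormalSum a u u' (ev (i, .bottom)) =
        Complex.exp (Complex.I * a₁ * ε) * φ (ev (σ i, .bottom)) +
        (Complex.exp (Complex.I * a₁ * ε))⁻¹ * φ (ev (σ.symm i, .bottom))
        - 4 * C ε * φ (ev (i, .bottom)) + 2 * φ (ev (i, .top)) -
        bottomSource ee σ ε a₁ C S (fun e => g e) i ∧
      S ε * G.conormalSum a u u' (ev (i, .top)) =
        Complex.exp (Complex.I * a₂ * ε) * φ (ev (σ i, .top)) +
        (Complex.exp (Complex.I * a₂ * ε))⁻¹ * φ (ev (σ.symm i, .top))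
        - 4 * C ε * φ (ev (i, .top)) + 2 * φ (ev (i, .bottom)) -
        topSource ee σ ε a₂ C S (fun e => g e) i := by
  have hc : ∀ e, (S ε * (u' e 0 + Complex.I * a e * u e 0) =
        Complex.exp (Complex.I * a e * ε) * u e ε - C ε * u e 0 + edgeSource ε (a e) C S (g e)) ∧
      S ε * (u' e ε + Complex.I * a e * u e ε) =
        C ε * u e ε - (Complex.exp (Complex.I * a e * ε))⁻¹ * u e 0
          - (Complex.exp (Complex.I * a e * ε))⁻¹ * edgeMean ε (a e) S (g e) :=
    fun e => (h e).conormal_of_eq P hε (hG.len e)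
  have hu0 : ∀ e, u e 0 = φ (G.src e) := fun e => (hφ e).1
  have huε : ∀ e, u e ε = φ (G.tgt e) := fun e => by
    have := (hφ e).2
    rwa [hG.len] at this
  have b0 := fun i => hc (ee (i, .bottomHorizontal))
  have t0 := fun i => hc (ee (i, .topHorizontal))
  have f0 := hc (ee (i, .front))
  have k0 := hc (ee (i, .back))
  simp only [hu0, huε, hG.src, hG.tgt_bottomHorizontal, hG.tgt_topHorizontal, hG.tgt_front,
    hG.tgt_back, TubeEdge.src, ha.bottomHorizontal, ha.topHorizontal, ha.front, ha.back,
    Complex.ofReal_zero, mul_zero, zero_mul, Complex.exp_zero, one_mul, inv_one] at b0 t0 f0 k0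
  rw [hG.conormalSum_bottom, hG.conormalSum_top]
  simp only [hu0, huε, hG.src, hG.tgt_bottomHorizontal, hG.tgt_topHorizontal, hG.tgt_front,
    hG.tgt_back, TubeEdge.src, ha.bottomHorizontal, ha.topHorizontal, ha.front, ha.back,
    Complex.ofReal_zero, mul_zero, zero_mul, bottomSource, topSource]
  have b1 := (b0 (σ.symm i)).2
  have t1 := (t0 (σ.symm i)).2
  simp only [Equiv.apply_symm_apply] at b1 t1 ⊢
  constructor
  · linear_combination (b0 i).1 + f0.1 + k0.1 - b1
  · linear_combination (t0 i).1 - t1 - f0.2 - k0.2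

theorem exists_source_bound (P : FundamentalPair z C S) (hε : 0 < ε) (a₁ a₂ : ℝ) :
    ∃ K, 0 ≤ K ∧ ∀ g : G.L2,
      SqBound (fun i => ‖bottomSource ee σ ε a₁ C S (fun e => g e) i‖) (K * ‖g‖) ∧
      SqBound (fun i => ‖topSource ee σ ε a₂ C S (fun e => g e) i‖) (K * ‖g‖) := by
  obtain ⟨K, hK, hb⟩ := exists_edgeSource_bound P hε
  refine ⟨4 * K, by positivity, fun g => ?_⟩
  have hS : ∀ (a : ℝ) e, ‖edgeMean ε a S (g e)‖ ≤ K * ‖g e‖ := fun a e =>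
    (hb _ (hG.len e) a (g e)).1
  have hI : ∀ (a : ℝ) e, ‖edgeSource ε a C S (g e)‖ ≤ K * ‖g e‖ := fun a e =>
    (hb _ (hG.len e) a (g e)).2
  have hg := SqBound.of_lp g
  have hinj : ∀ k, Function.Injective fun i => ee (i, k) := fun k i j hij => by
    simpa using hij
  have hinj' : ∀ k, Function.Injective fun i => ee (σ.symm i, k) := fun k i j hij => by
    simpa using hij
  have he : ∀ a : ℝ, ‖(Complex.exp (Complex.I * a * ε))⁻¹‖ = 1 := fun a => by
    rw [norm_inv, norm_cexp_I_mul, inv_one]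
  have hs : ∀ k, SqBound (fun i => K * (‖g (ee (i, k))‖ + ‖g (ee (i, .front))‖ +
      ‖g (ee (i, .back))‖ + ‖g (ee (σ.symm i, k))‖)) (4 * K * ‖g‖) := fun k => by
    refine (((((hg.comp (hinj k)).add (hg.comp (hinj .front))).add
      (hg.comp (hinj .back))).add (hg.comp (hinj' k))).const_mul hK).mono_right (le_of_eq ?_)
    ring
  constructor
  · refine (hs .bottomHorizontal).mono fun i => ?_
    rw [abs_of_nonneg (norm_nonneg _)]
    refine le_trans ?_ (le_abs_self _)
    rw [bottomSource, norm_neg]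
    refine (norm_add_le _ _).trans ?_
    rw [norm_mul, he, one_mul]
    have h1 := norm_add₃_le (a := edgeSource ε a₁ C S (g (ee (i, .bottomHorizontal))))
      (b := edgeSource ε 0 C S (g (ee (i, .front)))) (c := edgeSource ε 0 C S (g (ee (i, .back))))
    linarith [hI a₁ (ee (i, .bottomHorizontal)), hI 0 (ee (i, .front)), hI 0 (ee (i, .back)),
      hS a₁ (ee (σ.symm i, .bottomHorizontal))]
  · refine (hs .topHorizontal).mono fun i => ?_
    rw [abs_of_nonneg (norm_nonneg _)]
    refine le_trans ?_ (le_abs_self _)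
    rw [topSource, norm_neg]
    refine (norm_add_le _ _).trans ?_
    rw [norm_mul, he, one_mul]
    have h1 := norm_add₃_le (a := edgeSource ε a₂ C S (g (ee (i, .topHorizontal))))
      (b := edgeMean ε 0 S (g (ee (i, .front)))) (c := edgeMean ε 0 S (g (ee (i, .back))))
    linarith [hI a₂ (ee (i, .topHorizontal)), hS 0 (ee (i, .front)), hS 0 (ee (i, .back)),
      hS a₂ (ee (σ.symm i, .topHorizontal))]

/-- The vertex values of an element of the domain are square summable and satisfy the vertex
equations. -/
theorem exists_vertex_values (P : FundamentalPair z C S) (hε : 0 < ε)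
    (ha : IsTubePotential ee a a₁ a₂) {f g : G.L2}
    (h : (f, g + (z : ℂ) • f) ∈ G.magneticLaplacian a) :
    ∃ (φ₁ φ₂ : SeqL2 ι),
      (∀ i, (vertexOp σ (C ε) (Complex.exp (Complex.I * a₁ * ε)) φ₁ + (2 : ℂ) • φ₂) i =
        bottomSource ee σ ε a₁ C S (fun e => g e) i) ∧
      (∀ i, ((2 : ℂ) • φ₁ + vertexOp σ (C ε) (Complex.exp (Complex.I * a₂ * ε)) φ₂) i =
        topSource ee σ ε a₂ C S (fun e => g e) i) ∧
      (S ε ≠ 0 → g = 0 → φ₁ = 0 → φ₂ = 0 → f = 0) := by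
  obtain ⟨f₁, f₂, u, u', φ, hsol, hφ, hK⟩ := (MetricGraph.mem_magneticLaplacian_iff a f g z).1 h
  have htr : ∀ e, ‖u e 0‖ ≤ (√ε / ε) * ‖f e‖ + √ε * ‖f₁ e‖ := fun e =>
    (hsol e).trace_le_of_eq hε (hG.len e)
  have hinj : ∀ k, Function.Injective fun i => ee (i, k) := fun k i j hij => by
    simpa using hij
  have hsum : ∀ k, SqBound (fun i => ‖u (ee (i, k)) 0‖) ((√ε / ε) * ‖f‖ + √ε * ‖f₁‖) := by
    intro k
    refine ((((SqBound.of_lp f).comp (hinj k)).const_mul (by positivity)).add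
      (((SqBound.of_lp f₁).comp (hinj k)).const_mul (by positivity))).mono fun i => ?_
    rw [abs_of_nonneg (norm_nonneg _)]
    exact (htr _).trans (le_abs_self _)
  obtain ⟨φ₁, hφ₁, -⟩ := (hsum .bottomHorizontal).exists_lp
  obtain ⟨φ₂, hφ₂, -⟩ := (hsum .topHorizontal).exists_lp
  have e1 : ∀ i, φ₁ i = φ (ev (i, .bottom)) := fun i => by
    rw [hφ₁, (hφ _).1, hG.src]; rfl
  have e2 : ∀ i, φ₂ i = φ (ev (i, .top)) := fun i => by
    rw [hφ₂, (hφ _).1, hG.src]; rfl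
  refine ⟨φ₁, φ₂, fun i => ?_, fun i => ?_, ?_⟩
  · have := (hG.vertex_equation P hε ha hsol hφ i).1
    rw [hK, mul_zero] at this
    simp only [lp.coeFn_add, lp.coeFn_smul, Pi.add_apply, Pi.smul_apply, smul_eq_mul,
      vertexOp_apply, e1, e2]
    linear_combination -this
  · have := (hG.vertex_equation P hε ha hsol hφ i).2
    rw [hK, mul_zero] at this
    simp only [lp.coeFn_add, lp.coeFn_smul, Pi.add_apply, Pi.smul_apply, smul_eq_mul,
      vertexOp_apply, e1, e2]
    linear_combination -this
  · rintro hS rfl rfl rfl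
    have hv : ∀ v, φ v = 0 := by
      intro v
      obtain ⟨⟨i, k⟩, rfl⟩ := ev.surjective v
      cases k
      · rw [← e1]; rfl
      · rw [← e2]; rfl
    ext1
    funext e
    have hs : S (G.len e) ≠ 0 := by rwa [hG.len]
    refine (hsol e).eq_zero P (G.len_pos e).le hs ?_ ?_
    · rw [(hφ e).1, hv]
    · rw [(hφ e).2, hv]

/-- Read off from the source bound at `g = 0`, which saves evaluating the integrals. -/
theorem source_zero (P : FundamentalPair z C S) (hε : 0 < ε) (i : ι) :
    bottomSource ee σ ε a₁ C S (fun e => (0 : G.L2) e) i = 0 ∧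
      topSource ee σ ε a₂ C S (fun e => (0 : G.L2) e) i = 0 := by
  obtain ⟨K, -, h⟩ := hG.exists_source_bound P hε a₁ a₂
  obtain ⟨h1, h2⟩ := h 0
  have h3 := h1.2 {i}
  have h4 := h2.2 {i}
  simp only [norm_zero, mul_zero, Finset.sum_singleton, ne_eq, OfNat.ofNat_ne_zero,
    not_false_eq_true, zero_pow] at h3 h4
  exact ⟨norm_eq_zero.1 (pow_eq_zero_iff two_ne_zero |>.1 (le_antisymm h3 (sq_nonneg _))),
    norm_eq_zero.1 (pow_eq_zero_iff two_ne_zero |>.1 (le_antisymm h4 (sq_nonneg _)))⟩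

/-- A point at which the symbol is invertible belongs to the resolvent set. -/
theorem notMem_spectrum [Nonempty ι] (P : FundamentalPair z C S) (hε : 0 < ε) (hS : S ε ≠ 0)
    (ha : IsTubePotential ee a a₁ a₂)
    (hdet : ∀ r ∈ spectrum ℂ (shiftOp σ), symbolDet (C ε) (Complex.exp (Complex.I * a₁ * ε))
      (Complex.exp (Complex.I * a₂ * ε)) r ≠ 0) :
    (z : ℂ) ∉ operatorSpectrum (G.magneticLaplacian a) := by
  have hU := isUnit_of_symbolDet_ne_zero (shiftOp_mul_symm σ) (shiftOp_symm_mul σ) hdet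
  obtain ⟨⟨K₁, hK₁, hex⟩, huniq⟩ := exists_bound_of_isUnit_det
    (X := vertexOp σ (C ε) (Complex.exp (Complex.I * a₁ * ε)))
    (Y := vertexOp σ (C ε) (Complex.exp (Complex.I * a₂ * ε))) (vertexOp_comm _ _ _ _) hU
  obtain ⟨K₂, hK₂, hsrc⟩ := hG.exists_source_bound P hε a₁ a₂
  obtain ⟨K₃, hK₃, hedge⟩ := exists_edgeSolution P hε hS (|a₁| + |a₂|)
  have : Fintype TubeEdge := Fintype.ofFinite _
  refine notMem_operatorSpectrum (MetricGraph.magneticLaplacian_add a)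
    (MetricGraph.magneticLaplacian_smul a)
    (K := (Fintype.card TubeEdge) * (K₃ * (2 * (K₁ * (2 * K₂)) + 1))) (fun g => ?_) ?_
  -- Existence: invert the vertex system for the source terms, solve the Dirichlet problem on every
  -- edge with the resulting values, and recover the Kirchhoff conditions from the vertex equations
  -- by cancelling `S ε`.
  · obtain ⟨ψ₁, hψ₁, hn₁⟩ := (hsrc g).1.exists_lp
    obtain ⟨ψ₂, hψ₂, hn₂⟩ := (hsrc g).2.exists_lp
    obtain ⟨φ₁, φ₂, h1, h2, h3⟩ := hex ψ₁ ψ₂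
    let Φ : ι × TubeVertex → ℂ := fun p => TubeVertex.casesOn p.2 (φ₁ p.1) (φ₂ p.1)
    let φ : V → ℂ := fun v => Φ (ev.symm v)
    have hΦ : ∀ p, ‖φ (ev p)‖ ≤ ‖φ₁ p.1‖ + ‖φ₂ p.1‖ := by
      rintro ⟨i, k⟩
      simp only [φ, Equiv.symm_apply_apply]
      cases k
      · exact le_add_of_nonneg_right (norm_nonneg _)
      · exact le_add_of_nonneg_left (norm_nonneg _)
    have hb : ∀ i, φ (ev (i, .bottom)) = φ₁ i := fun i => by simp [φ, Φ]
    have ht : ∀ i, φ (ev (i, .top)) = φ₂ i := fun i => by simp [φ, Φ]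
    choose f f₁ f₂ u u' hsol hu0 huε hfn hf₁n hf₂n using fun e => hedge (G.len e) (hG.len e) (a e)
      (ha.abs_le e) (g e) (φ (G.src e)) (φ (G.tgt e))
    set c := K₃ * ((‖φ₁‖ + ‖φ₂‖) + (‖φ₁‖ + ‖φ₂‖) + ‖g‖) with hc
    have hslice : ∀ k, SqBound (fun i => K₃ * (‖φ (G.src (ee (i, k)))‖ +
        ‖φ (G.tgt (ee (i, k)))‖ + ‖g (ee (i, k))‖)) c := by
      intro k
      have hinj : Function.Injective fun i => ee (i, k) := fun i j hij => by simpa using hij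
      have hs : SqBound (fun i => ‖φ (G.src (ee (i, k)))‖) (‖φ₁‖ + ‖φ₂‖) := by
        refine ((SqBound.of_lp φ₁).add (SqBound.of_lp φ₂)).mono fun i => ?_
        rw [hG.src, abs_of_nonneg (norm_nonneg _)]
        exact (hΦ _).trans (le_abs_self _)
      have hs' : SqBound (fun i => ‖φ (G.tgt (ee (i, k)))‖) (‖φ₁‖ + ‖φ₂‖) := by
        have hτ : ∃ τ : ι ≃ ι, ∃ w, ∀ i, G.tgt (ee (i, k)) = ev (τ i, w) := by
          cases k
          · exact ⟨σ, _, hG.tgt_bottomHorizontal⟩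
          · exact ⟨σ, _, hG.tgt_topHorizontal⟩
          · exact ⟨Equiv.refl _, _, hG.tgt_front⟩
          · exact ⟨Equiv.refl _, _, hG.tgt_back⟩
        obtain ⟨τ, w, hτ⟩ := hτ
        refine (((SqBound.of_lp φ₁).comp τ.injective).add
          ((SqBound.of_lp φ₂).comp τ.injective)).mono fun i => ?_
        rw [hτ, abs_of_nonneg (norm_nonneg _)]
        exact (hΦ _).trans (le_abs_self _)
      exact ((hs.add hs').add ((SqBound.of_lp g).comp hinj)).const_mul hK₃
    have hall : ∀ F : ∀ e, Lp ℂ 2 (G.edgeMeasure e), (∀ e, ‖F e‖ ≤ K₃ * (‖φ (G.src e)‖ +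
        ‖φ (G.tgt e)‖ + ‖g e‖)) →
        ∃ F' : G.L2, (∀ e, F' e = F e) ∧ ‖F'‖ ≤ (Fintype.card TubeEdge) * c := by
      intro F hF
      have := SqBound.of_fibres ee (h := fun e => ‖F e‖) (c := fun _ => c) fun k =>
        (hslice k).mono fun i => by
          rw [abs_of_nonneg (norm_nonneg _)]
          exact (hF _).trans (le_abs_self _)
      simp only [Finset.sum_const, Finset.card_univ, nsmul_eq_mul] at this
      exact this.exists_lp
    obtain ⟨f', hf', hf'n⟩ := hall f hfn
    obtain ⟨f₁', hf₁', -⟩ := hall f₁ hf₁n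
    obtain ⟨f₂', hf₂', -⟩ := hall f₂ hf₂n
    have hsol' : ∀ e, EdgeSolution (G.len e) z (a e) (g e) (f' e) (f₁' e) (f₂' e) (u e) (u' e) :=
      fun e => by rw [hf', hf₁', hf₂']; exact hsol e
    have hφ : ∀ e, u e 0 = φ (G.src e) ∧ u e (G.len e) = φ (G.tgt e) :=
      fun e => ⟨hu0 e, huε e⟩
    refine ⟨f', (MetricGraph.mem_magneticLaplacian_iff a f' g z).2
      ⟨f₁', f₂', u, u', φ, hsol', hφ, fun v => ?_⟩, ?_⟩
    · have hS' : (S ε : ℂ) ≠ 0 := by exact_mod_cast hS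
      refine (mul_eq_zero.1 ?_).resolve_left hS'
      obtain ⟨⟨i, k⟩, rfl⟩ := ev.surjective v
      cases k
      · rw [(hG.vertex_equation P hε ha hsol' hφ i).1, ← hψ₁ i, ← h1]
        simp only [lp.coeFn_add, lp.coeFn_smul, Pi.add_apply, Pi.smul_apply, smul_eq_mul,
          vertexOp_apply, hb, ht]
        ring
      · rw [(hG.vertex_equation P hε ha hsol' hφ i).2, ← hψ₂ i, ← h2]
        simp only [lp.coeFn_add, lp.coeFn_smul, Pi.add_apply, Pi.smul_apply, smul_eq_mul,
          vertexOp_apply, hb, ht]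
        ring
    · refine hf'n.trans ?_
      rw [mul_assoc, hc, mul_assoc]
      have h4 : ‖φ₁‖ + ‖φ₂‖ ≤ K₁ * (2 * K₂) * ‖g‖ := by
        refine h3.trans ?_
        rw [mul_assoc]
        gcongr
        linarith
      gcongr
      linarith
  -- Uniqueness: without source the vertex values solve the homogeneous system, so they vanish, and
  -- then so does `f` on every edge.
  · intro f hf
    have hf' : (f, (0 : G.L2) + (z : ℂ) • f) ∈ G.magneticLaplacian a := by rwa [zero_add]
    obtain ⟨φ₁, φ₂, h1, h2, h3⟩ := hG.exists_vertex_values P hε ha hf'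
    obtain ⟨h4, h5⟩ := huniq φ₁ φ₂ (by
        ext i
        rw [h1, (hG.source_zero (a₁ := a₁) (a₂ := a₂) P hε i).1]; rfl) (by
        ext i
        rw [h2, (hG.source_zero (a₁ := a₁) (a₂ := a₂) P hε i).2]; rfl)
    exact h3 hS rfl h4 h5

end IsTube

/-! ### Zeros of the symbol are in the spectrum. -/

theorem edgeMean_zero {ℓ a : ℝ} {χ : ℝ → ℝ} (hℓ : 0 ≤ ℓ) (g : ℝ → ℂ)
    (hg : g =ᵐ[volume.restrict (Set.Ioc 0 ℓ)] 0) : edgeMean ℓ a χ g = 0 := by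
  unfold edgeMean
  rw [intervalIntegral.integral_of_le hℓ]
  refine integral_eq_zero_of_ae ?_
  filter_upwards [hg] with x hx
  simp [hx]

theorem edgeMean_zero_potential {ℓ : ℝ} {χ : ℝ → ℝ} (hℓ : 0 ≤ ℓ) {g h : ℝ → ℂ}
    (hg : g =ᵐ[volume.restrict (Set.Ioc 0 ℓ)] h) :
    edgeMean ℓ 0 χ g = ∫ y in (0 : ℝ)..ℓ, χ y * h y := by
  unfold edgeMean
  rw [intervalIntegral.integral_of_le hℓ, intervalIntegral.integral_of_le hℓ]
  refine integral_congr_ae ?_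
  filter_upwards [hg] with x hx
  simp [hx]

/-- There is a source term on an edge that is not orthogonal to a given solution. -/
theorem exists_source_ne_zero {ε z : ℝ} {C S : ℝ → ℝ}
    (P : FundamentalPair z C S) (hε : 0 < ε) (hS : S ε ≠ 0) (x : ℂ) : ∃ h : ℝ → ℂ, Continuous h ∧
      2 * (S ε * (∫ y in (0 : ℝ)..ε, C y * h y) - C ε * ∫ y in (0 : ℝ)..ε, S y * h y)
        - x * ∫ y in (0 : ℝ)..ε, S y * h y ≠ 0 := by
  have hCc : Continuous fun x => (C x : ℂ) := Complex.continuous_ofReal.comp P.continuous_cos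
  have hSc : Continuous fun x => (S x : ℂ) := Complex.continuous_ofReal.comp P.continuous_sin
  -- Gathered under one integral, the expression is `∫ w h`. With `h` the conjugate of `w` it equals
  -- `∫ |w|²`, positive because `w 0 = 2 S ε ≠ 0`.
  set w : ℝ → ℂ := fun y => 2 * (S ε * C y - C ε * S y) - x * S y with hw
  have hwc : Continuous w := by fun_prop
  have hcc : Continuous fun y => (starRingEnd ℂ) (w y) := Complex.continuous_conj.comp hwc
  refine ⟨fun y => (starRingEnd ℂ) (w y), hcc, ?_⟩
  have h1 : IntervalIntegrable (fun y => (C y : ℂ) * (starRingEnd ℂ) (w y)) volume 0 ε :=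
    (hCc.mul hcc).intervalIntegrable _ _
  have h2 : IntervalIntegrable (fun y => (S y : ℂ) * (starRingEnd ℂ) (w y)) volume 0 ε :=
    (hSc.mul hcc).intervalIntegrable _ _
  have h3 : 2 * (S ε * (∫ y in (0 : ℝ)..ε, (C y : ℂ) * (starRingEnd ℂ) (w y))
      - C ε * ∫ y in (0 : ℝ)..ε, (S y : ℂ) * (starRingEnd ℂ) (w y))
        - x * ∫ y in (0 : ℝ)..ε, (S y : ℂ) * (starRingEnd ℂ) (w y) =
      ((∫ y in (0 : ℝ)..ε, ‖w y‖ ^ 2 : ℝ) : ℂ) := by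
    rw [← intervalIntegral.integral_const_mul, ← intervalIntegral.integral_const_mul,
      ← intervalIntegral.integral_sub (h1.const_mul _) (h2.const_mul _),
      ← intervalIntegral.integral_const_mul, ← intervalIntegral.integral_const_mul,
      ← intervalIntegral.integral_sub (((h1.const_mul _).sub (h2.const_mul _)).const_mul _)
        (h2.const_mul _), ← intervalIntegral.integral_ofReal]
    refine intervalIntegral.integral_congr fun y _ => ?_
    rw [Complex.ofReal_pow, ← Complex.mul_conj']
    simp only [hw]
    ring
  rw [h3]
  have hpos : 0 < ∫ y in (0 : ℝ)..ε, ‖w y‖ ^ 2 := by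
    refine intervalIntegral.integral_pos hε (by fun_prop) (fun y _ => by positivity)
      ⟨0, ⟨le_rfl, hε.le⟩, ?_⟩
    have hw0 : w 0 ≠ 0 := by
      simp only [hw, P.cos_zero, P.sin_zero]
      simpa using hS
    positivity
  exact_mod_cast hpos.ne'

namespace IsTube

variable {V E ι : Type} {G : MetricGraph V E} {ε : ℝ} {σ : ι ≃ ι}
  {ev : ι × TubeVertex ≃ V} {ee : ι × TubeEdge ≃ E} (hG : IsTube G ε σ ev ee)
  {a : E → ℝ} {a₁ a₂ z : ℝ} {C S : ℝ → ℝ}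

include hG

/-- A point at which the symbol degenerates belongs to the spectrum. -/
theorem mem_spectrum (P : FundamentalPair z C S) (hε : 0 < ε) (hS : S ε ≠ 0)
    (ha : IsTubePotential ee a a₁ a₂) {r : ℂ} (hr : r ≠ 0)
    (hdet : symbolDet (C ε) (Complex.exp (Complex.I * a₁ * ε))
      (Complex.exp (Complex.I * a₂ * ε)) r = 0) (i₀ : ι)
    (hδ : ∀ (ω : SeqL2 ι) (κ : ℂ), ω (σ i₀) - r * ω i₀ = κ →
      (∀ i, i ≠ i₀ → ω (σ i) - r * ω i = 0) → κ = 0) :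
    (z : ℂ) ∈ operatorSpectrum (G.magneticLaplacian a) := by
  classical
  rintro ⟨R, hR⟩
  set e₁ := Complex.exp (Complex.I * a₁ * ε) with he₁
  set e₂ := Complex.exp (Complex.I * a₂ * ε) with he₂
  set x : ℂ := e₁ * r + e₁⁻¹ * r⁻¹ - 4 * C ε with hx
  set y : ℂ := e₂ * r + e₂⁻¹ * r⁻¹ - 4 * C ε with hy
  have hxy : x * y - 4 = 0 := hdet
  obtain ⟨h, hhc, hne⟩ := exists_source_ne_zero P hε hS x
  have hg₀ : ∃ g₀ : Lp ℂ 2 (G.edgeMeasure (ee (i₀, .front))),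
      g₀ =ᵐ[volume.restrict (Set.Ioc 0 ε)] h := by
    have key : ∀ ℓ, ℓ = ε → ∃ g₀ : EdgeL2 ℓ, g₀ =ᵐ[volume.restrict (Set.Ioc 0 ε)] h := by
      rintro ℓ rfl
      obtain ⟨B, hB⟩ := isCompact_Icc.exists_bound_of_continuousOn (s := Set.Icc 0 ℓ)
        hhc.continuousOn
      obtain ⟨g₀, hg₀, -⟩ := EdgeL2.exists_of_continuousOn hε.le hhc.continuousOn
        ((norm_nonneg _).trans (hB 0 ⟨le_rfl, hε.le⟩)) hB
      exact ⟨g₀, hg₀⟩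
    exact key _ (hG.len _)
  obtain ⟨g₀, hg₀⟩ := hg₀
  set g : G.L2 := lp.single 2 (ee (i₀, .front)) g₀ with hg
  have hg0 : ∀ e, e ≠ ee (i₀, .front) →
      (g e : ℝ → ℂ) =ᵐ[volume.restrict (Set.Ioc 0 ε)] 0 := by
    intro e he
    rw [hg, lp.single_apply_ne _ _ _ he]
    have key : ∀ ℓ, ℓ = ε →
        ((0 : EdgeL2 ℓ) : ℝ → ℂ) =ᵐ[volume.restrict (Set.Ioc 0 ε)] 0 := by
      rintro ℓ rfl
      exact Lp.coeFn_zero _ _ _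
    exact key _ (hG.len e)
  have hgf : (g (ee (i₀, .front)) : ℝ → ℂ) =ᵐ[volume.restrict (Set.Ioc 0 ε)] h := by
    rw [hg, lp.single_apply_self]
    exact hg₀
  have hm0 : ∀ e, e ≠ ee (i₀, .front) → ∀ a, edgeMean ε a S (g e) = 0 ∧
      edgeSource ε a C S (g e) = 0 := by
    intro e he a
    simp [edgeSource, edgeMean_zero hε.le _ (hg0 e he)]
  obtain ⟨φ₁, φ₂, h1, h2, -⟩ := hG.exists_vertex_values P hε ha ((hR (R g) g).2 rfl)
  have hb0 : ∀ i, i ≠ i₀ → bottomSource ee σ ε a₁ C S (fun e => g e) i = 0 := by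
    intro i hi
    rw [bottomSource, (hm0 _ (by simp) _).2, (hm0 _ (by simp [hi]) _).2, (hm0 _ (by simp) _).2,
      (hm0 _ (by simp) _).1]
    simp
  have ht0 : ∀ i, i ≠ i₀ → topSource ee σ ε a₂ C S (fun e => g e) i = 0 := by
    intro i hi
    rw [topSource, (hm0 _ (by simp) _).2, (hm0 _ (by simp [hi]) _).1, (hm0 _ (by simp) _).1,
      (hm0 _ (by simp) _).1]
    simp
  have hb1 : bottomSource ee σ ε a₁ C S (fun e => g e) i₀ =
      -(S ε * (∫ y in (0 : ℝ)..ε, C y * h y) - C ε * ∫ y in (0 : ℝ)..ε, S y * h y) := by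
    rw [bottomSource, (hm0 _ (by simp) _).2, (hm0 (ee (i₀, .back)) (by simp) _).2,
      (hm0 (ee (σ.symm i₀, .bottomHorizontal)) (by simp) _).1, edgeSource,
      edgeMean_zero_potential hε.le hgf, edgeMean_zero_potential hε.le hgf]
    ring
  have ht1 : topSource ee σ ε a₂ C S (fun e => g e) i₀ =
      -∫ y in (0 : ℝ)..ε, S y * h y := by
    rw [topSource, (hm0 _ (by simp) _).2, (hm0 (ee (i₀, .back)) (by simp) _).1,
      (hm0 (ee (σ.symm i₀, .topHorizontal)) (by simp) _).1,
      edgeMean_zero_potential hε.le hgf]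
    ring
  -- The row `(2, -x)` annihilates the singular matrix with rows `(x, 2)` and `(2, y)`, since `x y =
  -- 4`. Hence twice the bottom equation minus `x` times the top one is divisible by the shift minus
  -- `r`, and `ω` is the quotient. Its source lives at `i₀` only and is nonzero by the choice of
  -- `h`, against `hδ`.
  set ω : SeqL2 ι := (2 : ℂ) • (e₁ • φ₁ - (e₁⁻¹ * r⁻¹) • shiftOp σ.symm φ₁) -
    x • (e₂ • φ₂ - (e₂⁻¹ * r⁻¹) • shiftOp σ.symm φ₂) with hω
  have hrr : r * r⁻¹ = 1 := mul_inv_cancel₀ hr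
  have key : ∀ i, ω (σ i) - r * ω i = 2 * bottomSource ee σ ε a₁ C S (fun e => g e) i -
      x * topSource ee σ ε a₂ C S (fun e => g e) i := by
    intro i
    rw [← h1, ← h2]
    simp only [hω, lp.coeFn_add, lp.coeFn_sub, lp.coeFn_smul, Pi.add_apply, Pi.sub_apply,
      Pi.smul_apply, smul_eq_mul, vertexOp_apply, shiftOp_apply, Equiv.symm_apply_apply]
    linear_combination (2 * φ₁ i) * hx - φ₂ i * x * hy + φ₂ i * hxy
      + (2 * e₁⁻¹ * φ₁ (σ.symm i) - x * e₂⁻¹ * φ₂ (σ.symm i)) * hrr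
  refine hne ?_
  have hκ := hδ ω _ (key i₀) fun i hi => by rw [key, hb0 i hi, ht0 i hi]; ring
  rw [hb1, ht1] at hκ
  linear_combination -hκ

end IsTube

/-! ### The tubular graph and its quotient -/

theorem isTube_tubularGraph (ε : ℝ) (hε : 0 < ε) :
    IsTube (tubularGraph ε hε) ε (Equiv.addRight (1 : ℤ)) (Equiv.refl _) (Equiv.refl _) where
  src _ _ := rfl
  tgt_bottomHorizontal _ := rfl
  tgt_topHorizontal _ := rfl
  tgt_front _ := by simp [tubularGraph, TubeEdge.shift, TubeEdge.tgt]
  tgt_back _ := by simp [tubularGraph, TubeEdge.shift, TubeEdge.tgt]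
  len _ := rfl

theorem isTube_fundamentalGraph (ε : ℝ) (hε : 0 < ε) :
    IsTube (fundamentalGraph ε hε) ε (Equiv.refl Unit) (Equiv.punitProd _)
      (Equiv.punitProd _) where
  src _ _ := rfl
  tgt_bottomHorizontal _ := rfl
  tgt_topHorizontal _ := rfl
  tgt_front _ := rfl
  tgt_back _ := rfl
  len _ := rfl

theorem isTubePotential_tube (a : ℝ) :
    IsTubePotential (Equiv.refl (ℤ × TubeEdge)) (fun e => e.2.potential a) a (-a) where
  bottomHorizontal _ := rfl
  topHorizontal _ := rfl
  front _ := rfl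
  back _ := rfl

theorem isTubePotential_fibre {ε : ℝ} (hε : 0 < ε) (a t : ℝ) :
    IsTubePotential (Equiv.punitProd TubeEdge)
      (fun e => e.potential a + (ε * e.shift) * t / ε) (a + t) (-a + t) where
  bottomHorizontal _ := by
    simp only [Equiv.punitProd_apply, TubeEdge.potential, TubeEdge.shift]
    field_simp
    simp
  topHorizontal _ := by
    simp only [Equiv.punitProd_apply, TubeEdge.potential, TubeEdge.shift]
    field_simp
    simp
  front _ := by simp [TubeEdge.potential, TubeEdge.shift]
  back _ := by simp [TubeEdge.potential, TubeEdge.shift]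

/-- The dispersion function: `z` is in the spectrum of the fibre when it vanishes. -/
def dispersion (A c θ : ℝ) : ℝ :=
  (Real.cos (θ + A) - 2 * c) * (Real.cos (θ - A) - 2 * c) - 1

theorem cexp_add_inv (x : ℝ) :
    Complex.exp (Complex.I * x) + (Complex.exp (Complex.I * x))⁻¹ = 2 * (Real.cos x : ℂ) := by
  rw [← Complex.exp_neg, Complex.ofReal_cos, Complex.two_cos, mul_comm Complex.I, neg_mul]

theorem symbolDet_exp (A c θ : ℝ) :
    symbolDet c (Complex.exp (Complex.I * A)) (Complex.exp (Complex.I * (-A : ℝ)))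
      (Complex.exp (Complex.I * θ)) = 4 * (dispersion A c θ : ℂ) := by
  have h1 := cexp_add_inv (θ + A)
  have h2 := cexp_add_inv (θ - A)
  have e1 : Complex.exp (Complex.I * (θ + A : ℝ)) =
      Complex.exp (Complex.I * A) * Complex.exp (Complex.I * θ) := by
    rw [← Complex.exp_add]; congr 1; push_cast; ring
  have e2 : Complex.exp (Complex.I * (θ - A : ℝ)) =
      Complex.exp (Complex.I * (-A : ℝ)) * Complex.exp (Complex.I * θ) := by
    rw [← Complex.exp_add]; congr 1; push_cast; ring
  rw [e1, mul_inv] at h1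
  rw [e2, mul_inv] at h2
  simp only [symbolDet, dispersion, h1, h2]
  push_cast
  ring

/-- The spectrum of the shift on `ℤ` lies on the unit circle, so a missing `θ` means an invertible
symbol. Conversely, for `|r| = 1` the recursion `ω (i + 1) = r ω i` off `0` makes `|ω|` constant on
each of the half-lines `i ≥ 1` and `i ≤ 0`; square summability makes it zero, and no point source at
`0` can be present. -/
theorem mem_tubeSpectrum_iff {ε z A : ℝ} {C S : ℝ → ℝ} (P : FundamentalPair z C S) (hε : 0 < ε)
    (hS : S ε ≠ 0) : z ∈ tubeSpectrum ε hε A ↔ ∃ θ, dispersion A (C ε) θ = 0 := by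
  have hA : Complex.I * ((A / ε : ℝ) : ℂ) * ε = Complex.I * A := by
    have : (ε : ℂ) ≠ 0 := by exact_mod_cast hε.ne'
    push_cast
    field_simp
  have hA' : Complex.I * ((-(A / ε) : ℝ) : ℂ) * ε = Complex.I * (-A : ℝ) := by
    have : (ε : ℂ) ≠ 0 := by exact_mod_cast hε.ne'
    push_cast
    field_simp
  have hG := isTube_tubularGraph ε hε
  have ha := isTubePotential_tube (A / ε)
  constructor
  · intro h
    by_contra hne
    push Not at hne
    refine hG.notMem_spectrum P hε hS ha (fun r hr => ?_) h
    have hr1 := norm_eq_one_of_mem_spectrum_shiftOp _ hr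
    obtain ⟨θ, rfl⟩ : ∃ θ : ℝ, r = Complex.exp (Complex.I * θ) := by
      refine ⟨r.arg, ?_⟩
      have := Complex.norm_mul_exp_arg_mul_I r
      rw [hr1, Complex.ofReal_one, one_mul] at this
      rw [mul_comm, this]
    rw [hA, hA', symbolDet_exp]
    have := hne θ
    exact mul_ne_zero (by norm_num) (by exact_mod_cast this)
  · rintro ⟨θ, hθ⟩
    refine hG.mem_spectrum P hε hS ha (r := Complex.exp (Complex.I * θ)) (Complex.exp_ne_zero _)
      ?_ 0 ?_
    · rw [hA, hA', symbolDet_exp, hθ]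
      simp
    · intro ω κ h0 hi
      set r := Complex.exp (Complex.I * θ) with hr
      have hr1 : ‖r‖ = 1 := by
        rw [hr, mul_comm]
        exact Complex.norm_exp_ofReal_mul_I θ
      have hsum := (lp.memℓp ω).summable (by norm_num)
      have hconst : ∀ η : ℕ → ℤ, Function.Injective η →
          (∀ n, ‖ω (η (n + 1))‖ = ‖ω (η n)‖) → ω (η 0) = 0 := by
        intro η hη hstep
        have h1 : ∀ n, ‖ω (η n)‖ = ‖ω (η 0)‖ := fun n => by
          induction n with
          | zero => rfl
          | succ n ih => rw [hstep, ih]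
        have h2 := (hsum.comp_injective hη).tendsto_atTop_zero
        simp only [Function.comp_def, h1] at h2
        have h3 := tendsto_nhds_unique h2 tendsto_const_nhds
        simpa using h3.symm
      have hstep : ∀ i : ℤ, i ≠ 0 → ‖ω (i + 1)‖ = ‖ω i‖ := by
        intro i hi0
        have := hi i hi0
        have h4 : ω (i + 1) = r * ω i := sub_eq_zero.1 this
        rw [h4, norm_mul, hr1, one_mul]
      have hp : ω (1 : ℤ) = 0 := by
        have := hconst (fun n => ((n + 1 : ℕ) : ℤ)) (fun m n h => by simpa using h) fun n => by
          have h5 := hstep ((n + 1 : ℕ) : ℤ) (by omega)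
          rwa [show ((n + 1 : ℕ) : ℤ) + 1 = ((n + 1 + 1 : ℕ) : ℤ) by omega] at h5
        simpa using this
      have hn : ω (0 : ℤ) = 0 := by
        have := hconst (fun n => -(n : ℤ)) (fun m n h => by simpa using h) fun n => by
          have h5 := hstep (-((n + 1 : ℕ) : ℤ)) (by omega)
          rw [show -((n + 1 : ℕ) : ℤ) + 1 = -(n : ℤ) by omega] at h5
          exact h5.symm
        simpa using this
      rw [← h0]
      change ω (0 + 1) - r * ω 0 = 0
      rw [zero_add, hp, hn]
      ring

/-- On a single cell the shift is the identity, with spectrum `{1}`. The quasimomentum multiplies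
both magnetic phases by `e^{iεt}`, so the symbol at `1` is that of the tube at `θ = εt`. The
obstruction is trivial here: `ω - 1 · ω = 0`. -/
theorem mem_fibreSpectrum_iff {ε z A t : ℝ} {C S : ℝ → ℝ} (P : FundamentalPair z C S)
    (hε : 0 < ε) (hS : S ε ≠ 0) :
    z ∈ fibreSpectrum ε hε A t ↔ dispersion A (C ε) (ε * t) = 0 := by
  have hε' : (ε : ℂ) ≠ 0 := by exact_mod_cast hε.ne'
  have hG := isTube_fundamentalGraph ε hε
  have ha := isTubePotential_fibre hε (A / ε) t
  have hdet : symbolDet (C ε) (Complex.exp (Complex.I * ((A / ε + t : ℝ) : ℂ) * ε))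
      (Complex.exp (Complex.I * ((-(A / ε) + t : ℝ) : ℂ) * ε)) 1 =
      4 * (dispersion A (C ε) (ε * t) : ℂ) := by
    rw [← symbolDet_exp]
    have e1 : Complex.exp (Complex.I * ((A / ε + t : ℝ) : ℂ) * ε) =
        Complex.exp (Complex.I * A) * Complex.exp (Complex.I * ((ε * t : ℝ) : ℂ)) := by
      rw [← Complex.exp_add]; congr 1; push_cast; field_simp
    have e2 : Complex.exp (Complex.I * ((-(A / ε) + t : ℝ) : ℂ) * ε) =
        Complex.exp (Complex.I * (-A : ℝ)) * Complex.exp (Complex.I * ((ε * t : ℝ) : ℂ)) := by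
      rw [← Complex.exp_add]; congr 1; push_cast; field_simp
    rw [e1, e2]
    simp only [symbolDet, mul_inv, inv_one, mul_one]
  have hL : shiftOp (Equiv.refl Unit) = 1 := rfl
  constructor
  · intro h
    by_contra hne
    refine hG.notMem_spectrum P hε hS ha (fun r hr => ?_) h
    rw [hL, spectrum.one_eq] at hr
    obtain rfl : r = 1 := hr
    rw [hdet]
    exact mul_ne_zero (by norm_num) (by exact_mod_cast hne)
  · intro h0
    refine hG.mem_spectrum P hε hS ha one_ne_zero ?_ () ?_
    · rw [hdet, h0]
      simp
    · intro ω κ h1 _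
      rw [← h1]
      simp

/-- The upper branch of the vertex dispersion relation. -/
def upperBranch (A θ : ℝ) : ℝ :=
  (Real.cos A * Real.cos θ + √(1 + Real.sin A ^ 2 * (1 - Real.cos θ ^ 2))) / 2

theorem one_le_radicand (A θ : ℝ) : 1 ≤ 1 + Real.sin A ^ 2 * (1 - Real.cos θ ^ 2) := by
  have h : 0 ≤ 1 - Real.cos θ ^ 2 := by linarith [Real.cos_sq_le_one θ]
  have := mul_nonneg (sq_nonneg (Real.sin A)) h
  linarith

theorem one_le_sqrt_radicand (A θ : ℝ) :
    1 ≤ √(1 + Real.sin A ^ 2 * (1 - Real.cos θ ^ 2)) := by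
  rw [Real.one_le_sqrt]
  exact one_le_radicand A θ

theorem sq_sqrt_radicand (A θ : ℝ) : √(1 + Real.sin A ^ 2 * (1 - Real.cos θ ^ 2)) ^ 2 =
    1 + Real.sin A ^ 2 * (1 - Real.cos θ ^ 2) :=
  Real.sq_sqrt (zero_le_one.trans (one_le_radicand A θ))

theorem continuous_upperBranch (A : ℝ) : Continuous (upperBranch A) := by
  unfold upperBranch
  fun_prop

theorem abs_cos_mul_cos_le_one (A θ : ℝ) : |Real.cos A * Real.cos θ| ≤ 1 := by
  rw [abs_mul]
  exact mul_le_one₀ (Real.abs_cos_le_one A) (abs_nonneg _) (Real.abs_cos_le_one θ)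

theorem upperBranch_nonneg (A θ : ℝ) : 0 ≤ upperBranch A θ := by
  have h1 := one_le_sqrt_radicand A θ
  have h2 := neg_le_of_abs_le (abs_cos_mul_cos_le_one A θ)
  unfold upperBranch
  linarith

theorem upperBranch_le_one (A θ : ℝ) : upperBranch A θ ≤ 1 := by
  have h2 := le_of_abs_le (abs_cos_mul_cos_le_one A θ)
  have h3 : √(1 + Real.sin A ^ 2 * (1 - Real.cos θ ^ 2)) ≤ 2 - Real.cos A * Real.cos θ := by
    rw [Real.sqrt_le_left (by linarith), Real.sin_sq]
    nlinarith [sq_nonneg (Real.cos A - Real.cos θ)]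
  unfold upperBranch
  linarith

/-- Completing the square in `c` gives `(2c - cos A cos θ)² = 1 + sin² A sin² θ`. The negative root
is the reflected positive one because `cos (θ + π) = -cos θ`. -/
theorem dispersion_eq_zero_iff (A c θ : ℝ) :
    dispersion A c θ = 0 ↔ c = upperBranch A θ ∨ c = -upperBranch A (θ + Real.pi) := by
  have h1 : dispersion A c θ = (2 * c - Real.cos A * Real.cos θ) ^ 2 -
      √(1 + Real.sin A ^ 2 * (1 - Real.cos θ ^ 2)) ^ 2 := by
    rw [sq_sqrt_radicand, dispersion, Real.cos_add, Real.cos_sub]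
    linear_combination (-Real.sin A ^ 2) * Real.sin_sq_add_cos_sq θ
  rw [h1, sub_eq_zero, sq_eq_sq_iff_eq_or_eq_neg]
  unfold upperBranch
  rw [Real.cos_add_pi, neg_sq]
  constructor
  · rintro (h | h)
    · left; linarith
    · right; linarith
  · rintro (h | h)
    · left; linarith
    · right; linarith

/-- A shift of `θ` by `Jπ` and the sign `(-1)^J` of `c` compensate each other. Thus energies near
the wavenumber `Jπ` are treated like those near `0`. -/
theorem dispersion_neg_one_pow (A c θ : ℝ) (J : ℕ) :
    dispersion A ((-1) ^ J * c) (θ + J * Real.pi) = dispersion A c θ := by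
  have h1 : Real.cos (θ + J * Real.pi + A) = (-1) ^ J * Real.cos (θ + A) := by
    rw [← Real.cos_add_nat_mul_pi]; congr 1; ring
  have h2 : Real.cos (θ + J * Real.pi - A) = (-1) ^ J * Real.cos (θ - A) := by
    rw [← Real.cos_add_nat_mul_pi]; congr 1; ring
  have h3 : ((-1 : ℝ) ^ J) * (-1) ^ J = 1 := by
    rw [← mul_pow]; simp
  simp only [dispersion, h1, h2]
  linear_combination ((Real.cos (θ + A) - 2 * c) * (Real.cos (θ - A) - 2 * c)) * h3

/-- This excludes negative energies, for which `c` is a hyperbolic cosine greater than `1`. -/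
theorem dispersion_ne_zero_of_one_lt {A c θ : ℝ} (hc : 1 < c) : dispersion A c θ ≠ 0 := by
  rw [Ne, dispersion_eq_zero_iff, not_or]
  constructor
  · exact ne_of_gt (lt_of_le_of_lt (upperBranch_le_one A θ) hc)
  · exact ne_of_gt (by linarith [upperBranch_nonneg A (θ + Real.pi)])

/-! ### The fundamental pairs -/

theorem fundamentalPair_pos {k : ℝ} (hk : k ≠ 0) :
    FundamentalPair (k ^ 2) (fun x => Real.cos (k * x)) (fun x => Real.sin (k * x) / k) where
  cos_zero := by simp
  sin_zero := by simp
  cos_deriv x := by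
    have := ((hasDerivAt_id x).const_mul k).cos
    refine this.congr_deriv ?_
    simp only [id]
    field_simp
  sin_deriv x := by
    have := (((hasDerivAt_id x).const_mul k).sin).div_const k
    refine this.congr_deriv ?_
    simp only [id]
    field_simp

theorem fundamentalPair_zero : FundamentalPair 0 (fun _ => 1) (fun x => x) where
  cos_zero := rfl
  sin_zero := rfl
  cos_deriv x := (hasDerivAt_const x (1 : ℝ)).congr_deriv (by ring)
  sin_deriv x := hasDerivAt_id x

theorem fundamentalPair_neg {k : ℝ} (hk : k ≠ 0) :
    FundamentalPair (-k ^ 2) (fun x => Real.cosh (k * x)) (fun x => Real.sinh (k * x) / k) where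
  cos_zero := by simp
  sin_zero := by simp
  cos_deriv x := by
    have := ((hasDerivAt_id x).const_mul k).cosh
    refine this.congr_deriv ?_
    simp only [id]
    field_simp
  sin_deriv x := by
    have := (((hasDerivAt_id x).const_mul k).sinh).div_const k
    refine this.congr_deriv ?_
    simp only [id]
    field_simp

/-- The condition on `κ` excludes the Dirichlet eigenvalues. The value `κ = 0` is allowed although
its sine vanishes, because there `S x = x`. -/
theorem exists_fundamentalPair_sq {ε κ : ℝ} (hε : 0 < ε) (hκ : κ = 0 ∨ Real.sin κ ≠ 0) :
    ∃ C S : ℝ → ℝ, FundamentalPair ((κ / ε) ^ 2) C S ∧ S ε ≠ 0 ∧ C ε = Real.cos κ := by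
  have hmul : κ / ε * ε = κ := div_mul_cancel₀ _ hε.ne'
  by_cases h0 : κ = 0
  · subst h0
    refine ⟨_, _, by simpa using fundamentalPair_zero, hε.ne', by simp⟩
  · refine ⟨_, _, fundamentalPair_pos (div_ne_zero h0 hε.ne'), ?_, ?_⟩
    · simp only [hmul]
      exact div_ne_zero (hκ.resolve_left h0) (div_ne_zero h0 hε.ne')
    · simp only [hmul]

theorem exists_fundamentalPair_neg {ε z : ℝ} (hε : 0 < ε) (hz : z < 0) :
    ∃ C S : ℝ → ℝ, FundamentalPair z C S ∧ S ε ≠ 0 ∧ 1 < C ε := by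
  have hk : √(-z) ≠ 0 := (Real.sqrt_pos.2 (by linarith)).ne'
  have hP := fundamentalPair_neg hk
  rw [Real.sq_sqrt (by linarith), neg_neg] at hP
  have hkε : √(-z) * ε ≠ 0 := mul_ne_zero hk hε.ne'
  refine ⟨_, _, hP, div_ne_zero ?_ hk, Real.one_lt_cosh.2 hkε⟩
  rwa [Ne, Real.sinh_eq_zero]

theorem sq_mem_tubeSpectrum_iff {ε κ A : ℝ} (hε : 0 < ε) (hκ : κ = 0 ∨ Real.sin κ ≠ 0) :
    (κ / ε) ^ 2 ∈ tubeSpectrum ε hε A ↔ ∃ θ, dispersion A (Real.cos κ) θ = 0 := by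
  obtain ⟨C, S, P, hS, hC⟩ := exists_fundamentalPair_sq hε hκ
  rw [mem_tubeSpectrum_iff P hε hS, hC]

theorem sq_mem_fibreSpectrum_iff {ε κ A t : ℝ} (hε : 0 < ε) (hκ : κ = 0 ∨ Real.sin κ ≠ 0) :
    (κ / ε) ^ 2 ∈ fibreSpectrum ε hε A t ↔ dispersion A (Real.cos κ) (ε * t) = 0 := by
  obtain ⟨C, S, P, hS, hC⟩ := exists_fundamentalPair_sq hε hκ
  rw [mem_fibreSpectrum_iff P hε hS, hC]

theorem nonneg_of_mem_tubeSpectrum {ε z A : ℝ} (hε : 0 < ε) (hz : z ∈ tubeSpectrum ε hε A) :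
    0 ≤ z := by
  by_contra! h
  obtain ⟨C, S, P, hS, hC⟩ := exists_fundamentalPair_neg hε h
  obtain ⟨θ, hθ⟩ := (mem_tubeSpectrum_iff P hε hS).1 hz
  exact dispersion_ne_zero_of_one_lt hC hθ

theorem nonneg_of_mem_fibreSpectrum {ε z A t : ℝ} (hε : 0 < ε)
    (hz : z ∈ fibreSpectrum ε hε A t) : 0 ≤ z := by
  by_contra! h
  obtain ⟨C, S, P, hS, hC⟩ := exists_fundamentalPair_neg hε h
  exact dispersion_ne_zero_of_one_lt hC ((mem_fibreSpectrum_iff P hε hS).1 hz)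

/-! ### Orders of contact -/

/-- `f - f x₀` vanishes exactly to the order `k` at `x₀`. -/
def HasOrderAt (f : ℝ → ℝ) (k : ℕ) (x₀ : ℝ) : Prop :=
  ∃ c : ℝ, c ≠ 0 ∧ Tendsto (fun x => (f x - f x₀) / (x - x₀) ^ k) (𝓝[≠] x₀) (𝓝 c)

theorem HasOrderAt.of_factor {f F : ℝ → ℝ} {k : ℕ} {x₀ : ℝ}
    (h : ∀ᶠ x in 𝓝 x₀, f x - f x₀ = (x - x₀) ^ k * F x) (hF : ContinuousAt F x₀)
    (hF0 : F x₀ ≠ 0) : HasOrderAt f k x₀ := by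
  refine ⟨F x₀, hF0, (hF.tendsto.mono_left nhdsWithin_le_nhds).congr' ?_⟩
  filter_upwards [h.filter_mono nhdsWithin_le_nhds, self_mem_nhdsWithin] with x hx hne
  rw [hx, mul_div_cancel_left₀]
  exact pow_ne_zero _ (sub_ne_zero.2 hne)

theorem HasOrderAt.comp_affine {f : ℝ → ℝ} {k : ℕ} {ε b t₀ : ℝ} (hε : ε ≠ 0)
    (h : HasOrderAt f k (ε * t₀ + b)) : HasOrderAt (fun t => f (ε * t + b)) k t₀ := by
  obtain ⟨c, hc, hl⟩ := h
  have h1 : Tendsto (fun t => ε * t + b) (𝓝[≠] t₀) (𝓝[≠] (ε * t₀ + b)) := by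
    refine tendsto_nhdsWithin_of_tendsto_nhds_of_eventually_within _ ?_ ?_
    · exact (Continuous.tendsto (by fun_prop) t₀).mono_left nhdsWithin_le_nhds
    · filter_upwards [self_mem_nhdsWithin] with t ht h
      exact ht (mul_left_cancel₀ hε (add_right_cancel h))
  refine ⟨ε ^ k * c, mul_ne_zero (pow_ne_zero _ hε) hc,
    ((hl.comp h1).const_mul (ε ^ k)).congr' ?_⟩
  filter_upwards [self_mem_nhdsWithin] with t ht
  have h2 : t - t₀ ≠ 0 := sub_ne_zero.2 ht
  have h3 : ε * t + b - (ε * t₀ + b) = ε * (t - t₀) := by ring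
  simp only [Function.comp, h3, mul_pow]
  field_simp

/-- The difference quotient factors through the slope of `h`, which tends to `L ≠ 0`. One-sided
differentiability on a set containing the range of `f` is what is available for `arccos²` at `1`. -/
theorem HasOrderAt.comp_left {f h : ℝ → ℝ} {k : ℕ} {x₀ L : ℝ} {s : Set ℝ}
    (hf : HasOrderAt f k x₀) (hfc : ContinuousAt f x₀) (hs : ∀ x, f x ∈ s)
    (hh : HasDerivWithinAt h L s (f x₀)) (hL : L ≠ 0) :
    HasOrderAt (fun x => h (f x)) k x₀ := by
  obtain ⟨c, hc, hl⟩ := hf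
  -- The quotient has a nonzero limit, so `f x ≠ f x₀` nearby, and dividing by the difference is
  -- legitimate.
  have hne : ∀ᶠ x in 𝓝[≠] x₀, f x ≠ f x₀ := by
    filter_upwards [hl.eventually_ne hc] with x hx h
    exact hx (by rw [h, sub_self, zero_div])
  have h1 : Tendsto f (𝓝[≠] x₀) (𝓝[s \ {f x₀}] (f x₀)) := by
    refine tendsto_nhdsWithin_of_tendsto_nhds_of_eventually_within _
      (hfc.tendsto.mono_left nhdsWithin_le_nhds) ?_
    filter_upwards [hne] with x hx
    exact ⟨hs x, hx⟩
  have h2 := (hasDerivWithinAt_iff_tendsto_slope.1 hh).comp h1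
  refine ⟨L * c, mul_ne_zero hL hc, (h2.mul hl).congr' ?_⟩
  filter_upwards [hne] with x hx
  have h3 : f x - f x₀ ≠ 0 := sub_ne_zero.2 hx
  simp only [Function.comp, slope_def_field]
  field_simp

theorem HasOrderAt.congr_of_eventuallyEq {f g : ℝ → ℝ} {k : ℕ} {x₀ : ℝ} (h : HasOrderAt f k x₀)
    (hfg : f =ᶠ[𝓝 x₀] g) : HasOrderAt g k x₀ := by
  obtain ⟨c, hc, hl⟩ := h
  refine ⟨c, hc, hl.congr' ?_⟩
  filter_upwards [hfg.filter_mono nhdsWithin_le_nhds] with x hx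
  rw [hx, hfg.eq_of_nhds]

theorem HasOrderAt.not_two_four {f : ℝ → ℝ} {x₀ : ℝ} (h2 : HasOrderAt f 2 x₀)
    (h4 : HasOrderAt f 4 x₀) : False := by
  obtain ⟨c, hc, hl⟩ := h2
  obtain ⟨d, hd, hl'⟩ := h4
  have h1 : Tendsto (fun x => (x - x₀) ^ 2) (𝓝[≠] x₀) (𝓝 ((x₀ - x₀) ^ 2)) :=
    (Continuous.tendsto (by fun_prop) x₀).mono_left nhdsWithin_le_nhds
  have h3 := h1.mul hl'
  rw [sub_self, zero_pow two_ne_zero, zero_mul] at h3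
  suffices h5 : Tendsto (fun x => (f x - f x₀) / (x - x₀) ^ 2) (𝓝[≠] x₀) (𝓝 0) from
    hc (tendsto_nhds_unique hl h5)
  refine h3.congr' ?_
  filter_upwards [self_mem_nhdsWithin] with x hx
  have : x - x₀ ≠ 0 := sub_ne_zero.2 hx
  field_simp

theorem sin_half_eq (x : ℝ) : Real.sin (x / 2) = x / 2 * Real.sinc (x / 2) := by
  by_cases hx : x = 0
  · simp [hx]
  · rw [Real.sinc_of_ne_zero (by simpa using hx)]
    field_simp

/-- An exact factorization with a continuous second factor equal to `1/2` at `0`; it replaces Taylor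
expansions in all computations of orders below. -/
theorem one_sub_cos_eq (x : ℝ) : 1 - Real.cos x = x ^ 2 * (Real.sinc (x / 2) ^ 2 / 2) := by
  have h1 : Real.cos x = 1 - 2 * Real.sin (x / 2) ^ 2 := by
    rw [Real.sin_sq_eq_half_sub]
    ring_nf
  rw [h1, sin_half_eq]
  ring

/-- With `w = arccos y`, `one_sub_cos_eq` gives `y - 1 = -w² sinc²(w/2)/2`, so `w²/(y - 1) → -2`.
This serves an edge at energy `0`, where `arccos` itself is not differentiable. -/
theorem hasDerivWithinAt_arccos_sq :
    HasDerivWithinAt (fun y => Real.arccos y ^ 2) (-2) (Set.Iic 1) 1 := by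
  rw [hasDerivWithinAt_iff_tendsto_slope]
  have hc : ContinuousAt (fun y => -2 / Real.sinc (Real.arccos y / 2) ^ 2) 1 := by
    have h1 : ContinuousAt (fun y => Real.sinc (Real.arccos y / 2) ^ 2) 1 :=
      (Continuous.continuousAt (by
        have := Real.continuous_sinc
        have := Real.continuous_arccos
        fun_prop))
    exact continuousAt_const.div h1 (by simp)
  have hl := hc.tendsto.mono_left (nhdsWithin_le_nhds (s := Set.Iic 1 \ {1}))
  simp only [Real.arccos_one, zero_div, Real.sinc_zero, one_pow, div_one] at hl
  refine hl.congr' ?_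
  have h0 : ∀ᶠ y : ℝ in 𝓝[Set.Iic 1 \ {1}] 1, -1 < y :=
    (eventually_gt_nhds (by norm_num)).filter_mono nhdsWithin_le_nhds
  filter_upwards [h0, self_mem_nhdsWithin] with y hy1 hy2
  have hy3 : y < 1 := lt_of_le_of_ne hy2.1 hy2.2
  have hw : 0 < Real.arccos y := Real.arccos_pos.2 hy3
  have h1 := one_sub_cos_eq (Real.arccos y)
  rw [Real.cos_arccos hy1.le hy3.le] at h1
  have h2 : Real.sinc (Real.arccos y / 2) ≠ 0 := by
    intro h
    rw [h] at h1
    norm_num at h1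
    linarith
  rw [slope_def_field, Real.arccos_one]
  have h3 : y - 1 = -(Real.arccos y ^ 2 * (Real.sinc (Real.arccos y / 2) ^ 2 / 2)) := by linarith
  rw [h3]
  field_simp
  ring

/-! ### The maximum of the upper branch -/

/-- `M` is the maximum of `f`, and `f` has contact of order `k` with it wherever it is attained. -/
structure IsMaxOfOrder (f : ℝ → ℝ) (k : ℕ) (M : ℝ) : Prop where
  attained : ∃ θ, f θ = M
  le : ∀ θ, f θ ≤ M
  order : ∀ θ, f θ = M → HasOrderAt f k θ

theorem cos_sub_cos_eq (x y : ℝ) : Real.cos x - Real.cos y =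
    -((x - y) * (Real.sin ((x + y) / 2) * Real.sinc ((x - y) / 2))) := by
  rw [Real.cos_sub_cos, sin_half_eq (x - y)]
  ring

/-- With `K² = (1 + s)/s`, the maximum over `x = cos θ` is `K/2`, at `x = CK`; the inequality `|C| <
s` is what puts this point strictly inside `(-1, 1)`. The deviation from `K/2` is `-(x - CK)²` over
a positive function, and `cos θ - CK` has a simple zero because `sin θ ≠ 0` there. -/
theorem isMaxOfOrder_of_lt {A : ℝ} (h : |Real.cos A| < Real.sin A ^ 2) :
    ∃ M, 0 < M ∧ IsMaxOfOrder (upperBranch A) 2 M := by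
  set C := Real.cos A with hC
  set s := Real.sin A ^ 2 with hs
  have hs0 : 0 < s := (abs_nonneg _).trans_lt h
  have hCs : C ^ 2 = 1 - s := by rw [hC, hs, Real.cos_sq']
  set K := √((1 + s) / s) with hK
  have hKpos : 0 < K := Real.sqrt_pos.2 (by positivity)
  have hK2 : K ^ 2 * s = 1 + s := by
    rw [hK, Real.sq_sqrt (by positivity)]
    field_simp
  have hx0 : (C * K) ^ 2 < 1 := by
    have h1 : C ^ 2 < s ^ 2 := by
      rw [← sq_abs C]
      exact pow_lt_pow_left₀ h (abs_nonneg _) two_ne_zero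
    have h2 : (C * K) ^ 2 * s = (1 - s) * (1 + s) := by
      rw [mul_pow, hCs]
      linear_combination (1 - s) * hK2
    have h3 : (C * K) ^ 2 * s < 1 * s := by rw [h2]; nlinarith
    exact lt_of_mul_lt_mul_right h3 hs0.le
  have hK1 : 1 < K := by
    by_contra! hle
    have : K ^ 2 ≤ 1 := pow_le_one₀ hKpos.le hle
    nlinarith
  have key : ∀ θ, upperBranch A θ - K / 2 = -((Real.cos θ - C * K) ^ 2 /
      (2 * (K - C * Real.cos θ + √(1 + s * (1 - Real.cos θ ^ 2))))) ∧
      0 < K - C * Real.cos θ + √(1 + s * (1 - Real.cos θ ^ 2)) := by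
    intro θ
    have h1 := one_le_sqrt_radicand A θ
    have h2 := sq_sqrt_radicand A θ
    have h3 := le_of_abs_le (abs_cos_mul_cos_le_one A θ)
    rw [← hs] at h1 h2
    rw [← hC] at h3
    set r := √(1 + s * (1 - Real.cos θ ^ 2)) with hr
    have hpos : 0 < K - C * Real.cos θ + r := by linarith
    refine ⟨?_, hpos⟩
    unfold upperBranch
    rw [← hs, ← hC, ← hr]
    have hne := hpos.ne'
    have hCK : (C * K) ^ 2 = K ^ 2 - 1 - s := by rw [mul_pow, hCs]; linear_combination -hK2
    field_simp
    linear_combination h2 - Real.cos θ ^ 2 * hCs + hCK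
  have hle : ∀ θ, upperBranch A θ ≤ K / 2 := by
    intro θ
    obtain ⟨h1, h2⟩ := key θ
    have : 0 ≤ (Real.cos θ - C * K) ^ 2 /
      (2 * (K - C * Real.cos θ + √(1 + s * (1 - Real.cos θ ^ 2)))) := by positivity
    linarith
  have habs := abs_lt.1 ((sq_lt_one_iff_abs_lt_one _).1 hx0)
  refine ⟨K / 2, by positivity, ⟨Real.arccos (C * K), ?_⟩, hle, ?_⟩
  · have h1 := (key (Real.arccos (C * K))).1
    rw [Real.cos_arccos habs.1.le habs.2.le, sub_self] at h1
    simp only [ne_eq, OfNat.ofNat_ne_zero, not_false_eq_true, zero_pow, zero_div, neg_zero] at h1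
    linarith
  · intro θ₀ h0
    have hcos : Real.cos θ₀ = C * K := by
      obtain ⟨h1, h2⟩ := key θ₀
      rw [h0, sub_self, eq_comm, neg_eq_zero, div_eq_zero_iff] at h1
      exact sub_eq_zero.1 (pow_eq_zero_iff two_ne_zero |>.1 (h1.resolve_right (by positivity)))
    have hsin : Real.sin θ₀ ≠ 0 := by
      intro hsin
      have := Real.sin_sq_add_cos_sq θ₀
      rw [hsin, hcos] at this
      linarith
    refine HasOrderAt.of_factor (F := fun θ =>
      -((Real.sin ((θ + θ₀) / 2) * Real.sinc ((θ - θ₀) / 2)) ^ 2 /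
        (2 * (K - C * Real.cos θ + √(1 + s * (1 - Real.cos θ ^ 2))))))
      (Eventually.of_forall fun θ => ?_) ?_ ?_
    · rw [h0, (key θ).1, ← hcos, cos_sub_cos_eq]
      ring
    · have := Real.continuous_sinc
      refine ContinuousAt.neg (ContinuousAt.div (by fun_prop) (by fun_prop) ?_)
      have := (key θ₀).2
      positivity
    · have h3 := (key θ₀).2
      have h4 : (θ₀ + θ₀) / 2 = θ₀ := by ring
      simp only [h4, sub_self, zero_div, Real.sinc_zero, mul_one]
      refine neg_ne_zero.2 (div_ne_zero (pow_ne_zero _ hsin) (by positivity))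

/-- Put `y = σ cos θ` with `σ` a sign of `cos A`. The deviation from the maximum is `-(1 - y)/2`
times a bracket that is positive for `y < 1`, so the maximum is exactly at `y = 1`, where `1 - y`
has a double zero in `θ`. The bracket equals `D - s` there: the order is 2 if this is nonzero, and
if `D = s` the bracket contains a second factor `1 - y`. -/
theorem isMaxOfOrder_of_le {A : ℝ} (h : Real.sin A ^ 2 ≤ |Real.cos A|) :
    IsMaxOfOrder (upperBranch A) (if |Real.cos A| = Real.sin A ^ 2 then 4 else 2)
      ((1 + |Real.cos A|) / 2) := by
  obtain ⟨σ, hσ, hCσ⟩ : ∃ σ : ℝ, (σ = 1 ∨ σ = -1) ∧ Real.cos A = σ * |Real.cos A| := by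
    rcases le_total 0 (Real.cos A) with h0 | h0
    · exact ⟨1, Or.inl rfl, by rw [abs_of_nonneg h0, one_mul]⟩
    · exact ⟨-1, Or.inr rfl, by rw [abs_of_nonpos h0]; ring⟩
  have hσ2 : σ * σ = 1 := by rcases hσ with rfl | rfl <;> norm_num
  have hsq := Real.sin_sq_add_cos_sq A
  rw [← sq_abs (Real.cos A)] at hsq
  have hD1 := Real.abs_cos_le_one A
  set D := |Real.cos A| with hD
  set s := Real.sin A ^ 2 with hs
  have hs0 : 0 ≤ s := sq_nonneg _
  have hD0 : 0 < D := by
    rcases (abs_nonneg (Real.cos A)).eq_or_lt with h0 | h0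
    · rw [← hD] at h0
      rw [← h0] at hsq h
      linarith
    · exact h0
  set r : ℝ → ℝ := fun θ => √(1 + s * (1 - Real.cos θ ^ 2)) with hr
  have hr1 : ∀ θ, 1 ≤ r θ := fun θ => one_le_sqrt_radicand A θ
  have hr2 : ∀ θ, r θ ^ 2 = 1 + s * (1 - Real.cos θ ^ 2) := fun θ => sq_sqrt_radicand A θ
  have hrc : Continuous r := by fun_prop
  have key : ∀ θ, upperBranch A θ - (1 + D) / 2 =
      -((1 - σ * Real.cos θ) * (D - s * (1 + σ * Real.cos θ) / (1 + r θ)) / 2) := by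
    intro θ
    have h1 : 1 + r θ ≠ 0 := by linarith [hr1 θ]
    unfold upperBranch
    rw [← hs, hCσ]
    change (σ * D * Real.cos θ + r θ) / 2 - _ = _
    field_simp
    linear_combination hr2 θ + s * Real.cos θ ^ 2 * hσ2
  have hy : ∀ θ, |σ * Real.cos θ| ≤ 1 := by
    intro θ
    have := Real.abs_cos_le_one θ
    rcases hσ with rfl | rfl
    · simpa using this
    · simpa using this
  have hbr : ∀ θ, σ * Real.cos θ < 1 → 0 < D - s * (1 + σ * Real.cos θ) / (1 + r θ) := by
    intro θ hlt
    have h1 : 0 < 1 + r θ := by linarith [hr1 θ]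
    rw [sub_pos, div_lt_iff₀ h1]
    have h2 := (abs_le.1 (hy θ)).1
    have h3 := hr1 θ
    calc s * (1 + σ * Real.cos θ) ≤ D * (1 + σ * Real.cos θ) := by gcongr; linarith
      _ < D * (1 + r θ) := by gcongr; linarith
  have hle : ∀ θ, upperBranch A θ ≤ (1 + D) / 2 := by
    intro θ
    have h1 := key θ
    rcases (abs_le.1 (hy θ)).2.eq_or_lt with h2 | h2
    · rw [h2] at h1
      norm_num at h1
      linarith
    · have := mul_pos (sub_pos.2 h2) (hbr θ h2)
      linarith
  have hiff : ∀ θ, upperBranch A θ = (1 + D) / 2 ↔ σ * Real.cos θ = 1 := by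
    intro θ
    have h1 := key θ
    constructor
    · intro h2
      by_contra hne
      have h3 := lt_of_le_of_ne (abs_le.1 (hy θ)).2 hne
      have := mul_pos (sub_pos.2 h3) (hbr θ h3)
      linarith
    · intro h2
      rw [h2] at h1
      norm_num at h1
      linarith
  refine ⟨?_, hle, ?_⟩
  · rcases hσ with rfl | rfl
    · exact ⟨0, (hiff 0).2 (by simp)⟩
    · exact ⟨Real.pi, (hiff _).2 (by simp)⟩
  · intro θ₀ h0
    have hy0 := (hiff θ₀).1 h0
    have hsin : Real.sin θ₀ = 0 := by
      have h1 := Real.sin_sq_add_cos_sq θ₀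
      have h2 : Real.cos θ₀ ^ 2 = 1 := by
        have : (σ * Real.cos θ₀) ^ 2 = 1 := by rw [hy0, one_pow]
        linear_combination this - Real.cos θ₀ ^ 2 * hσ2
      rw [h2] at h1
      exact pow_eq_zero_iff two_ne_zero |>.1 (by linarith)
    -- Recentring at `θ₀`, a multiple of `π`, absorbs the sign `σ`.
    have hcos : ∀ θ, σ * Real.cos θ = Real.cos (θ - θ₀) := by
      intro θ
      have h1 : Real.cos θ = Real.cos ((θ - θ₀) + θ₀) := by congr 1; ring
      rw [h1, Real.cos_add, hsin]
      linear_combination Real.cos (θ - θ₀) * hy0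
    have hr0 : r θ₀ = 1 := by
      have h1 : Real.cos θ₀ ^ 2 = 1 := by
        have := Real.sin_sq_add_cos_sq θ₀
        rw [hsin] at this
        linarith
      simp [hr, h1]
    have hsinc := Real.continuous_sinc
    have key' : ∀ θ, upperBranch A θ - upperBranch A θ₀ =
      (θ - θ₀) ^ 2 * (-(Real.sinc ((θ - θ₀) / 2) ^ 2 *
        (D - s * (1 + Real.cos (θ - θ₀)) / (1 + r θ)) / 4)) := by
      intro θ
      rw [h0, key, hcos, one_sub_cos_eq]
      ring
    split_ifs with hDs
    · refine HasOrderAt.of_factor (F := fun θ =>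
        -(Real.sinc ((θ - θ₀) / 2) ^ 2 * (D * (1 + s) * (Real.sinc ((θ - θ₀) / 2) ^ 2 *
          (1 + Real.cos (θ - θ₀)) / 2) / ((1 + r θ) * (r θ + Real.cos (θ - θ₀))) / 4))) ?_ ?_ ?_
      · have hpos : ∀ᶠ θ in 𝓝 θ₀, 0 < Real.cos (θ - θ₀) := by
          have hc : ContinuousAt (fun θ => Real.cos (θ - θ₀)) θ₀ := by fun_prop
          exact hc.eventually_const_lt (by simp)
        filter_upwards [hpos] with θ hθ
        have h1 := hr1 θ
        have h2 := one_sub_cos_eq (θ - θ₀)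
        -- For `D = s` the bracket is `s (r - y)/(1 + r)`; multiplying and dividing by `r + y`
        -- exposes `r² - y² = (1 + s)(1 - y²)`.
        have h3 : D - s * (1 + Real.cos (θ - θ₀)) / (1 + r θ) =
            D * (1 + s) * ((1 - Real.cos (θ - θ₀)) * (1 + Real.cos (θ - θ₀))) /
              ((1 + r θ) * (r θ + Real.cos (θ - θ₀))) := by
          have h4 : 1 + r θ ≠ 0 := by linarith
          have h5 : r θ + Real.cos (θ - θ₀) ≠ 0 := by linarith
          have h6 : r θ ^ 2 = 1 + s * (1 - Real.cos (θ - θ₀) ^ 2) := by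
            rw [hr2, ← hcos]
            linear_combination (s * Real.cos θ ^ 2) * hσ2
          rw [← hDs] at h6 ⊢
          field_simp
          linear_combination h6
        rw [key', h3, h2]
        ring
      · refine ContinuousAt.neg (ContinuousAt.mul (by fun_prop) (ContinuousAt.div_const
          (ContinuousAt.div (by fun_prop) (by fun_prop) ?_) _))
        rw [hr0]
        simp
      · simp only [hr0, sub_self, zero_div, Real.sinc_zero, Real.cos_zero]
        have : D * (1 + s) ≠ 0 := (mul_pos hD0 (by linarith)).ne'
        simp only [ne_eq, neg_eq_zero]
        norm_num
        refine ⟨hD0.ne', by linarith⟩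
    · refine HasOrderAt.of_factor (Eventually.of_forall key') ?_ ?_
      · refine ContinuousAt.neg (ContinuousAt.div_const (ContinuousAt.mul (by fun_prop)
          (ContinuousAt.sub continuousAt_const (ContinuousAt.div (by fun_prop) (by fun_prop) ?_)))
          _)
        rw [hr0]
        norm_num
      · simp only [hr0, sub_self, zero_div, Real.sinc_zero, Real.cos_zero]
        norm_num
        intro h1
        exact hDs (by linarith)

/-! ### Edges of bands -/

/-- The energy whose square root, rescaled by `ε`, lies at distance `w` from `J π` in the
direction `τ = ±1`. -/
def energyNear (ε : ℝ) (J : ℕ) (τ w : ℝ) : ℝ := ((J * Real.pi + τ * w) / ε) ^ 2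

theorem wavenumber_nonneg {J : ℕ} {τ w : ℝ} (hτ : τ = 1 ∨ τ = -1 ∧ 1 ≤ J) (hw0 : 0 ≤ w)
    (hw : w ≤ Real.pi) : 0 ≤ J * Real.pi + τ * w := by
  have hπ := Real.pi_pos
  rcases hτ with rfl | ⟨rfl, hJ⟩
  · positivity
  · have : (1 : ℝ) ≤ J := by exact_mod_cast hJ
    nlinarith

theorem sq_eq_one_of_sign {J : ℕ} {τ : ℝ} (hτ : τ = 1 ∨ τ = -1 ∧ 1 ≤ J) : τ * τ = 1 := by
  rcases hτ with rfl | ⟨rfl, -⟩ <;> norm_num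

theorem cos_wavenumber {J : ℕ} {τ w : ℝ} (hτ : τ = 1 ∨ τ = -1 ∧ 1 ≤ J) :
    Real.cos (J * Real.pi + τ * w) = (-1) ^ J * Real.cos w := by
  rw [add_comm, Real.cos_add_nat_mul_pi]
  rcases hτ with rfl | ⟨rfl, -⟩ <;> simp

theorem sin_wavenumber {J : ℕ} {τ w : ℝ} (hτ : τ = 1 ∨ τ = -1 ∧ 1 ≤ J) :
    Real.sin (J * Real.pi + τ * w) = (-1) ^ J * (τ * Real.sin w) := by
  rw [add_comm, Real.sin_add_nat_mul_pi]
  rcases hτ with rfl | ⟨rfl, -⟩ <;> simp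

/-- At `w = 0` the wavenumber is `Jπ`, a Dirichlet point unless `J = 0`; hence the alternative in
the hypothesis. -/
theorem wavenumber_eq_zero_or {J : ℕ} {τ w : ℝ} (hτ : τ = 1 ∨ τ = -1 ∧ 1 ≤ J) (hw0 : 0 ≤ w)
    (hw : w < Real.pi) (h : 0 < w ∨ J = 0) :
    J * Real.pi + τ * w = 0 ∨ Real.sin (J * Real.pi + τ * w) ≠ 0 := by
  rcases hw0.eq_or_lt with h0 | h0
  · left
    rw [← h0] at h ⊢
    simp [h.resolve_left (lt_irrefl _)]
  · right
    rw [sin_wavenumber hτ]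
    have hτ0 : τ ≠ 0 := fun h => by simpa [h] using sq_eq_one_of_sign hτ
    exact mul_ne_zero (pow_ne_zero _ (by norm_num))
      (mul_ne_zero hτ0 (Real.sin_pos_of_pos_of_lt_pi h0 hw).ne')

theorem energyNear_inj {ε τ w w' : ℝ} {J : ℕ} (hε : 0 < ε) (hτ : τ = 1 ∨ τ = -1 ∧ 1 ≤ J)
    (hw0 : 0 ≤ w) (hw : w ≤ Real.pi) (hw0' : 0 ≤ w') (hw' : w' ≤ Real.pi) :
    energyNear ε J τ w = energyNear ε J τ w' ↔ w = w' := by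
  refine ⟨fun h => ?_, fun h => h ▸ rfl⟩
  have h1 := (sq_eq_sq₀ (div_nonneg (wavenumber_nonneg hτ hw0 hw) hε.le)
    (div_nonneg (wavenumber_nonneg hτ hw0' hw') hε.le)).1 h
  rw [div_left_inj' hε.ne', add_right_inj] at h1
  have hτ0 : τ ≠ 0 := fun h => by simpa [h] using sq_eq_one_of_sign hτ
  exact mul_left_cancel₀ hτ0 h1

/-- The sign `(-1)^J` of the cosine is traded for a shift of `θ` by `Jπ`. For `w < π/2` the cosine
of `w` is positive, so only the upper branch can meet it. -/
theorem energyNear_mem_fibreSpectrum_iff {ε A t τ w : ℝ} {J : ℕ} (hε : 0 < ε)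
    (hτ : τ = 1 ∨ τ = -1 ∧ 1 ≤ J) (hw0 : 0 ≤ w) (hw : w < Real.pi / 2) (h : 0 < w ∨ J = 0) :
    energyNear ε J τ w ∈ fibreSpectrum ε hε A t ↔
      w = Real.arccos (upperBranch A (ε * t + J * Real.pi)) := by
  have hπ := Real.pi_pos
  have hκ := wavenumber_eq_zero_or hτ hw0 (by linarith) h
  have h1 : ((-1 : ℝ) ^ J) * ((-1) ^ J * Real.cos w) = Real.cos w := by
    rw [← mul_assoc, ← mul_pow]; simp
  have hcos : 0 < Real.cos w := Real.cos_pos_of_mem_Ioo ⟨by linarith, hw⟩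
  have hub := upperBranch_nonneg A (ε * t + J * Real.pi + Real.pi)
  rw [energyNear, sq_mem_fibreSpectrum_iff hε hκ, cos_wavenumber hτ, ← dispersion_neg_one_pow, h1,
    dispersion_eq_zero_iff, or_iff_left (by linarith)]
  refine ⟨fun h => ?_, fun h => ?_⟩
  · rw [← h, Real.arccos_cos hw0 (by linarith)]
  · rw [h, Real.cos_arccos (by linarith [upperBranch_nonneg A (ε * t + J * Real.pi)])
      (upperBranch_le_one _ _)]

/-- For `M < 1` this is the chain rule at a positive wavenumber. For `M = 1` only `J = 0` is
allowed: the energy is then a multiple of `arccos²`. -/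
theorem exists_hasDerivWithinAt_energyNear_arccos {ε τ M : ℝ} {J : ℕ} (hε : 0 < ε)
    (hτ : τ = 1 ∨ τ = -1 ∧ 1 ≤ J) (hM0 : 0 < M) (hM1 : M ≤ 1) (h : M < 1 ∨ J = 0) :
    ∃ L ≠ 0, HasDerivWithinAt (fun y => energyNear ε J τ (Real.arccos y)) L (Set.Iic 1) M := by
  have hπ := Real.pi_pos
  rcases hM1.eq_or_lt with rfl | hlt
  · obtain rfl := h.resolve_left (lt_irrefl _)
    refine ⟨-2 * (1 / ε ^ 2), by positivity, ?_⟩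
    refine (hasDerivWithinAt_arccos_sq.mul_const (1 / ε ^ 2)).congr_of_mem (fun y _ => ?_)
      (Set.mem_Iic.2 le_rfl)
    have h1 := sq_eq_one_of_sign hτ
    simp only [energyNear, CharP.cast_eq_zero, zero_mul, zero_add]
    rw [div_pow, mul_pow, sq τ, h1]
    ring
  · have hd := Real.hasDerivAt_arccos (x := M) (by linarith) hlt.ne
    have hd2 := ((((hd.const_mul τ).const_add (J * Real.pi)).div_const ε).pow 2)
    refine ⟨_, ?_, hd2.hasDerivWithinAt⟩
    have hτ0 : τ ≠ 0 := fun h => by simpa [h] using sq_eq_one_of_sign hτ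
    have hw : 0 < Real.arccos M := Real.arccos_pos.2 hlt
    have hw2 : Real.arccos M < Real.pi := (Real.arccos_lt_pi_div_two.2 hM0).trans (by linarith)
    have hpos : J * Real.pi + τ * Real.arccos M ≠ 0 := by
      intro h0
      rcases hτ with rfl | ⟨rfl, hJ⟩
      · have : (0 : ℝ) ≤ J * Real.pi := by positivity
        linarith
      · have : (1 : ℝ) ≤ J := by exact_mod_cast hJ
        nlinarith
    have hsq : √(1 - M ^ 2) ≠ 0 := (Real.sqrt_pos.2 (by nlinarith)).ne'
    have := hε.ne'
    simp only [Nat.cast_ofNat]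
    refine mul_ne_zero (mul_ne_zero two_ne_zero (pow_ne_zero _ (div_ne_zero hpos this)))
      (div_ne_zero (mul_ne_zero hτ0 (neg_ne_zero.2 (one_div_ne_zero hsq))) this)

/-- Near the edge the fibre spectrum is the graph of the energy at distance `arccos (U(εt + Jπ))`
from `Jπ`. The inner map is affine and the outer one has nonzero derivative at `M`, so the order of
contact of `U` with its maximum is kept. -/
theorem isEdgeOfOrder_energyNear {ε A τ M : ℝ} {J k : ℕ} (hε : 0 < ε)
    (hτ : τ = 1 ∨ τ = -1 ∧ 1 ≤ J) (hM : IsMaxOfOrder (upperBranch A) k M) (hM0 : 0 < M)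
    (h : M < 1 ∨ J = 0) :
    IsEdgeOfOrder (fibreSpectrum ε hε A) k (energyNear ε J τ (Real.arccos M)) := by
  have hπ := Real.pi_pos
  have hM1 : M ≤ 1 := by
    obtain ⟨θ, rfl⟩ := hM.attained
    exact upperBranch_le_one A θ
  set w₀ := Real.arccos M with hw₀
  have hw₀0 : 0 ≤ w₀ := Real.arccos_nonneg M
  have hw₀1 : w₀ < Real.pi / 2 := Real.arccos_lt_pi_div_two.2 hM0
  have hw₀2 : 0 < w₀ ∨ J = 0 := h.imp Real.arccos_pos.2 id
  have hmem : ∀ t, energyNear ε J τ w₀ ∈ fibreSpectrum ε hε A t ↔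
      upperBranch A (ε * t + J * Real.pi) = M := by
    intro t
    rw [energyNear_mem_fibreSpectrum_iff hε hτ hw₀0 hw₀1 hw₀2, eq_comm, hw₀,
      Real.arccos_injOn.eq_iff ⟨by linarith [upperBranch_nonneg A (ε * t + J * Real.pi)],
        upperBranch_le_one _ _⟩ ⟨by linarith, hM1⟩]
  constructor
  · obtain ⟨θ, hθ⟩ := hM.attained
    refine ⟨(θ - J * Real.pi) / ε, (hmem _).2 ?_⟩
    rw [mul_div_cancel₀ _ hε.ne', sub_add_cancel, hθ]
  intro t₀ ht₀
  have hub := (hmem t₀).1 ht₀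
  have hcont : Continuous fun t =>
      energyNear ε J τ (Real.arccos (upperBranch A (ε * t + J * Real.pi))) := by
    have h1 := Real.continuous_arccos
    have h2 := continuous_upperBranch A
    unfold energyNear
    fun_prop
  refine ⟨_, ⟨by simp only [hub, hw₀], hcont.continuousAt, ?_⟩, ?_⟩
  · have hsqrt : ε * √(energyNear ε J τ w₀) = J * Real.pi + τ * w₀ := by
      rw [energyNear, Real.sqrt_sq (div_nonneg (wavenumber_nonneg hτ hw₀0 (by linarith)) hε.le),
        mul_div_cancel₀ _ hε.ne']
    have hτ2 := sq_eq_one_of_sign hτ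
    -- `W` is a continuous inverse of the energy as a function of `w`: it writes each nonnegative
    -- `z` near the edge as an energy with small enough `w`. Negative `z` lie neither in the
    -- spectrum nor on the graph of squares.
    set W : ℝ → ℝ := fun z => τ * (ε * √z - J * Real.pi) with hW
    have hWc : Continuous W := by fun_prop
    have hW0 : W (energyNear ε J τ w₀) = w₀ := by
      simp only [hW, hsqrt]
      linear_combination w₀ * hτ2
    have hlt : ∀ᶠ z in 𝓝 (energyNear ε J τ w₀), W z < Real.pi / 2 :=
      hWc.continuousAt.eventually_lt continuousAt_const (by rwa [hW0])
    have hgt : ∀ᶠ z in 𝓝 (energyNear ε J τ w₀), 0 < W z ∨ J = 0 := by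
      rcases hw₀2 with h0 | h0
      · have : ∀ᶠ z in 𝓝 (energyNear ε J τ w₀), 0 < W z :=
          continuousAt_const.eventually_lt hWc.continuousAt (by rwa [hW0])
        exact this.mono fun _ => Or.inl
      · exact Eventually.of_forall fun _ => Or.inr h0
    rw [nhds_prod_eq]
    filter_upwards [(hlt.and hgt).prod_inr (𝓝 t₀)] with ⟨t, z⟩ ⟨h1, h2⟩
    simp only at h1 h2 ⊢
    rcases lt_or_ge z 0 with hz | hz
    · refine iff_of_false (fun h => hz.not_ge (nonneg_of_mem_fibreSpectrum hε h)) (fun h => ?_)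
      exact hz.not_ge (h ▸ sq_nonneg _)
    · have hzW : z = energyNear ε J τ (W z) := by
        have h3 : J * Real.pi + τ * W z = ε * √z := by
          simp only [hW]
          linear_combination (ε * √z - J * Real.pi) * hτ2
        rw [energyNear, h3, mul_div_cancel_left₀ _ hε.ne', Real.sq_sqrt hz]
      have hW0 : 0 ≤ W z := by
        rcases h2 with h2 | h2
        · exact h2.le
        · rcases hτ with h4 | h4
          · simp only [hW, h4, h2]
            simp
            positivity
          · omega
      have h5 := energyNear_mem_fibreSpectrum_iff (A := A) (t := t) hε hτ hW0 h1 h2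
      rw [← hzW] at h5
      rw [h5]
      conv_rhs => rw [hzW]
      rw [energyNear_inj hε hτ hW0 (by linarith) (Real.arccos_nonneg _) (Real.arccos_le_pi _)]
  · obtain ⟨L, hL, hd⟩ := exists_hasDerivWithinAt_energyNear_arccos hε hτ hM0 hM1 h
    have h1 : HasOrderAt (fun x => energyNear ε J τ (Real.arccos (upperBranch A x))) k
        (ε * t₀ + J * Real.pi) :=
      (hM.order _ hub).comp_left (h := fun y => energyNear ε J τ (Real.arccos y))
        (continuous_upperBranch A).continuousAt (fun x => upperBranch_le_one A x)
        (by rw [hub]; exact hd) hL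
    have h2 := h1.comp_affine hε.ne'
    unfold HasOrderAt at h2
    simpa only [hub, ← hw₀] using h2

/-- The points `(t, E t)` tend to `(t₀, z₀)`, so both descriptions of the fibre spectrum apply to
them. The germ of the band function, and with it the order of an edge, is thus well defined. -/
theorem IsBandFunctionNear.eventuallyEq {S : ℝ → Set ℝ} {t₀ z₀ : ℝ} {E E' : ℝ → ℝ}
    (h : IsBandFunctionNear S t₀ z₀ E) (h' : IsBandFunctionNear S t₀ z₀ E') : E =ᶠ[𝓝 t₀] E' := by
  obtain ⟨h1, h2, h3⟩ := h
  obtain ⟨h1', h2', h3'⟩ := h'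
  have hl : Tendsto (fun t => (t, E t)) (𝓝 t₀) (𝓝 (t₀, z₀)) := by
    rw [← h1]
    exact (continuousAt_id.prodMk h2).tendsto
  filter_upwards [hl.eventually h3, hl.eventually h3'] with t ht ht'
  exact ht'.1 (ht.2 rfl)

theorem IsEdgeOfOrder.not_two_four {S : ℝ → Set ℝ} {z₀ : ℝ} (h2 : IsEdgeOfOrder S 2 z₀) :
    ¬ IsEdgeOfOrder S 4 z₀ := by
  intro h4
  obtain ⟨t₀, ht₀⟩ := h2.1
  obtain ⟨E, hE, hc⟩ := h2.2 t₀ ht₀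
  obtain ⟨E', hE', hc'⟩ := h4.2 t₀ ht₀
  rw [← hE.1] at hc
  rw [← hE'.1] at hc'
  exact HasOrderAt.not_two_four (HasOrderAt.congr_of_eventuallyEq hc (hE.eventuallyEq hE')) hc'

/-! ### The lower edge of the spectrum -/

theorem isCriticalPotential_iff (A : ℝ) :
    IsCriticalPotential A ↔ |Real.cos A| = Real.sin A ^ 2 := by
  rw [IsCriticalPotential, ← abs_of_nonneg (sq_nonneg (Real.sin A)), abs_eq_abs,
    abs_of_nonneg (sq_nonneg (Real.sin A))]

theorem sq_eq_energyNear_zero (ε κ : ℝ) : (κ / ε) ^ 2 = energyNear ε 0 1 κ := by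
  simp [energyNear]

theorem exists_eq_sq_of_mem_tubeSpectrum {ε z A : ℝ} (hε : 0 < ε)
    (hz : z ∈ tubeSpectrum ε hε A) : ∃ κ, 0 ≤ κ ∧ z = (κ / ε) ^ 2 :=
  ⟨ε * √z, by positivity, by
    rw [mul_div_cancel_left₀ _ hε.ne', Real.sq_sqrt (nonneg_of_mem_tubeSpectrum hε hz)]⟩

/-- A smaller wavenumber has `cos κ > M > 0`: too large for the upper branch, and of the wrong sign
for the reflected one. -/
theorem isLeast_tubeSpectrum {ε A M : ℝ} {k : ℕ} (hε : 0 < ε)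
    (hM : IsMaxOfOrder (upperBranch A) k M) (hM0 : 0 < M) :
    IsLeast (tubeSpectrum ε hε A) ((Real.arccos M / ε) ^ 2) := by
  have hπ := Real.pi_pos
  have hw₀1 : Real.arccos M < Real.pi / 2 := Real.arccos_lt_pi_div_two.2 hM0
  have hM1 : M ≤ 1 := by
    obtain ⟨θ, rfl⟩ := hM.attained
    exact upperBranch_le_one A θ
  have hsin : ∀ w, 0 ≤ w → w < Real.pi → w = 0 ∨ Real.sin w ≠ 0 := by
    intro w h0 h1
    simpa using wavenumber_eq_zero_or (J := 0) (τ := 1) (Or.inl rfl) h0 h1 (Or.inr rfl)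
  constructor
  · rw [sq_mem_tubeSpectrum_iff hε (hsin _ (Real.arccos_nonneg M) (by linarith)),
      Real.cos_arccos (by linarith) hM1]
    obtain ⟨θ, hθ⟩ := hM.attained
    exact ⟨θ, (dispersion_eq_zero_iff _ _ _).2 (Or.inl hθ.symm)⟩
  · intro z hz
    by_contra! hlt
    obtain ⟨κ, hκ, rfl⟩ := exists_eq_sq_of_mem_tubeSpectrum hε hz
    have h1 : κ < Real.arccos M := by
      by_contra! hge
      refine hlt.not_ge ?_
      have := Real.arccos_nonneg M
      gcongr
    obtain ⟨θ, hθ⟩ := (sq_mem_tubeSpectrum_iff hε (hsin _ hκ (by linarith))).1 hz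
    have h2 : M < Real.cos κ := by
      rw [← Real.cos_arccos (by linarith : -1 ≤ M) hM1]
      exact Real.cos_lt_cos_of_nonneg_of_le_pi hκ (by linarith) h1
    rcases (dispersion_eq_zero_iff _ _ _).1 hθ with h3 | h3
    · linarith [hM.le θ]
    · linarith [upperBranch_nonneg A (θ + Real.pi)]

theorem exists_isMaxOfOrder_upperBranch (A : ℝ) : ∃ M, 0 < M ∧ IsMaxOfOrder (upperBranch A)
    (if |Real.cos A| = Real.sin A ^ 2 then 4 else 2) M := by
  rcases lt_or_ge |Real.cos A| (Real.sin A ^ 2) with h | h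
  · rw [if_neg h.ne]
    exact isMaxOfOrder_of_lt h
  · exact ⟨_, by positivity, isMaxOfOrder_of_le h⟩

theorem exists_isLeast_tubeSpectrum (ε : ℝ) (hε : 0 < ε) (A : ℝ) :
    ∃ z₀ : ℝ, IsLeast (tubeSpectrum ε hε A) z₀ ∧
      (IsDegenerateEdge (fibreSpectrum ε hε A) z₀ ↔ IsCriticalPotential A) ∧
      (¬ IsCriticalPotential A → IsNondegenerateEdge (fibreSpectrum ε hε A) z₀) := by
  obtain ⟨M, hM0, hM⟩ := exists_isMaxOfOrder_upperBranch A
  have hedge := isEdgeOfOrder_energyNear (J := 0) (τ := 1) hε (Or.inl rfl) hM hM0 (Or.inr rfl)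
  rw [← sq_eq_energyNear_zero] at hedge
  refine ⟨_, isLeast_tubeSpectrum hε hM hM0, ?_⟩
  rw [isCriticalPotential_iff]
  by_cases hA : |Real.cos A| = Real.sin A ^ 2
  · rw [if_pos hA] at hedge
    exact ⟨iff_of_true hedge hA, fun h => absurd hA h⟩
  · rw [if_neg hA] at hedge
    exact ⟨iff_of_false hedge.not_two_four hA, fun _ => hedge⟩

/-! ### Counting bands -/

section Bands

variable {S : Set ℝ} {α β : ℕ → ℝ}

theorem strictMono_left_of_interlacing (hαβ : ∀ n, α n < β n) (hβα : ∀ n, β n < α (n + 1)) :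
    StrictMono α :=
  strictMono_nat_of_lt_succ fun n => (hαβ n).trans (hβα n)

theorem right_lt_left_of_interlacing (hαβ : ∀ n, α n < β n) (hβα : ∀ n, β n < α (n + 1))
    {m n : ℕ} (hmn : m < n) : β m < α n :=
  (hβα m).trans_le ((strictMono_left_of_interlacing hαβ hβα).monotone hmn)

/-- A nonempty open interval is uncountable, so it cannot consist of exceptional points only. -/
theorem exists_mem_Icc_of_Ioo_subset (hc : (S \ ⋃ n, Set.Icc (α n) (β n)).Countable)
    {x y : ℝ} (hxy : x < y) (h : Set.Ioo x y ⊆ S) :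
    ∃ n, ∃ p ∈ Set.Ioo x y, p ∈ Set.Icc (α n) (β n) := by
  by_contra! hno
  have hsub : Set.Ioo x y ⊆ S \ ⋃ n, Set.Icc (α n) (β n) := by
    refine fun p hp => ⟨h hp, ?_⟩
    simp only [Set.mem_iUnion, not_exists]
    exact fun n => hno n p hp
  exact Cardinal.Real.Ioo_countable_iff.not.2 hxy.not_ge (hc.mono hsub)

/-- If `I` left `[α n, β n]`, it would contain an open interval of the adjacent gap, which meets `S`
in countably many points only. -/
theorem subset_Icc_of_isPreconnected (hαβ : ∀ n, α n < β n) (hβα : ∀ n, β n < α (n + 1))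
    (hc : (S \ ⋃ n, Set.Icc (α n) (β n)).Countable) {I : Set ℝ} (hI : IsPreconnected I)
    (hIS : I ⊆ S) {n : ℕ} {p : ℝ} (hpI : p ∈ I) (hp : p ∈ Set.Icc (α n) (β n)) :
    I ⊆ Set.Icc (α n) (β n) := by
  have hlt := fun {m n : ℕ} => right_lt_left_of_interlacing hαβ hβα (m := m) (n := n)
  intro q hq
  constructor
  · by_contra! hqn
    -- `r` bounds the gap on the left: it is the end of the preceding interval, or `q` itself for `n
    -- = 0`, where there is none.
    obtain ⟨r, hr, hrn⟩ : ∃ r < α n, ∀ m < n, β m ≤ r := by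
      rcases n with _ | n
      · exact ⟨q, hqn, fun m hm => absurd hm (Nat.not_lt_zero m)⟩
      · refine ⟨β n, hβα n, fun m hm => ?_⟩
        rcases (Nat.lt_succ_iff.1 hm).eq_or_lt with rfl | h
        · exact le_rfl
        · exact ((hlt h).trans (hαβ n)).le
    have hsub : Set.Ioo (max q r) (α n) ⊆ S := fun y hy =>
      hIS (hI.Icc_subset hq hpI ⟨(le_max_left _ _).trans hy.1.le, hy.2.le.trans hp.1⟩)
    obtain ⟨m, y, hy, hym⟩ := exists_mem_Icc_of_Ioo_subset hc (max_lt hqn hr) hsub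
    rcases lt_or_ge m n with h | h
    · linarith [hrn m h, hym.2, (le_max_right q r).trans_lt hy.1]
    · linarith [(strictMono_left_of_interlacing hαβ hβα).monotone h, hym.1, hy.2]
  · by_contra! hqn
    have hsub : Set.Ioo (β n) (min q (α (n + 1))) ⊆ S := fun y hy =>
      hIS (hI.Icc_subset hpI hq ⟨hp.2.trans hy.1.le, hy.2.le.trans (min_le_left _ _)⟩)
    obtain ⟨m, y, hy, hym⟩ := exists_mem_Icc_of_Ioo_subset hc (lt_min hqn (hβα n)) hsub
    rcases lt_trichotomy m n with h | rfl | h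
    · linarith [hlt h, hαβ n, hym.2, hy.1]
    · exact hy.1.not_ge hym.2
    · linarith [(strictMono_left_of_interlacing hαβ hβα).monotone h, hym.1,
        hy.2.trans_le (min_le_right _ _)]

/-- A component with two points contains an open interval, so it meets some `[α n, β n]` and equals
it. Exceptional points outside these intervals form one-point components and are not counted. -/
theorem isSpectralBand_iff_of_interlacing (hαβ : ∀ n, α n < β n) (hβα : ∀ n, β n < α (n + 1))
    (hsub : ∀ n, Set.Icc (α n) (β n) ⊆ S)
    (hc : (S \ ⋃ n, Set.Icc (α n) (β n)).Countable) {I : Set ℝ} :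
    IsSpectralBand S I ↔ ∃ n, I = Set.Icc (α n) (β n) := by
  have key : ∀ x ∈ S, ∀ n, ∀ p ∈ connectedComponentIn S x, p ∈ Set.Icc (α n) (β n) →
      connectedComponentIn S x = Set.Icc (α n) (β n) := by
    intro x hx n p hp hpn
    refine (subset_Icc_of_isPreconnected hαβ hβα hc isPreconnected_connectedComponentIn
      (connectedComponentIn_subset S x) hp hpn).antisymm ?_
    rw [connectedComponentIn_eq hp]
    exact isPreconnected_Icc.subset_connectedComponentIn hpn (hsub n)
  constructor
  · rintro ⟨x, hx, rfl, hnt⟩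
    obtain ⟨y, hy, z, hz, hyz⟩ := hnt.exists_lt
    have h1 : Set.Icc y z ⊆ connectedComponentIn S x :=
      isPreconnected_connectedComponentIn.Icc_subset hy hz
    obtain ⟨n, p, hp, hpn⟩ := exists_mem_Icc_of_Ioo_subset hc hyz
      ((Set.Ioo_subset_Icc_self.trans h1).trans (connectedComponentIn_subset S x))
    exact ⟨n, key x hx n p (h1 (Set.Ioo_subset_Icc_self hp)) hpn⟩
  · rintro ⟨n, rfl⟩
    have hmem : α n ∈ Set.Icc (α n) (β n) := Set.left_mem_Icc.2 (hαβ n).le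
    exact ⟨α n, hsub n hmem,
      (key _ (hsub n hmem) n _ (mem_connectedComponentIn (hsub n hmem)) hmem).symm,
      α n, hmem, β n, Set.right_mem_Icc.2 (hαβ n).le, (hαβ n).ne⟩

theorem isNthSpectralBand_of_interlacing (hαβ : ∀ n, α n < β n) (hβα : ∀ n, β n < α (n + 1))
    (hsub : ∀ n, Set.Icc (α n) (β n) ⊆ S)
    (hc : (S \ ⋃ n, Set.Icc (α n) (β n)).Countable) (n : ℕ) :
    IsNthSpectralBand S (n + 1) (Set.Icc (α n) (β n)) := by
  have hmono := strictMono_left_of_interlacing hαβ hβα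
  refine ⟨(isSpectralBand_iff_of_interlacing hαβ hβα hsub hc).2 ⟨n, rfl⟩, ?_⟩
  have hset : {J | IsSpectralBand S J ∧ ∀ x ∈ J, ∀ y ∈ Set.Icc (α n) (β n), x < y} =
      (fun m => Set.Icc (α m) (β m)) '' (Finset.range n : Set ℕ) := by
    ext J
    simp only [Set.mem_ofPred_eq, isSpectralBand_iff_of_interlacing hαβ hβα hsub hc,
      Set.mem_image, Finset.coe_range, Set.mem_Iio]
    constructor
    · rintro ⟨⟨m, rfl⟩, h⟩
      exact ⟨m, hmono.lt_iff_lt.1 (h _ (Set.left_mem_Icc.2 (hαβ m).le) _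
        (Set.left_mem_Icc.2 (hαβ n).le)), rfl⟩
    · rintro ⟨m, hm, rfl⟩
      exact ⟨⟨m, rfl⟩, fun x hx y hy =>
        (hx.2.trans_lt (right_lt_left_of_interlacing hαβ hβα hm)).trans_le hy.1⟩
  have hinj : Function.Injective fun m => Set.Icc (α m) (β m) := by
    intro m m' h
    have h1 : α m = sInf (Set.Icc (α m) (β m)) := (csInf_Icc (hαβ m).le).symm
    simp only at h
    rw [h, csInf_Icc (hαβ m').le] at h1
    exact hmono.injective h1
  rw [hset, hinj.encard_image, Set.encard_coe_eq_coe_finsetCard, Finset.card_range]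
  norm_cast

end Bands

/-! ### The bands at critical potentials -/

/-- The upper end is the maximum found for `sin² A ≤ |cos A|`; the lower one follows from the square
root being at least `1`. Both are attained, at `0` and `π`, and the intermediate value theorem fills
the interval. -/
theorem exists_upperBranch_eq_iff {A : ℝ} (hA : |Real.cos A| = Real.sin A ^ 2) (y : ℝ) :
    (∃ θ, upperBranch A θ = y) ↔
      y ∈ Set.Icc ((1 - |Real.cos A|) / 2) ((1 + |Real.cos A|) / 2) := by
  constructor
  · rintro ⟨θ, rfl⟩
    refine ⟨?_, (isMaxOfOrder_of_le hA.ge).le θ⟩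
    have h1 := one_le_sqrt_radicand A θ
    have h2 : |Real.cos A * Real.cos θ| ≤ |Real.cos A| := by
      rw [abs_mul]
      exact mul_le_of_le_one_right (abs_nonneg _) (Real.abs_cos_le_one θ)
    have h3 := neg_le_of_abs_le h2
    unfold upperBranch
    linarith
  · intro hy
    have h0 : upperBranch A 0 = (1 + Real.cos A) / 2 := by
      simp [upperBranch, add_comm]
    have h1 : upperBranch A Real.pi = (1 - Real.cos A) / 2 := by
      simp [upperBranch]
      ring
    have h2 := intermediate_value_uIcc (a := 0) (b := Real.pi)
      (continuous_upperBranch A).continuousOn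
    obtain ⟨θ, -, hθ⟩ := h2 (a := y) (by
      rw [h0, h1, Set.mem_uIcc]
      rcases abs_cases (Real.cos A) with ⟨h, -⟩ | ⟨h, -⟩
      · rw [h] at hy
        exact Or.inr hy
      · rw [h] at hy
        exact Or.inl ⟨by linarith [hy.1], by linarith [hy.2]⟩)
    exact ⟨θ, hθ⟩

theorem exists_dispersion_eq_zero_iff {A : ℝ} (hA : |Real.cos A| = Real.sin A ^ 2) (c : ℝ) :
    (∃ θ, dispersion A c θ = 0) ↔
      |c| ∈ Set.Icc ((1 - |Real.cos A|) / 2) ((1 + |Real.cos A|) / 2) := by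
  rw [← exists_upperBranch_eq_iff hA]
  simp only [dispersion_eq_zero_iff]
  constructor
  · rintro ⟨θ, h | h⟩
    · exact ⟨θ, by rw [h, abs_of_nonneg (upperBranch_nonneg A θ)]⟩
    · exact ⟨_, by rw [h, abs_neg, abs_of_nonneg (upperBranch_nonneg A _)]⟩
  · rintro ⟨θ, h⟩
    rcases abs_cases c with ⟨h1, -⟩ | ⟨h1, -⟩
    · exact ⟨θ, Or.inl (by rw [h, h1])⟩
    · exact ⟨θ - Real.pi, Or.inr (by rw [sub_add_cancel, h, h1, neg_neg])⟩

/-- The wavenumber, rescaled by `ε`, at the left edge of the `n`-th band (counted from `0`). -/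
def bandLeft (a b : ℝ) (n : ℕ) : ℝ := n * (Real.pi / 2) + if Even n then a else Real.pi / 2 - b

theorem bandLeft_two_mul (a b : ℝ) (j : ℕ) : bandLeft a b (2 * j) = j * Real.pi + a := by
  simp [bandLeft]
  ring

theorem bandLeft_two_mul_add_one (a b : ℝ) (j : ℕ) :
    bandLeft a b (2 * j + 1) = (j + 1 : ℕ) * Real.pi - b := by
  simp [bandLeft]
  ring

theorem bandLeft_mem_Ioo {a b : ℝ} (ha : 0 < a) (hab : a < b) (hb : b < Real.pi / 2) (n : ℕ) :
    bandLeft a b n ∈ Set.Ioo (n * (Real.pi / 2)) ((n + 1) * (Real.pi / 2)) := by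
  unfold bandLeft
  split_ifs <;> constructor <;> linarith

/-- Exchanging `a` and `b` turns the left edge of the `n`-th band into its right edge, both for even
`n` (the interval `[a, b]` translated) and for odd `n` (reflected). -/
theorem bandLeft_swap_mem_Ioo {a b : ℝ} (ha : 0 < a) (hab : a < b) (hb : b < Real.pi / 2)
    (n : ℕ) :
    bandLeft b a n ∈ Set.Ioo (n * (Real.pi / 2)) ((n + 1) * (Real.pi / 2)) := by
  unfold bandLeft
  split_ifs <;> constructor <;> linarith

theorem bandLeft_lt_swap {a b : ℝ} (hab : a < b) (n : ℕ) : bandLeft a b n < bandLeft b a n := by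
  unfold bandLeft
  split_ifs <;> linarith

/-- Translation by `jπ` for `n = 2j`, or reflection `κ ↦ (j + 1)π - κ` for `n = 2j + 1`, preserves
`|cos|` and leads to `[0, π/2]`, where the cosine decreases. -/
theorem abs_cos_mem_Icc_iff {a b κ : ℝ} {n : ℕ} (ha : 0 ≤ a) (hb : b ≤ Real.pi / 2)
    (hab : a ≤ b) (h1 : n * (Real.pi / 2) ≤ κ) (h2 : κ ≤ (n + 1) * (Real.pi / 2)) :
    |Real.cos κ| ∈ Set.Icc (Real.cos b) (Real.cos a) ↔
      κ ∈ Set.Icc (bandLeft a b n) (bandLeft b a n) := by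
  have hπ := Real.pi_pos
  have hw : ∀ w, 0 ≤ w → w ≤ Real.pi / 2 →
      (|Real.cos w| ∈ Set.Icc (Real.cos b) (Real.cos a) ↔ a ≤ w ∧ w ≤ b) := by
    intro w hw0 hw1
    rw [abs_of_nonneg (Real.cos_nonneg_of_mem_Icc ⟨by linarith, hw1⟩), Set.mem_Icc,
      Real.strictAntiOn_cos.le_iff_ge ⟨by linarith, by linarith⟩ ⟨hw0, by linarith⟩,
      Real.strictAntiOn_cos.le_iff_ge ⟨hw0, by linarith⟩ ⟨ha, by linarith⟩, and_comm]
  rcases Nat.even_or_odd' n with ⟨j, rfl | rfl⟩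
  · rw [bandLeft_two_mul, bandLeft_two_mul]
    push_cast at h1 h2
    have h3 : |Real.cos κ| = |Real.cos (κ - j * Real.pi)| := by
      rw [Real.cos_sub_nat_mul_pi, abs_mul, abs_neg_one_pow, one_mul]
    rw [h3, hw _ (by linarith) (by linarith), Set.mem_Icc, le_sub_iff_add_le', sub_le_iff_le_add']
  · rw [bandLeft_two_mul_add_one, bandLeft_two_mul_add_one]
    push_cast at h1 h2
    have h3 : |Real.cos κ| = |Real.cos ((j + 1 : ℕ) * Real.pi - κ)| := by
      rw [Real.cos_nat_mul_pi_sub, abs_mul, abs_neg_one_pow, one_mul]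
    have h4 : ((j + 1 : ℕ) : ℝ) = j + 1 := by push_cast; ring
    rw [h3, hw _ (by rw [h4]; linarith) (by rw [h4]; linarith), Set.mem_Icc, and_comm]
    exact and_congr (by constructor <;> intro h <;> linarith)
      (by constructor <;> intro h <;> linarith)

theorem sin_ne_zero_of_mem_Ioo {κ : ℝ} {n : ℕ}
    (h : κ ∈ Set.Ioo (n * (Real.pi / 2)) ((n + 1) * (Real.pi / 2))) : Real.sin κ ≠ 0 := by
  have hπ := Real.pi_pos
  intro h0
  obtain ⟨m, rfl⟩ := Real.sin_eq_zero_iff.1 h0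
  have h1 : (n : ℝ) < 2 * m := by nlinarith [h.1]
  have h2 : (2 * m : ℝ) < n + 1 := by nlinarith [h.2]
  have h3 : (n : ℤ) < 2 * m := by exact_mod_cast h1
  have h4 : (2 * m : ℤ) < n + 1 := by exact_mod_cast h2
  omega

theorem isNthSpectralBand_tubeSpectrum {ε A : ℝ} (hε : 0 < ε)
    (hA : |Real.cos A| = Real.sin A ^ 2) {a b : ℝ} (ha : 0 < a) (hab : a < b)
    (hb : b < Real.pi / 2) (hca : Real.cos a = (1 + |Real.cos A|) / 2)
    (hcb : Real.cos b = (1 - |Real.cos A|) / 2) (n : ℕ) :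
    IsNthSpectralBand (tubeSpectrum ε hε A) (n + 1)
      (Set.Icc ((bandLeft a b n / ε) ^ 2) ((bandLeft b a n / ε) ^ 2)) := by
  have hπ := Real.pi_pos
  have hl := bandLeft_mem_Ioo ha hab hb
  have hr := bandLeft_swap_mem_Ioo ha hab hb
  have hn : ∀ n : ℕ, 0 ≤ n * (Real.pi / 2) := fun n => by positivity
  have hsq : ∀ {x y : ℝ}, 0 ≤ x → 0 ≤ y → ((x / ε) ^ 2 ≤ (y / ε) ^ 2 ↔ x ≤ y) :=
    fun hx hy => by
      rw [sq_le_sq₀ (div_nonneg hx hε.le) (div_nonneg hy hε.le), div_le_div_iff_of_pos_right hε]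
  have hsq' : ∀ {x y : ℝ}, 0 ≤ x → 0 ≤ y → ((x / ε) ^ 2 < (y / ε) ^ 2 ↔ x < y) :=
    fun hx hy => by
      rw [sq_lt_sq₀ (div_nonneg hx hε.le) (div_nonneg hy hε.le), div_lt_div_iff_of_pos_right hε]
  have hmem : ∀ {κ : ℝ}, Real.sin κ ≠ 0 → ((κ / ε) ^ 2 ∈ tubeSpectrum ε hε A ↔
      |Real.cos κ| ∈ Set.Icc (Real.cos b) (Real.cos a)) := fun h => by
    rw [sq_mem_tubeSpectrum_iff hε (Or.inr h), exists_dispersion_eq_zero_iff hA, hca, hcb]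
  have hl0 : ∀ n, 0 ≤ bandLeft a b n := fun n => (hn n).trans (hl n).1.le
  have hr0 : ∀ n, 0 ≤ bandLeft b a n := fun n => (hn n).trans (hr n).1.le
  refine isNthSpectralBand_of_interlacing (α := fun n => (bandLeft a b n / ε) ^ 2)
    (β := fun n => (bandLeft b a n / ε) ^ 2) (fun n => ?_) (fun n => ?_) (fun n => ?_) ?_ n
  · exact (hsq' (hl0 n) (hr0 n)).2 (bandLeft_lt_swap hab n)
  · refine (hsq' (hr0 n) (hl0 _)).2 ((hr n).2.trans ?_)
    simpa using (hl (n + 1)).1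
  · intro z hz
    have hz0 : 0 ≤ z := (sq_nonneg _).trans hz.1
    obtain ⟨κ, hκ, rfl⟩ : ∃ κ, 0 ≤ κ ∧ z = (κ / ε) ^ 2 :=
      ⟨ε * √z, by positivity, by rw [mul_div_cancel_left₀ _ hε.ne', Real.sq_sqrt hz0]⟩
    have h1 := (hsq (hl0 n) hκ).1 hz.1
    have h2 := (hsq hκ (hr0 n)).1 hz.2
    have h3 := (hl n).1.trans_le h1
    have h4 := h2.trans_lt (hr n).2
    exact (hmem (sin_ne_zero_of_mem_Ioo ⟨h3, h4⟩)).2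
      ((abs_cos_mem_Icc_iff ha.le hb.le hab.le h3.le h4.le).2 ⟨h1, h2⟩)
  -- The exceptional points are among the Dirichlet points `(mπ/ε)²`. For any other point of the
  -- spectrum, the integer part of `κ/(π/2)` is the index of its band.
  · refine (Set.countable_range fun m : ℤ => (m * Real.pi / ε) ^ 2).mono ?_
    rintro z ⟨hz, hzn⟩
    obtain ⟨κ, hκ, rfl⟩ := exists_eq_sq_of_mem_tubeSpectrum hε hz
    by_cases hs : Real.sin κ = 0
    · obtain ⟨m, rfl⟩ := Real.sin_eq_zero_iff.1 hs
      exact ⟨m, rfl⟩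
    · refine absurd (Set.mem_iUnion.2 ⟨⌊κ / (Real.pi / 2)⌋₊, ?_⟩) hzn
      have h1 := Nat.floor_le (a := κ / (Real.pi / 2)) (by positivity)
      have h2 := (Nat.lt_floor_add_one (κ / (Real.pi / 2))).le
      rw [le_div_iff₀ (by positivity)] at h1
      rw [div_le_iff₀ (by positivity)] at h2
      have h3 := (abs_cos_mem_Icc_iff ha.le hb.le hab.le h1 h2).1 ((hmem hs).1 hz)
      exact ⟨(hsq (hl0 _) hκ).2 h3.1, (hsq hκ (hr0 _)).2 h3.2⟩

theorem exists_isNthSpectralBand {ε A : ℝ} (hε : 0 < ε) (hA : |Real.cos A| = Real.sin A ^ 2)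
    {n : ℕ} (hn : 1 ≤ n) :
    ∃ α β : ℝ, α < β ∧ IsNthSpectralBand (tubeSpectrum ε hε A) n (Set.Icc α β) ∧
      (Odd n → IsDegenerateEdge (fibreSpectrum ε hε A) α) ∧
      (Even n → IsDegenerateEdge (fibreSpectrum ε hε A) β) := by
  set D := |Real.cos A| with hD
  -- Criticality is `D = 1 - D²`, so `0 < D < 1`. Hence the maximum `(1 + D)/2` is below `1`, and
  -- the edges in question avoid the Dirichlet points.
  have hsq : D ^ 2 + D = 1 := by
    have h := Real.sin_sq_add_cos_sq A
    rw [← hA, ← sq_abs (Real.cos A), ← hD] at h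
    linarith
  have hD0 : 0 < D := by
    refine (abs_nonneg _).lt_of_ne fun h => ?_
    rw [← hD] at h
    rw [← h] at hsq
    norm_num at hsq
  have hD1 : D < 1 := by nlinarith
  have hM := isMaxOfOrder_of_le hA.ge
  rw [if_pos hA, ← hD] at hM
  have hedge : ∀ {J : ℕ} {τ : ℝ}, (τ = 1 ∨ τ = -1 ∧ 1 ≤ J) → IsDegenerateEdge
      (fibreSpectrum ε hε A) (energyNear ε J τ (Real.arccos ((1 + D) / 2))) := fun hτ =>
    isEdgeOfOrder_energyNear hε hτ hM (by positivity) (Or.inl (by linarith))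
  have ha : 0 < Real.arccos ((1 + D) / 2) := Real.arccos_pos.2 (by linarith)
  have hb : Real.arccos ((1 - D) / 2) < Real.pi / 2 :=
    Real.arccos_lt_pi_div_two.2 (by linarith)
  have hab : Real.arccos ((1 + D) / 2) < Real.arccos ((1 - D) / 2) :=
    Real.strictAntiOn_arccos ⟨by linarith, by linarith⟩ ⟨by linarith, by linarith⟩ (by linarith)
  obtain ⟨n, rfl⟩ := Nat.exists_eq_add_of_le' hn
  refine ⟨_, _, ?_, isNthSpectralBand_tubeSpectrum hε hA ha hab hb
    (Real.cos_arccos (by linarith) (by linarith)) (Real.cos_arccos (by linarith) (by linarith)) n,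
    fun h => ?_, fun h => ?_⟩
  · have h1 := (bandLeft_mem_Ioo ha hab hb n).1
    have h2 : (0 : ℝ) ≤ n * (Real.pi / 2) := by positivity
    have h3 := bandLeft_lt_swap hab n
    have h4 := h2.trans h1.le
    gcongr
  -- Here `n` has become the index counted from `0`. An odd band has index `2j` and starts at `jπ +
  -- a`; an even one has index `2i + 1` and ends at `(i + 1)π - a`, which is approached with `τ =
  -- -1`, `J = i + 1`.
  · obtain ⟨j, hj⟩ := h
    obtain rfl : n = 2 * j := by omega
    have := hedge (J := j) (τ := 1) (Or.inl rfl)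
    rwa [energyNear, one_mul, ← bandLeft_two_mul _ (Real.arccos ((1 - D) / 2))] at this
  · obtain ⟨j, hj⟩ := h
    obtain ⟨i, rfl⟩ : ∃ i, n = 2 * i + 1 := ⟨j - 1, by omega⟩
    have := hedge (J := i + 1) (τ := -1) (Or.inr ⟨rfl, by omega⟩)
    rwa [energyNear, neg_one_mul, ← sub_eq_add_neg,
      ← bandLeft_two_mul_add_one (Real.arccos ((1 - D) / 2))] at this

end

theorem theorem7p1 (ε : ℝ) (hε : 0 < ε) (A : ℝ) :
    (∃ z₀ : ℝ, IsLeast (tubeSpectrum ε hε A) z₀ ∧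
      (IsDegenerateEdge (fibreSpectrum ε hε A) z₀ ↔ IsCriticalPotential A) ∧
      (¬ IsCriticalPotential A → IsNondegenerateEdge (fibreSpectrum ε hε A) z₀)) ∧
    (IsCriticalPotential A → ∀ n : ℕ, 1 ≤ n →
      ∃ α β : ℝ, α < β ∧ IsNthSpectralBand (tubeSpectrum ε hε A) n (Set.Icc α β) ∧
        (Odd n → IsDegenerateEdge (fibreSpectrum ε hε A) α) ∧
        (Even n → IsDegenerateEdge (fibreSpectrum ε hε A) β)) :=
  ⟨exists_isLeast_tubeSpectrum ε hε A, fun hA _ hn =>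
    exists_isNthSpectralBand hε ((isCriticalPotential_iff A).1 hA) hn⟩
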